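/- Let $D\ge 3$, let $U\subset\mathbb R^{D-2}$ be open, $\rho_0>0$, $G>0$, $\Lambda\in\mathbb R$, and use coordinates $(x^\mu)=(t,\rho,x^M)$, $M=2,\dots,D-1$, with $(x^M)=(\psi,\theta^A)$, $A=3,\dots,D-1$, on the domain $\mathcal M=\{t\in\mathbb R,\ 0\le\rho<\rho_0,\ (x^M)\in U\}$. The horizon is $\{\rho=0\}$ and $\partial\Sigma=\{t=\mathrm{const},\ \rho=0\}$. All components of fields below are smooth on $\mathcal M$ up to $\rho=0$, and $O(\rho^k)$ in an expansion of such fields means $\rho^k$ times a function smooth on $\mathcal M$. Let $\bar g$ be a symmetric tensor field on $\mathcal M$ which for $\rho>0$ is a Lorentzian metric satisfying the Einstein equations $R_{\mu\nu}-\frac12(R-2\Lambda)\bar g_{\mu\nu}=0$, with $$\bar g_{tt}=-\kappa^2\rho^2+O(\rho^4),\quad \bar g_{t\rho}=O(\rho^4),\quad \bar g_{t\psi}=f_{t\psi}\rho^2+O(\rho^4),\quad \bar g_{tA}=f_{tA}\rho^2+O(\rho^4),$$ $$\bar g_{\rho\rho}=1+O(\rho^2),\quad \bar g_{\rho\psi}=O(\rho^4),\quad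 \bar g_{\rho A}=O(\rho^3),\quad \bar g_{\psi\psi}=f_{\psi\psi}+O(\rho^2),\quad \bar g_{\psi A}=O(\rho^2),\quad \bar g_{AB}=\Omega_{AB}+O(\rho^2),$$ where $\kappa\neq0$ is constant and $f_{t\psi},f_{tA},f_{\psi\psi}>0$ and the positive definite matrix $\Omega_{AB}$ are smooth functions of $\theta^A$ only. Let $$\mathcal A=\{(T(x^M)+O(\rho^2),\ O(\rho^2),\ V^M(x^N)+O(\rho^2)) : T, V^M \text{ arbitrary smooth functions on } U\}.$$ For a metric $g$ and symmetric tensor fields $\delta_1g,\delta_2g$ let $$\omega^\nu(g,\delta_1g,\delta_2g)=\frac{\sqrt{-\det g}}{16\pi G}\Bigl(g^{\nu\alpha}(g^{\rho\sigma}g^{\beta\gamma}-2g^{\rho\beta}g^{\sigma\gamma})+2g^{\nu\gamma}g^{\rho[\alpha}g^{\sigma]\beta}+g^{\nu\rho}g^{\alpha\beta}g^{\sigma\gamma}\Bigr)\delta_{[1}g_{\rho\sigma}\nabla_\gamma\delta_{2]}g_{\alpha\beta}$$ be the pre-symplectic current ($\nabla$ is the Levi-Civita connection of $g$; brackets denote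 antisymmetrization with the factor $\frac12$). Then: 1. $\mathcal A$ is closed: it is a linear space of vector fields and is closed under commutators. More precisely, if $\xi,\eta\in\mathcal A$ have leading coefficients $(T_1,V_1)$ and $(T_2,V_2)$, then $[\xi,\eta]^t=V_1^M\partial_MT_2-V_2^M\partial_MT_1+O(\rho^2)$, $[\xi,\eta]^\rho=O(\rho^2)$ and $[\xi,\eta]^M=V_1^N\partial_NV_2^M-V_2^N\partial_NV_1^M+O(\rho^2)$. 2. $\mathcal A$ satisfies the sufficient condition for integrability: for all $\xi,\eta,\chi\in\mathcal A$, as $\rho\to0^+$ and locally uniformly near each point of the horizon, $\xi^t=O(1)$, $\xi^\rho=O(\rho)$, $\xi^M=O(1)$, and the current $\omega^\mu=\omega^\mu(\bar g,\pounds_\eta\bar g,\pounds_\chi\bar g)$ satisfies $\omega^t=O(1)$, $\omega^\rho=O(\rho)$, $\omega^M=O(1)$. 3. The charges of $\mathcal A$ are integrable: for every metric $g=\phi^*\bar g$, where $\phi$ is a finite composition of time-one flow maps of elements of $\mathcal A$, and for all $\xi,\eta,\chi\in\mathcal A$, $$\int_{\partial\Sigma}(d^{D-2}x)_{\mu\nu}\,\xi^{[\mu}\omega^{\nu]}(g,\pounds_\eta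 g,\pounds_\chi g)=0 .$$ Here $\phi$ may be defined only on a relatively open set $W\subset\mathcal M$, and the integral is understood as follows: for every $t$ and every compact $K\subset U$ with $\{t\}\times\{0\}\times K\subset W$, the integrand $\xi^{[t}\omega^{\rho]}$ is integrable over $K$ for all small $\rho>0$, and $\lim_{\rho\to0^+}\int_K\xi^{[t}\omega^{\rho]}(t,\rho,x^M)\,d^{D-2}x=0$. -/

import Mathlib

open scoped ContDiff Topology
open Set Filter MeasureTheory

noncomputable section

namespace KillingHorizon

/-! Coordinates `(t, ρ, ψ, θ^A)` of a spacetime of dimension `D = n + 3`: the index `0` is `t`, `1` is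
`ρ`, `2` is `ψ`, and the remaining `n` indices are the `θ^A`.  The indices `M = 2, …, D - 1` of the
cross-section `(ψ, θ^A)` are the `M.succ.succ` with `M : Fin (n + 1)`. -/

/-- Coordinate space of a `D`-dimensional spacetime, `D = n + 3`. -/
abbrev Coord (n : ℕ) := Fin (n + 3) → ℝ

/-- The cross-section coordinates `x^M = (ψ, θ^A)` of a point. -/
def crossPt {n : ℕ} (x : Coord n) : Fin (n + 1) → ℝ := fun M => x M.succ.succ

/-- The coordinates `θ^A` of a point `(ψ, θ^A)` of the cross-section. -/
def thetaPt {n : ℕ} (y : Fin (n + 1) → ℝ) : Fin n → ℝ := fun A => y A.succ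

/-- The point with coordinates `(t, ρ, y)`. -/
def slicePt {n : ℕ} (t ρ : ℝ) (y : Fin (n + 1) → ℝ) : Coord n :=
  Matrix.vecCons t (Matrix.vecCons ρ y)

/-- The coordinate domain of the spacetime: `t` is arbitrary, `0 ≤ ρ < ρ₀`, and `(ψ, θ^A) ∈ U`. -/
def region {n : ℕ} (ρ₀ : ℝ) (U : Set (Fin (n + 1) → ℝ)) : Set (Coord n) :=
  {x | 0 ≤ x 1 ∧ x 1 < ρ₀ ∧ crossPt x ∈ U}

/-- The horizon `ρ = 0`, the union of the boundaries of the surfaces `t = const`. -/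
def horizon {n : ℕ} (ρ₀ : ℝ) (U : Set (Fin (n + 1) → ℝ)) : Set (Coord n) :=
  {x | x ∈ region ρ₀ U ∧ x 1 = 0}

/-- The part `ρ > 0` of the coordinate domain. -/
def exterior {n : ℕ} (ρ₀ : ℝ) (U : Set (Fin (n + 1) → ℝ)) : Set (Coord n) :=
  {x | x ∈ region ρ₀ U ∧ 0 < x 1}

/-! ### Asymptotics as `ρ → 0` -/

/-- `O(ρ^k)` for the coefficients of the expansion of smooth fields: `ρ^k` times a function that is
smooth up to and including the horizon.  For a function that is smooth on the domain `0 ≤ ρ < ρ₀`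
this is the same as being bounded by a multiple of `ρ^k`, locally uniformly at `ρ = 0`. -/
def SmoothO {n : ℕ} (ρ₀ : ℝ) (U : Set (Fin (n + 1) → ℝ)) (k : ℕ) (f : Coord n → ℝ) : Prop :=
  ∃ r : Coord n → ℝ, ContDiffOn ℝ ∞ r (region ρ₀ U) ∧ ∀ x ∈ region ρ₀ U, f x = x 1 ^ k * r x

/-- `O(ρ^k)` as `ρ → 0` for a function on `ρ > 0`, near every point of the horizon. -/
def HorizonBigO {n : ℕ} (ρ₀ : ℝ) (U : Set (Fin (n + 1) → ℝ)) (k : ℕ) (f : Coord n → ℝ) : Prop :=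
  ∀ p ∈ horizon ρ₀ U, f =O[𝓝[exterior ρ₀ U] p] fun x => x 1 ^ k

/-! ### Tensor calculus in coordinates -/

/-- The partial derivative `∂_μ f`. -/
def pd {n : ℕ} (μ : Fin (n + 3)) (f : Coord n → ℝ) (x : Coord n) : ℝ :=
  fderiv ℝ f x (Pi.single μ 1)

/-- Fields of covariant 2-tensors, by their components. -/
abbrev Tensor2 (n : ℕ) := Coord n → Matrix (Fin (n + 3)) (Fin (n + 3)) ℝ

/-- Vector fields, by their components. -/
abbrev VField (n : ℕ) := Coord n → Coord n

/-- The Lie derivative `(£_ξ h)_{μν} = ξ^α ∂_α h_{μν} + h_{αν} ∂_μ ξ^α + h_{μα} ∂_ν ξ^α`. -/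
def lieDeriv {n : ℕ} (ξ : VField n) (h : Tensor2 n) : Tensor2 n := fun x μ ν =>
  ∑ α, (ξ x α * pd α (fun y => h y μ ν) x + h x α ν * pd μ (fun y => ξ y α) x
    + h x μ α * pd ν (fun y => ξ y α) x)

/-- The pull-back `(φ^* h)_{μν}(x) = h_{αβ}(φ(x)) ∂_μ φ^α ∂_ν φ^β`. -/
def pullback {n : ℕ} (φ : Coord n → Coord n) (h : Tensor2 n) : Tensor2 n := fun x μ ν =>
  ∑ α, ∑ β, h (φ x) α β * pd μ (fun y => φ y α) x * pd ν (fun y => φ y β) x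

/-- The Christoffel symbol `Γ^α_{μν}` of the metric `g`. -/
def christoffel {n : ℕ} (g : Tensor2 n) (α μ ν : Fin (n + 3)) (x : Coord n) : ℝ :=
  (1 / 2) * ∑ β, (g x)⁻¹ α β *
    (pd μ (fun y => g y β ν) x + pd ν (fun y => g y β μ) x - pd β (fun y => g y μ ν) x)

/-- The covariant derivative `∇_γ h_{αβ}` with respect to the Levi-Civita connection of `g`. -/
def covDeriv {n : ℕ} (g h : Tensor2 n) (γ α β : Fin (n + 3)) (x : Coord n) : ℝ :=
  pd γ (fun y => h y α β) x
    - ∑ δ, (christoffel g δ γ α x * h x δ β + christoffel g δ γ β x * h x α δ)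

/-- The Ricci tensor
`R_{μν} = ∂_α Γ^α_{μν} - ∂_ν Γ^α_{μα} + Γ^α_{αβ} Γ^β_{μν} - Γ^α_{νβ} Γ^β_{μα}`. -/
def ricci {n : ℕ} (g : Tensor2 n) (μ ν : Fin (n + 3)) (x : Coord n) : ℝ :=
  ∑ α, (pd α (christoffel g α μ ν) x - pd ν (christoffel g α μ α) x
    + ∑ β, (christoffel g α α β x * christoffel g β μ ν x
      - christoffel g α ν β x * christoffel g β μ α x))

/-- The Ricci scalar `R = g^{μν} R_{μν}`. -/
def scalarCurv {n : ℕ} (g : Tensor2 n) (x : Coord n) : ℝ :=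
  ∑ μ, ∑ ν, (g x)⁻¹ μ ν * ricci g μ ν x

/-- The pre-symplectic current `ω^ν(g, δ₁g, δ₂g)` of general relativity with Newton constant `G`:
`√(-g)/(16πG)` times the contraction of
`g^{να}(g^{ρσ} g^{βγ} - 2 g^{ρβ} g^{σγ}) + 2 g^{νγ} g^{ρ[α} g^{σ]β} + g^{νρ} g^{αβ} g^{σγ}`
with `δ_{[1} g_{ρσ} ∇_γ δ_{2]} g_{αβ}`, the brackets `[ ]` including the factor `1/2`.
It equals `δ₁Θ^ν(g, δ₂g) - δ₂Θ^ν(g, δ₁g)` for the pre-symplectic potential `Θ` of the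
Einstein-Hilbert Lagrangian. -/
def presymplecticCurrent {n : ℕ} (G : ℝ) (g h₁ h₂ : Tensor2 n) (ν : Fin (n + 3))
    (x : Coord n) : ℝ :=
  Real.sqrt (-(g x).det) / (16 * Real.pi * G) *
    ∑ r, ∑ s, ∑ c, ∑ a, ∑ b,
      ((g x)⁻¹ ν a * ((g x)⁻¹ r s * (g x)⁻¹ b c - 2 * (g x)⁻¹ r b * (g x)⁻¹ s c)
        + 2 * (g x)⁻¹ ν c
          * ((1 / 2) * ((g x)⁻¹ r a * (g x)⁻¹ s b - (g x)⁻¹ r s * (g x)⁻¹ a b))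
        + (g x)⁻¹ ν r * (g x)⁻¹ a b * (g x)⁻¹ s c)
      * ((1 / 2) * (h₁ x r s * covDeriv g h₂ c a b x - h₂ x r s * covDeriv g h₁ c a b x))

/-! ### The background metric -/

/-- The background metric `g` near a Killing horizon at `ρ = 0`: a Lorentzian solution, for `ρ > 0`,
of the Einstein equations with cosmological constant `Λ`, with the prescribed expansion as `ρ → 0`,
where the coefficients are functions of `θ^A` only and `κ` is constant. -/
structure IsBackground {n : ℕ} (ρ₀ : ℝ) (U : Set (Fin (n + 1) → ℝ)) (Λ κ : ℝ)
    (ftψ : (Fin n → ℝ) → ℝ) (ftA : (Fin n → ℝ) → Fin n → ℝ) (fψψ : (Fin n → ℝ) → ℝ)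
    (Ω : (Fin n → ℝ) → Matrix (Fin n) (Fin n) ℝ) (g : Tensor2 n) : Prop where
  smooth_ftψ : ContDiffOn ℝ ∞ (fun y => ftψ (thetaPt y)) U
  smooth_ftA : ∀ A, ContDiffOn ℝ ∞ (fun y => ftA (thetaPt y) A) U
  smooth_fψψ : ContDiffOn ℝ ∞ (fun y => fψψ (thetaPt y)) U
  smooth_Ω : ∀ A B, ContDiffOn ℝ ∞ (fun y => Ω (thetaPt y) A B) U
  fψψ_pos : ∀ y ∈ U, 0 < fψψ (thetaPt y)
  Ω_posDef : ∀ y ∈ U, (Ω (thetaPt y)).PosDef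
  symm : ∀ x ∈ region ρ₀ U, (g x).IsSymm
  tt : SmoothO ρ₀ U 4 fun x => g x 0 0 - (-κ ^ 2 * x 1 ^ 2)
  tρ : SmoothO ρ₀ U 4 fun x => g x 0 1
  tψ : SmoothO ρ₀ U 4 fun x => g x 0 2 - ftψ (thetaPt (crossPt x)) * x 1 ^ 2
  tA : ∀ A : Fin n, SmoothO ρ₀ U 4 fun x =>
    g x 0 A.succ.succ.succ - ftA (thetaPt (crossPt x)) A * x 1 ^ 2
  ρρ : SmoothO ρ₀ U 2 fun x => g x 1 1 - 1
  ρψ : SmoothO ρ₀ U 4 fun x => g x 1 2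
  ρA : ∀ A : Fin n, SmoothO ρ₀ U 3 fun x => g x 1 A.succ.succ.succ
  ψψ : SmoothO ρ₀ U 2 fun x => g x 2 2 - fψψ (thetaPt (crossPt x))
  ψA : ∀ A : Fin n, SmoothO ρ₀ U 2 fun x => g x 2 A.succ.succ.succ
  AB : ∀ A B : Fin n, SmoothO ρ₀ U 2 fun x =>
    g x A.succ.succ.succ B.succ.succ.succ - Ω (thetaPt (crossPt x)) A B
  lorentzian : ∀ x ∈ exterior ρ₀ U, ∃ P : Matrix (Fin (n + 3)) (Fin (n + 3)) ℝ,
    IsUnit P.det ∧ P.transpose * g x * P = Matrix.diagonal fun μ => if μ = 0 then -1 else 1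
  einstein : ∀ x ∈ exterior ρ₀ U, ∀ μ ν,
    ricci g μ ν x - (1 / 2) * (scalarCurv g x - 2 * Λ) * g x μ ν = 0

/-! ### The algebra of supertranslations and superrotations -/

/-- `ξ = (T(x^M) + O(ρ²), O(ρ²), V^M(x^N) + O(ρ²))` with smooth `T` and `V^M`. -/
structure HasLeading {n : ℕ} (ρ₀ : ℝ) (U : Set (Fin (n + 1) → ℝ)) (ξ : VField n)
    (T : (Fin (n + 1) → ℝ) → ℝ) (V : (Fin (n + 1) → ℝ) → Fin (n + 1) → ℝ) : Prop where
  smooth_T : ContDiffOn ℝ ∞ T U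
  smooth_V : ContDiffOn ℝ ∞ V U
  t : SmoothO ρ₀ U 2 fun x => ξ x 0 - T (crossPt x)
  ρ : SmoothO ρ₀ U 2 fun x => ξ x 1
  cross : ∀ M : Fin (n + 1), SmoothO ρ₀ U 2 fun x => ξ x M.succ.succ - V (crossPt x) M

/-- The set of vector fields `(T + O(ρ²), O(ρ²), V^M + O(ρ²))` with arbitrary `T` and `V^M`. -/
def stsr {n : ℕ} (ρ₀ : ℝ) (U : Set (Fin (n + 1) → ℝ)) : Set (VField n) :=
  {ξ | ∃ T V, HasLeading ρ₀ U ξ T V}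

/-- `𝒜` is closed as an algebra of vector fields on the domain `0 ≤ ρ < ρ₀`: it is a linear space
and contains the commutators `[ξ, η]^μ = ξ^α ∂_α η^μ - η^α ∂_α ξ^μ` (one-sided derivatives at
`ρ = 0`). -/
def IsClosedAlgebra {n : ℕ} (ρ₀ : ℝ) (U : Set (Fin (n + 1) → ℝ)) (𝒜 : Set (VField n)) : Prop :=
  (0 : VField n) ∈ 𝒜 ∧ (∀ ξ ∈ 𝒜, ∀ η ∈ 𝒜, ξ + η ∈ 𝒜) ∧ (∀ c : ℝ, ∀ ξ ∈ 𝒜, c • ξ ∈ 𝒜) ∧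
    ∀ ξ ∈ 𝒜, ∀ η ∈ 𝒜, VectorField.lieBracketWithin ℝ ξ η (region ρ₀ U) ∈ 𝒜

/-! ### Integrability of the charges -/

/-- The sufficient condition for integrability, at the background metric `g`: the vector fields
preserve the horizon, `ξ^t = O(1)`, `ξ^ρ = O(ρ)`, `ξ^M = O(1)`, and the pre-symplectic current
`ω^μ(g, £_η g, £_χ g)` satisfies `ω^t = O(1)`, `ω^ρ = O(ρ)`, `ω^M = O(1)`. -/
def SufficientCondition {n : ℕ} (G ρ₀ : ℝ) (U : Set (Fin (n + 1) → ℝ)) (g : Tensor2 n)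
    (𝒜 : Set (VField n)) : Prop :=
  (∀ ξ ∈ 𝒜, HorizonBigO ρ₀ U 0 (fun x => ξ x 0) ∧ HorizonBigO ρ₀ U 1 (fun x => ξ x 1) ∧
    ∀ M : Fin (n + 1), HorizonBigO ρ₀ U 0 (fun x => ξ x M.succ.succ)) ∧
  ∀ η ∈ 𝒜, ∀ χ ∈ 𝒜,
    HorizonBigO ρ₀ U 0 (presymplecticCurrent G g (lieDeriv η g) (lieDeriv χ g) 0) ∧
    HorizonBigO ρ₀ U 1 (presymplecticCurrent G g (lieDeriv η g) (lieDeriv χ g) 1) ∧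
    ∀ M : Fin (n + 1), HorizonBigO ρ₀ U 0
      (presymplecticCurrent G g (lieDeriv η g) (lieDeriv χ g) M.succ.succ)

/-- `φ = exp ξ` on the relatively open set `W`: every point of `W` can be moved along the flow of
`ξ` for time `1` inside the spacetime domain, and `φ` is the resulting (smooth) map. -/
def IsExpOn {n : ℕ} (ρ₀ : ℝ) (U : Set (Fin (n + 1) → ℝ)) (ξ : VField n) (W : Set (Coord n))
    (φ : Coord n → Coord n) : Prop :=
  (∃ O : Set (Coord n), IsOpen O ∧ W = O ∩ region ρ₀ U) ∧
  ∃ Φ : ℝ → Coord n → Coord n,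
    ContDiffOn ℝ ∞ (fun p : ℝ × Coord n => Φ p.1 p.2) (Icc (0 : ℝ) 1 ×ˢ W) ∧
    ∀ x ∈ W, Φ 0 x = x ∧ Φ 1 x = φ x ∧ ∀ s ∈ Icc (0 : ℝ) 1, Φ s x ∈ region ρ₀ U ∧
      HasDerivWithinAt (fun s' => Φ s' x) (ξ (Φ s x)) (Icc 0 1) s

/-- The diffeomorphisms generated by `𝒜`: finite compositions `exp ξ⁽ᴺ⁾ ∘ ⋯ ∘ exp ξ⁽¹⁾` with
`ξ⁽ⁱ⁾ ∈ 𝒜`, on any relatively open set `W` of the spacetime domain on which they are defined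
(`W` may be the whole domain). -/
inductive Generated {n : ℕ} (ρ₀ : ℝ) (U : Set (Fin (n + 1) → ℝ)) (𝒜 : Set (VField n)) :
    Set (Coord n) → (Coord n → Coord n) → Prop
  | refl (O : Set (Coord n)) (hO : IsOpen O) : Generated ρ₀ U 𝒜 (O ∩ region ρ₀ U) id
  | step (W W' : Set (Coord n)) (φ φ' : Coord n → Coord n) (ξ : VField n)
      (hφ : Generated ρ₀ U 𝒜 W φ) (hξ : ξ ∈ 𝒜) (hφ' : IsExpOn ρ₀ U ξ W' φ')
      (hW : MapsTo φ W W') : Generated ρ₀ U 𝒜 W (φ' ∘ φ)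

/-- The integrand `ξ^{[t} ω^{ρ]}(g, £_η g, £_χ g)` of the integral of
`ξ^{[μ} ω^{ν]} (d^{D-2}x)_{μν}` over a surface of constant `t` and `ρ`. -/
def integrand {n : ℕ} (G : ℝ) (g : Tensor2 n) (ξ η χ : VField n) (x : Coord n) : ℝ :=
  (1 / 2) * (ξ x 0 * presymplecticCurrent G g (lieDeriv η g) (lieDeriv χ g) 1 x
    - ξ x 1 * presymplecticCurrent G g (lieDeriv η g) (lieDeriv χ g) 0 x)

/-- The charges are integrable: `∫_{∂Σ} ξ^{[μ} ω^{ν]}(g, £_η g, £_χ g) (d^{D-2}x)_{μν} = 0` for all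
`ξ, η, χ ∈ 𝒜` and all metrics `g = φ^* ḡ`, with `φ` a diffeomorphism generated by `𝒜`.
The integral over the boundary `∂Σ` of the surface `t = const` is the limit as `ρ → 0` of the
integrals at constant `t` and `ρ > 0`, and it is required to vanish over each compact piece `K` of
the cross-section. -/
def ChargesIntegrable {n : ℕ} (G ρ₀ : ℝ) (U : Set (Fin (n + 1) → ℝ)) (g : Tensor2 n)
    (𝒜 : Set (VField n)) : Prop :=
  ∀ (W : Set (Coord n)) (φ : Coord n → Coord n), Generated ρ₀ U 𝒜 W φ →
    ∀ ξ ∈ 𝒜, ∀ η ∈ 𝒜, ∀ χ ∈ 𝒜, ∀ (t : ℝ) (K : Set (Fin (n + 1) → ℝ)), IsCompact K →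
      (∀ y ∈ K, slicePt t 0 y ∈ W) →
      (∀ᶠ ρ in 𝓝[>] (0 : ℝ),
        IntegrableOn (fun y => integrand G (pullback φ g) ξ η χ (slicePt t ρ y)) K) ∧
      Tendsto (fun ρ => ∫ y in K, integrand G (pullback φ g) ξ η χ (slicePt t ρ y))
        (𝓝[>] (0 : ℝ)) (𝓝 0)

end KillingHorizon

end

/-!
The metric degenerates at the horizon, but its components in the frame `ρ dt, dρ, dx^M` converge to
the nondegenerate block matrix `diag(-κ², 1, g_{MN})`. So each lower index `t` of a tensor counts as
a factor `ρ`, each upper index `t` as a factor `ρ⁻¹`, and `√(-det g) = O(ρ)`. In general the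
derivatives `∂_ρ` and `∂_t` break this rule: the former lowers the power of `ρ`, and the latter does
not raise it. However, the leading coefficients of the algebra depend on `x^M` only, so that every
component of `h = £_η g` other than the `h_{MN}` has a factor `ρ` to spare, and `∂_t h_{MN}`
vanishes at the horizon. Hence `∇h` respects the rule too, and counting indices in `ω` gives
`ω^t = O(1)` and `ω^ρ, ω^M = O(ρ)`. In particular `ξ^t ω^ρ - ξ^ρ ω^t = O(ρ)`.

An element of the algebra is tangent to the horizon, and its derivatives along `∂_t` and `∂_ρ` are
zero there. By the variational equation, the derivative of its flow fixes `∂_t` and `∂_ρ` at the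
horizon. This is enough for the pulled-back metrics to inherit the asymptotics used above, so that
the same bound holds for them.
-/

noncomputable section

namespace KillingHorizon

variable {n : ℕ}

/-! ### Calculus up to the boundary of the half space -/

/-- The half space `0 ≤ ρ`, whose boundary is the horizon. -/
def halfSpace (n : ℕ) : Set (Coord n) := {x | 0 ≤ x 1}

/-- The open half space `0 < ρ`. -/
def openHalfSpace (n : ℕ) : Set (Coord n) := {x | 0 < x 1}

lemma isOpen_openHalfSpace : IsOpen (openHalfSpace n) :=
  isOpen_lt continuous_const (continuous_apply 1)

lemma openHalfSpace_subset_halfSpace : openHalfSpace n ⊆ halfSpace n :=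
  fun _ hx => mem_ofPred.2 (le_of_lt hx)

lemma halfSpace_mem_nhds {x : Coord n} (hx : 0 < x 1) : halfSpace n ∈ 𝓝 x :=
  mem_of_superset (isOpen_openHalfSpace.mem_nhds hx) openHalfSpace_subset_halfSpace

lemma convex_halfSpace : Convex ℝ (halfSpace n) :=
  convex_halfSpace_ge (f := fun x : Coord n => x 1) ⟨fun _ _ => rfl, fun _ _ => rfl⟩ 0

lemma interior_halfSpace_nonempty : (interior (halfSpace n)).Nonempty :=
  ⟨fun _ => 1, mem_interior_iff_mem_nhds.2 (halfSpace_mem_nhds one_pos)⟩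

lemma uniqueDiffOn_halfSpace : UniqueDiffOn ℝ (halfSpace n) :=
  uniqueDiffOn_convex convex_halfSpace interior_halfSpace_nonempty

lemma halfSpace_subset_closure_interior : halfSpace n ⊆ closure (interior (halfSpace n)) := by
  rw [convex_halfSpace.closure_interior_eq_closure_of_nonempty_interior
    interior_halfSpace_nonempty]
  exact subset_closure

/-- The partial derivative `∂_μ f` on the half space, one-sided at `ρ = 0`. -/
def pdWithin (μ : Fin (n + 3)) (f : Coord n → ℝ) (x : Coord n) : ℝ :=
  fderivWithin ℝ f (halfSpace n) x (Pi.single μ 1)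

lemma pd_eq_pdWithin {μ : Fin (n + 3)} {f : Coord n → ℝ} {x : Coord n} (hx : 0 < x 1) :
    pd μ f x = pdWithin μ f x := by
  rw [pd, pdWithin, fderivWithin_of_mem_nhds (halfSpace_mem_nhds hx)]

lemma clm_apply_eq_sum {ι E : Type*} [Fintype ι] [DecidableEq ι] [NormedAddCommGroup E]
    [NormedSpace ℝ E] (A : (ι → ℝ) →L[ℝ] E) (v : ι → ℝ) :
    A v = ∑ i, v i • A (Pi.single i 1) := by
  conv_lhs => rw [pi_eq_sum_univ' v, map_sum]
  exact Finset.sum_congr rfl fun i _ => A.map_smul _ _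

lemma two_le_smooth : (2 : WithTop ℕ∞) ≤ ∞ := WithTop.coe_le_coe.2 (le_top : (2 : ℕ∞) ≤ ⊤)

section SecondDerivative

variable {E F : Type*} [NormedAddCommGroup E] [NormedSpace ℝ E] [NormedAddCommGroup F]
  [NormedSpace ℝ F] {f : E → F} {s : Set E} {x : E}

lemma fderivWithin_fderivWithin_apply (hf : ContDiffWithinAt ℝ 2 f s x) (hs : UniqueDiffOn ℝ s)
    (hx : x ∈ s) (u v : E) : fderivWithin ℝ (fun y => fderivWithin ℝ f s y v) s x u =
      fderivWithin ℝ (fderivWithin ℝ f s) s x u v := by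
  have hd : DifferentiableWithinAt ℝ (fderivWithin ℝ f s) s x :=
    (hf.fderivWithin_right (m := 1) hs le_rfl hx).differentiableWithinAt one_ne_zero
  have hv := hd.hasFDerivWithinAt.clm_apply (hasFDerivWithinAt_const v x s)
  simp [hv.fderivWithin (hs x hx)]

lemma fderivWithin_fderivWithin_apply_comm (hf : ContDiffWithinAt ℝ 2 f s x)
    (hs : UniqueDiffOn ℝ s) (hxi : x ∈ closure (interior s)) (hx : x ∈ s) (u v : E) :
    fderivWithin ℝ (fun y => fderivWithin ℝ f s y v) s x u =
      fderivWithin ℝ (fun y => fderivWithin ℝ f s y u) s x v := by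
  rw [fderivWithin_fderivWithin_apply hf hs hx, fderivWithin_fderivWithin_apply hf hs hx,
    hf.isSymmSndFDerivWithinAt (by simp) hs hxi hx]

end SecondDerivative

/-- Smoothness up to `ρ = 0` at the points of `O` with `0 ≤ ρ`. The set `O` is meant to be open in
the whole coordinate space; only its part in the half space matters. -/
def SmoothUpTo (O : Set (Coord n)) (f : Coord n → ℝ) : Prop :=
  ∀ x ∈ O, x ∈ halfSpace n → ContDiffWithinAt ℝ ∞ f (halfSpace n) x

section SmoothUpTo

variable {O O' : Set (Coord n)} {f g : Coord n → ℝ} {φ : Coord n → Coord n} {x : Coord n}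

lemma smoothUpTo_iff_contDiffOn (hO : IsOpen O) :
    SmoothUpTo O f ↔ ContDiffOn ℝ ∞ f (O ∩ halfSpace n) := by
  refine ⟨fun h x hx => (h x hx.1 hx.2).mono inter_subset_right, fun h x hx hx' => ?_⟩
  have hf := h x ⟨hx, hx'⟩
  rw [inter_comm] at hf
  exact (contDiffWithinAt_inter (hO.mem_nhds hx)).1 hf

namespace SmoothUpTo

lemma differentiableWithinAt (h : SmoothUpTo O f) (hx : x ∈ O) (hx' : x ∈ halfSpace n) :
    DifferentiableWithinAt ℝ f (halfSpace n) x :=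
  (h x hx hx').differentiableWithinAt (by simp)

protected lemma pdWithin (h : SmoothUpTo O f) (μ : Fin (n + 3)) : SmoothUpTo O (pdWithin μ f) :=
  fun x hx hx' => (h x hx hx').fderivWithin_right_apply contDiffWithinAt_const
    uniqueDiffOn_halfSpace (by simp) hx'

lemma subset (h : SmoothUpTo O f) (hO : O' ⊆ O) : SmoothUpTo O' f :=
  fun x hx hx' => h x (hO hx) hx'

protected lemma add (hf : SmoothUpTo O f) (hg : SmoothUpTo O g) :
    SmoothUpTo O fun x => f x + g x :=
  fun x hx hx' => (hf x hx hx').add (hg x hx hx')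

protected lemma mul (hf : SmoothUpTo O f) (hg : SmoothUpTo O g) :
    SmoothUpTo O fun x => f x * g x :=
  fun x hx hx' => (hf x hx hx').mul (hg x hx hx')

end SmoothUpTo

lemma smoothUpTo_const (c : ℝ) : SmoothUpTo O fun _ => c := fun _ _ _ => contDiffWithinAt_const

lemma smoothUpTo_coord (μ : Fin (n + 3)) : SmoothUpTo O fun x => x μ :=
  fun _ _ _ => (contDiff_apply ℝ ℝ μ).contDiffWithinAt

lemma eventuallyEq_nhdsWithin_halfSpace (hO : IsOpen O)
    (h : ∀ x ∈ O, x ∈ halfSpace n → f x = g x) (hx : x ∈ O) : f =ᶠ[𝓝[halfSpace n] x] g := by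
  filter_upwards [mem_nhdsWithin_of_mem_nhds (hO.mem_nhds hx), self_mem_nhdsWithin] with y hy hy'
  exact h y hy hy'

lemma SmoothUpTo.congr (hO : IsOpen O) (hf : SmoothUpTo O f)
    (h : ∀ x ∈ O, x ∈ halfSpace n → g x = f x) : SmoothUpTo O g :=
  fun x hx hx' => (hf x hx hx').congr_of_eventuallyEq
    (eventuallyEq_nhdsWithin_halfSpace hO h hx) (h x hx hx')

lemma pdWithin_congr (hO : IsOpen O) (h : ∀ x ∈ O, x ∈ halfSpace n → f x = g x)
    (μ : Fin (n + 3)) (hx : x ∈ O) (hx' : x ∈ halfSpace n) : pdWithin μ f x = pdWithin μ g x := by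
  rw [pdWithin, pdWithin,
    (eventuallyEq_nhdsWithin_halfSpace hO h hx).fderivWithin_eq (h x hx hx')]

lemma pdWithin_add (hf : SmoothUpTo O f) (hg : SmoothUpTo O g) (μ : Fin (n + 3)) (hx : x ∈ O)
    (hx' : x ∈ halfSpace n) :
    pdWithin μ (fun y => f y + g y) x = pdWithin μ f x + pdWithin μ g x := by
  simp only [pdWithin, fderivWithin_fun_add (uniqueDiffOn_halfSpace x hx')
    (hf.differentiableWithinAt hx hx') (hg.differentiableWithinAt hx hx'), add_apply]

lemma pdWithin_mul (hf : SmoothUpTo O f) (hg : SmoothUpTo O g) (μ : Fin (n + 3)) (hx : x ∈ O)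
    (hx' : x ∈ halfSpace n) :
    pdWithin μ (fun y => f y * g y) x = pdWithin μ f x * g x + f x * pdWithin μ g x := by
  simp only [pdWithin, fderivWithin_fun_mul (uniqueDiffOn_halfSpace x hx')
    (hf.differentiableWithinAt hx hx') (hg.differentiableWithinAt hx hx'), add_apply, smul_apply,
    smul_eq_mul]
  ring

lemma pdWithin_const (μ : Fin (n + 3)) (c : ℝ) : pdWithin μ (fun _ => c) = fun _ => 0 := by
  ext x
  simp [pdWithin]

lemma pdWithin_coord (μ ν : Fin (n + 3)) (hx : x ∈ halfSpace n) :
    pdWithin μ (fun y => y ν) x = if ν = μ then 1 else 0 := by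
  have hν : HasFDerivWithinAt (fun y : Coord n => y ν)
      (ContinuousLinearMap.proj (R := ℝ) (φ := fun _ => ℝ) ν) (halfSpace n) x :=
    (ContinuousLinearMap.proj (R := ℝ) (φ := fun _ => ℝ) ν).hasFDerivWithinAt
  rw [pdWithin, hν.fderivWithin (uniqueDiffOn_halfSpace x hx)]
  simp [Pi.single_apply]

lemma pdWithin_comm (hf : SmoothUpTo O f) (μ ν : Fin (n + 3)) (hx : x ∈ O)
    (hx' : x ∈ halfSpace n) :
    pdWithin μ (pdWithin ν f) x = pdWithin ν (pdWithin μ f) x :=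
  fderivWithin_fderivWithin_apply_comm ((hf x hx hx').of_le two_le_smooth) uniqueDiffOn_halfSpace
    (halfSpace_subset_closure_interior hx') hx' _ _

lemma pdWithin_eq_zero_of_eq_zero_on_horizon (hO : IsOpen O) (hf : SmoothUpTo O f)
    (h0 : ∀ x ∈ O, x 1 = 0 → f x = 0) {μ : Fin (n + 3)} (hμ : μ ≠ 1) (hx : x ∈ O)
    (hx1 : x 1 = 0) : pdWithin μ f x = 0 := by
  set c : ℝ → Coord n := fun s => x + s • (Pi.single μ 1 : Coord n) with hc
  have hc_zero : c 0 = x := by simp [hc]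
  have hc_horizon (s : ℝ) : c s 1 = 0 := by simp [hc, hx1, hμ.symm]
  have hc_deriv : HasDerivAt c (Pi.single μ 1) 0 := by
    have h := (hasDerivAt_id (0 : ℝ)).smul_const (Pi.single μ 1 : Coord n)
    rw [one_smul] at h
    exact h.const_add x
  have hf_deriv := (hf.differentiableWithinAt hx hx1.ge).hasFDerivWithinAt
  rw [← hc_zero] at hf_deriv
  have hfc : HasDerivAt (f ∘ c) (pdWithin μ f (c 0)) 0 :=
    hf_deriv.comp_hasDerivAt (0 : ℝ) hc_deriv (.of_forall fun s => (hc_horizon s).ge)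
  have hfc_zero : f ∘ c =ᶠ[𝓝 0] fun _ => 0 := by
    have hcO : c ⁻¹' O ∈ 𝓝 0 := hc_deriv.continuousAt (hO.mem_nhds (hc_zero ▸ hx))
    filter_upwards [hcO] with s hs using h0 _ hs (hc_horizon s)
  rw [← hc_zero]
  exact hfc.unique ((hasDerivAt_const (0 : ℝ) (0 : ℝ)).congr_of_eventuallyEq hfc_zero)

lemma pdWithin_comp (hO : IsOpen O) (hφ : ∀ μ, SmoothUpTo O fun x => φ x μ)
    (hm : ∀ x ∈ O, x ∈ halfSpace n → φ x ∈ O' ∧ φ x ∈ halfSpace n) (hf : SmoothUpTo O' f)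
    (μ : Fin (n + 3)) (hx : x ∈ O) (hx' : x ∈ halfSpace n) :
    pdWithin μ (fun y => f (φ y)) x =
      ∑ α, pdWithin α f (φ x) * pdWithin μ (fun y => φ y α) x := by
  have hf' := (hf.differentiableWithinAt (hm x hx hx').1 (hm x hx hx').2).hasFDerivWithinAt
  have hφ' : HasFDerivWithinAt φ (ContinuousLinearMap.pi fun α =>
      fderivWithin ℝ (fun y => φ y α) (halfSpace n) x) (halfSpace n ∩ O) x :=
    hasFDerivWithinAt_pi'.2 fun α =>
      ((hφ α).differentiableWithinAt hx hx').hasFDerivWithinAt.mono inter_subset_left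
  have hfφ := (hasFDerivWithinAt_inter (hO.mem_nhds hx)).1
    (hf'.comp x hφ' fun y hy => (hm y hy.2 hy.1).2)
  change fderivWithin ℝ (f ∘ φ) (halfSpace n) x (Pi.single μ 1) = _
  rw [hfφ.fderivWithin (uniqueDiffOn_halfSpace x hx'), ContinuousLinearMap.comp_apply,
    clm_apply_eq_sum]
  exact Finset.sum_congr rfl fun α _ => mul_comm _ _

lemma SmoothUpTo.comp (hO : IsOpen O) (hφ : ∀ μ, SmoothUpTo O fun x => φ x μ)
    (hm : ∀ x ∈ O, x ∈ halfSpace n → φ x ∈ O' ∧ φ x ∈ halfSpace n) (hf : SmoothUpTo O' f) :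
    SmoothUpTo O fun x => f (φ x) := by
  intro x hx hx'
  have hφx : ContDiffWithinAt ℝ ∞ φ (halfSpace n ∩ O) x :=
    contDiffWithinAt_pi.2 fun α => (hφ α x hx hx').mono inter_subset_left
  exact (contDiffWithinAt_inter (hO.mem_nhds hx)).1
    ((hf _ (hm x hx hx').1 (hm x hx hx').2).comp x hφx fun y hy => (hm y hy.2 hy.1).2)

end SmoothUpTo

/-- `f` is smooth up to `ρ = 0` on `O`, and its `ρ`-derivatives of order less than `k` vanish at
`ρ = 0`. This is how `O(ρ^k)` is handled for smooth coefficients: it is stable under tangential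
derivatives by definition, without dividing by `ρ^k`. -/
def VanishesToOrder (O : Set (Coord n)) : ℕ → (Coord n → ℝ) → Prop
  | 0, f => SmoothUpTo O f
  | k + 1, f => SmoothUpTo O f ∧ (∀ x ∈ O, x 1 = 0 → f x = 0) ∧ VanishesToOrder O k (pdWithin 1 f)

section VanishesToOrder

variable {O O' : Set (Coord n)} {f g : Coord n → ℝ} {k l : ℕ}

namespace VanishesToOrder

lemma smoothUpTo (h : VanishesToOrder O k f) : SmoothUpTo O f := by
  cases k with
  | zero => exact h
  | succ k => exact h.1

lemma eq_zero (h : VanishesToOrder O (k + 1) f) {x : Coord n} (hx : x ∈ O) (hx1 : x 1 = 0) :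
    f x = 0 :=
  h.2.1 x hx hx1

end VanishesToOrder

lemma vanishesToOrder_one (h : SmoothUpTo O f) (h0 : ∀ x ∈ O, x 1 = 0 → f x = 0) :
    VanishesToOrder O 1 f :=
  ⟨h, h0, h.pdWithin 1⟩

lemma vanishesToOrder_zero_fun : VanishesToOrder O k fun _ => 0 := by
  induction k with
  | zero => exact smoothUpTo_const 0
  | succ k ih => exact ⟨smoothUpTo_const 0, fun _ _ _ => rfl, by rwa [pdWithin_const]⟩

lemma vanishesToOrder_rho : VanishesToOrder O 1 fun x => x 1 :=
  vanishesToOrder_one (smoothUpTo_coord 1) fun _ _ h => h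

namespace VanishesToOrder

protected lemma congr (hO : IsOpen O) (hf : VanishesToOrder O k f)
    (h : ∀ x ∈ O, x ∈ halfSpace n → g x = f x) : VanishesToOrder O k g := by
  induction k generalizing f g with
  | zero => exact SmoothUpTo.congr hO hf h
  | succ k ih =>
    refine ⟨hf.1.congr hO h, fun x hx hx1 => ?_,
      ih hf.2.2 fun x hx hx' => pdWithin_congr hO h 1 hx hx'⟩
    rw [h x hx hx1.ge, hf.eq_zero hx hx1]

lemma subset (hf : VanishesToOrder O k f) (h : O' ⊆ O) : VanishesToOrder O' k f := by
  induction k generalizing f with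
  | zero => exact SmoothUpTo.subset hf h
  | succ k ih => exact ⟨hf.1.subset h, fun x hx hx1 => hf.eq_zero (h hx) hx1, ih hf.2.2⟩

lemma mono (hf : VanishesToOrder O k f) (h : l ≤ k) : VanishesToOrder O l f := by
  induction k generalizing f l with
  | zero =>
    obtain rfl : l = 0 := Nat.le_zero.1 h
    exact hf
  | succ k ih =>
    cases l with
    | zero => exact hf.1
    | succ l => exact ⟨hf.1, hf.2.1, ih hf.2.2 (Nat.le_of_succ_le_succ h)⟩

protected lemma max (hf : VanishesToOrder O k f) (hf' : VanishesToOrder O l f) :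
    VanishesToOrder O (max k l) f := by
  obtain h | h := max_choice k l <;> rwa [h]

protected lemma add (hO : IsOpen O) (hf : VanishesToOrder O k f) (hg : VanishesToOrder O k g) :
    VanishesToOrder O k fun x => f x + g x := by
  induction k generalizing f g with
  | zero => exact SmoothUpTo.add hf hg
  | succ k ih =>
    refine ⟨hf.1.add hg.1, fun x hx hx1 => ?_,
      (ih hf.2.2 hg.2.2).congr hO fun x hx hx' => pdWithin_add hf.1 hg.1 1 hx hx'⟩
    simp only [hf.eq_zero hx hx1, hg.eq_zero hx hx1, add_zero]

protected lemma sum (hO : IsOpen O) {ι : Type*} (s : Finset ι) {F : ι → Coord n → ℝ}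
    (h : ∀ i ∈ s, VanishesToOrder O k (F i)) : VanishesToOrder O k fun x => ∑ i ∈ s, F i x := by
  classical
  induction s using Finset.induction_on with
  | empty => simpa only [Finset.sum_empty] using vanishesToOrder_zero_fun
  | insert a s ha ih =>
    simp only [Finset.sum_insert ha]
    exact (h a (by simp)).add hO (ih fun i hi => h i (by simp [hi]))

lemma pdWithin_rho (hf : VanishesToOrder O k f) : VanishesToOrder O (k - 1) (pdWithin 1 f) := by
  cases k with
  | zero => exact SmoothUpTo.pdWithin hf 1
  | succ k => exact hf.2.2

protected lemma mul (hO : IsOpen O) (hf : VanishesToOrder O k f) (hg : VanishesToOrder O l g) :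
    VanishesToOrder O (k + l) fun x => f x * g x := by
  induction hm : k + l generalizing k l f g with
  | zero => exact hf.smoothUpTo.mul hg.smoothUpTo
  | succ m ih =>
    have hfg' : VanishesToOrder O m fun x => pdWithin 1 f x * g x := by
      cases k with
      | zero => exact ih hf.pdWithin_rho (hg.mono (l := m) (by omega)) (by omega)
      | succ k => exact ih hf.pdWithin_rho hg (by omega)
    have hf'g : VanishesToOrder O m fun x => f x * pdWithin 1 g x := by
      cases l with
      | zero => exact ih (hf.mono (l := m) (by omega)) hg.pdWithin_rho (by omega)
      | succ l => exact ih hf hg.pdWithin_rho (by omega)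
    refine ⟨hf.smoothUpTo.mul hg.smoothUpTo, fun x hx hx1 => ?_, (hfg'.add hO hf'g).congr hO
      fun x hx hx' => pdWithin_mul hf.smoothUpTo hg.smoothUpTo 1 hx hx'⟩
    rcases k with _ | k
    · simp only [(hg.mono (l := 1) (by omega)).eq_zero hx hx1, mul_zero]
    · simp only [hf.eq_zero hx hx1, zero_mul]

lemma const_mul (hO : IsOpen O) (hf : VanishesToOrder O k f) (c : ℝ) :
    VanishesToOrder O k fun x => c * f x := by
  simpa only [zero_add] using VanishesToOrder.mul hO (k := 0) (smoothUpTo_const c) hf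

protected lemma neg (hO : IsOpen O) (hf : VanishesToOrder O k f) :
    VanishesToOrder O k fun x => -f x := by
  simpa only [neg_one_mul] using hf.const_mul hO (-1)

protected lemma sub (hO : IsOpen O) (hf : VanishesToOrder O k f) (hg : VanishesToOrder O k g) :
    VanishesToOrder O k fun x => f x - g x := by
  simpa only [sub_eq_add_neg] using hf.add hO (hg.neg hO)

lemma pdWithin_tangent (hO : IsOpen O) (hf : VanishesToOrder O k f) {μ : Fin (n + 3)}
    (hμ : μ ≠ 1) : VanishesToOrder O k (pdWithin μ f) := by
  induction k generalizing f with
  | zero => exact SmoothUpTo.pdWithin hf μ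
  | succ k ih =>
    exact ⟨hf.1.pdWithin μ,
      fun x hx hx1 => pdWithin_eq_zero_of_eq_zero_on_horizon hO hf.1 hf.2.1 hμ hx hx1,
      (ih hf.2.2).congr hO fun x hx hx' => pdWithin_comm hf.1 1 μ hx hx'⟩

protected lemma pdWithin (hO : IsOpen O) (hf : VanishesToOrder O k f) (μ : Fin (n + 3)) :
    VanishesToOrder O (k - 1) (pdWithin μ f) := by
  obtain rfl | hμ := eq_or_ne μ 1
  · exact hf.pdWithin_rho
  · exact (hf.pdWithin_tangent hO hμ).mono (Nat.sub_le k 1)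

lemma comp {φ : Coord n → Coord n} (hO : IsOpen O) (hO' : IsOpen O')
    (hφ : ∀ μ, SmoothUpTo O fun x => φ x μ)
    (hm : ∀ x ∈ O, x ∈ halfSpace n → φ x ∈ O' ∧ φ x ∈ halfSpace n)
    (hh : ∀ x ∈ O, x 1 = 0 → φ x 1 = 0) (hf : VanishesToOrder O' k f) :
    VanishesToOrder O k fun x => f (φ x) := by
  induction k generalizing f with
  | zero => exact SmoothUpTo.comp hO hφ hm hf
  | succ k ih =>
    refine ⟨hf.1.comp hO hφ hm,
      fun x hx hx1 => hf.eq_zero (hm x hx hx1.ge).1 (hh x hx hx1), ?_⟩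
    refine (VanishesToOrder.sum hO Finset.univ fun α _ => ?_).congr hO
      fun x hx hx' => pdWithin_comp hO hφ hm hf.1 1 hx hx'
    exact (ih (hf.pdWithin hO' α)).mul hO (l := 0) (SmoothUpTo.pdWithin (hφ α) 1)

end VanishesToOrder

lemma vanishesToOrder_rho_pow (hO : IsOpen O) (k : ℕ) :
    VanishesToOrder O k fun x => x 1 ^ k := by
  induction k with
  | zero =>
    simp only [pow_zero]
    exact smoothUpTo_const 1
  | succ k ih => simpa only [pow_succ] using ih.mul hO vanishesToOrder_rho

end VanishesToOrder

/-! ### Orders of magnitude at a point of the horizon -/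

/-- `f = O(ρ^k)` near the point `p`, as a function on `ρ > 0`. The exponent is an integer because
the inverse metric is singular at the horizon. -/
def IsBigORho (p : Coord n) (k : ℤ) (f : Coord n → ℝ) : Prop :=
  f =O[𝓝[openHalfSpace n] p] fun x => x 1 ^ k

section IsBigORho

variable {p : Coord n} {k l : ℤ} {f g : Coord n → ℝ}

lemma eventually_rho_pos : ∀ᶠ x in 𝓝[openHalfSpace n] p, 0 < x 1 := self_mem_nhdsWithin

lemma eventually_rho_lt (hp : p 1 = 0) {ε : ℝ} (hε : 0 < ε) :
    ∀ᶠ x in 𝓝[openHalfSpace n] p, x 1 < ε :=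
  mem_nhdsWithin_of_mem_nhds ((isOpen_lt (continuous_apply 1) continuous_const).mem_nhds
    (show p 1 < ε from hp ▸ hε))

lemma tendsto_rho (hp : p 1 = 0) :
    Tendsto (fun x : Coord n => x 1) (𝓝[openHalfSpace n] p) (𝓝 0) := by
  simpa only [hp] using ((continuous_apply (A := fun _ => ℝ) (1 : Fin (n + 3))).tendsto
    p).mono_left (nhdsWithin_le_nhds (s := openHalfSpace n))

lemma isBigORho_rho_zpow : IsBigORho p k fun x => x 1 ^ k := Asymptotics.isBigO_refl _ _

lemma isBigORho_of_tendsto {a : ℝ} (h : Tendsto f (𝓝[openHalfSpace n] p) (𝓝 a)) :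
    IsBigORho p 0 f := by
  simpa only [IsBigORho, zpow_zero] using h.isBigO_one ℝ

namespace IsBigORho

protected lemma add (hf : IsBigORho p k f) (hg : IsBigORho p k g) :
    IsBigORho p k fun x => f x + g x :=
  Asymptotics.IsBigO.add hf hg

protected lemma neg (hf : IsBigORho p k f) : IsBigORho p k fun x => -f x :=
  Asymptotics.IsBigO.neg_left hf

protected lemma sub (hf : IsBigORho p k f) (hg : IsBigORho p k g) :
    IsBigORho p k fun x => f x - g x :=
  Asymptotics.IsBigO.sub hf hg

lemma const_mul (hf : IsBigORho p k f) (c : ℝ) : IsBigORho p k fun x => c * f x :=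
  Asymptotics.IsBigO.const_mul_left hf c

protected lemma mul (hf : IsBigORho p k f) (hg : IsBigORho p l g) :
    IsBigORho p (k + l) fun x => f x * g x := by
  refine (Asymptotics.IsBigO.mul hf hg).congr' EventuallyEq.rfl ?_
  filter_upwards [eventually_rho_pos] with x hx
  rw [zpow_add₀ hx.ne']

protected lemma sum {ι : Type*} (s : Finset ι) {F : ι → Coord n → ℝ}
    (h : ∀ i ∈ s, IsBigORho p k (F i)) : IsBigORho p k fun x => ∑ i ∈ s, F i x :=
  Asymptotics.IsBigO.fun_sum h

protected lemma congr (hf : IsBigORho p k f) (h : g =ᶠ[𝓝[openHalfSpace n] p] f) :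
    IsBigORho p k g :=
  Asymptotics.IsBigO.congr' hf h.symm EventuallyEq.rfl

lemma mono (hp : p 1 = 0) (hf : IsBigORho p k f) (h : l ≤ k) : IsBigORho p l f := by
  refine Asymptotics.IsBigO.trans hf (Asymptotics.IsBigO.of_bound 1 ?_)
  filter_upwards [eventually_rho_pos, eventually_rho_lt hp one_pos] with x hx hx1
  rw [one_mul, Real.norm_of_nonneg (zpow_nonneg hx.le _), Real.norm_of_nonneg (zpow_nonneg hx.le _)]
  exact zpow_le_zpow_right_of_le_one₀ hx hx1.le h

lemma tendsto_zero (hp : p 1 = 0) (hf : IsBigORho p 1 f) :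
    Tendsto f (𝓝[openHalfSpace n] p) (𝓝 0) :=
  Asymptotics.IsBigO.trans_tendsto hf (by simpa only [zpow_one] using tendsto_rho hp)

end IsBigORho

end IsBigORho

section RhoLine

variable {O : Set (Coord n)} {p x : Coord n} {f : Coord n → ℝ} {s ε : ℝ}

lemma update_rho_mem_ball (hp : p 1 = 0) (hx : x ∈ Metric.ball p ε) (hs : s ∈ Icc 0 (x 1)) :
    Function.update x 1 s ∈ Metric.ball p ε := by
  have hε : 0 < ε := Metric.pos_of_mem_ball hx
  rw [Metric.mem_ball, dist_pi_lt_iff hε] at hx ⊢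
  intro i
  obtain rfl | hi := eq_or_ne i 1
  · have hx1 := hx 1
    rw [hp, dist_zero_right, Real.norm_of_nonneg (hs.1.trans hs.2)] at hx1
    rw [Function.update_self, hp, dist_zero_right, Real.norm_of_nonneg hs.1]
    exact hs.2.trans_lt hx1
  · simpa only [Function.update_of_ne hi] using hx i

lemma norm_le_of_norm_pdWithin_rho_le {C : ℝ} (hp : p 1 = 0)
    (hd : ∀ x ∈ Metric.ball p ε ∩ halfSpace n, DifferentiableWithinAt ℝ f (halfSpace n) x)
    (h0 : ∀ x ∈ Metric.ball p ε, x 1 = 0 → f x = 0)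
    (hx : x ∈ Metric.ball p ε ∩ halfSpace n)
    (hb : ∀ s ∈ Icc 0 (x 1), ‖pdWithin 1 f (Function.update x 1 s)‖ ≤ C) :
    ‖f x‖ ≤ C * x 1 := by
  have hx1 : 0 ≤ x 1 := hx.2
  have hmem (s) (hs : s ∈ Icc 0 (x 1)) :
      Function.update x 1 s ∈ Metric.ball p ε ∩ halfSpace n :=
    ⟨update_rho_mem_ball hp hx.1 hs, by simpa [halfSpace] using hs.1⟩
  have hderiv (s) (hs : s ∈ Icc 0 (x 1)) :
      HasDerivWithinAt (fun s => f (Function.update x 1 s))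
        (pdWithin 1 f (Function.update x 1 s)) (Icc 0 (x 1)) s :=
    (hd _ (hmem s hs)).hasFDerivWithinAt.comp_hasDerivWithinAt s
      (hasDerivAt_update x 1 s).hasDerivWithinAt fun s hs => (hmem s hs).2
  have h0x : f (Function.update x 1 0) = 0 :=
    h0 _ (hmem 0 (left_mem_Icc.2 hx1)).1 (Function.update_self ..)
  simpa only [h0x, Function.update_eq_self, sub_zero, Real.norm_of_nonneg hx1] using
    (convex_Icc 0 (x 1)).norm_image_sub_le_of_norm_hasDerivWithin_le hderiv hb
      (left_mem_Icc.2 hx1) (right_mem_Icc.2 hx1)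

lemma VanishesToOrder.exists_norm_le (hO : IsOpen O) (hp : p ∈ O) (hp1 : p 1 = 0) {k : ℕ}
    (hf : VanishesToOrder O k f) :
    ∃ C ε : ℝ, 0 ≤ C ∧ 0 < ε ∧
      ∀ x ∈ Metric.ball p ε ∩ halfSpace n, ‖f x‖ ≤ C * x 1 ^ k := by
  induction k generalizing f with
  | zero =>
    have hnear : ∀ᶠ x in 𝓝[halfSpace n] p, ‖f x‖ < ‖f p‖ + 1 :=
      (hf p hp hp1.ge).continuousWithinAt.norm.eventually (gt_mem_nhds (lt_add_one _))
    obtain ⟨ε, hε, h⟩ := Metric.mem_nhdsWithin_iff.1 hnear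
    exact ⟨‖f p‖ + 1, ε, by positivity, hε, fun x hx => by simpa using (h hx).le⟩
  | succ k ih =>
    obtain ⟨C, ε, hC, hε, hbound⟩ := ih hf.2.2
    obtain ⟨δ, hδ, hδO⟩ := Metric.isOpen_iff.1 hO p hp
    have hεδ : Metric.ball p (min ε δ) ⊆ O :=
      (Metric.ball_subset_ball (min_le_right ε δ)).trans hδO
    refine ⟨C, min ε δ, hC, lt_min hε hδ, fun x hx => ?_⟩
    rw [pow_succ, ← mul_assoc]
    refine norm_le_of_norm_pdWithin_rho_le hp1
      (fun y hy => hf.1.differentiableWithinAt (hεδ hy.1) hy.2)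
      (fun y hy hy1 => hf.eq_zero (hεδ hy) hy1) hx fun s hs => ?_
    have hs_mem := Metric.ball_subset_ball (min_le_left ε δ) (update_rho_mem_ball hp1 hx.1 hs)
    have hs_bound := hbound _ ⟨hs_mem, by simpa [halfSpace] using hs.1⟩
    rw [Function.update_self] at hs_bound
    exact hs_bound.trans (by gcongr; exacts [hs.1, hs.2])

lemma VanishesToOrder.isBigORho (hO : IsOpen O) (hp : p ∈ O) (hp1 : p 1 = 0) {k : ℕ}
    (hf : VanishesToOrder O k f) : IsBigORho p k f := by
  obtain ⟨C, ε, -, hε, h⟩ := hf.exists_norm_le hO hp hp1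
  refine Asymptotics.IsBigO.of_bound C ?_
  filter_upwards [eventually_rho_pos, mem_nhdsWithin_of_mem_nhds (Metric.ball_mem_nhds p hε)]
    with x hx hx'
  simpa only [zpow_natCast, Real.norm_of_nonneg (pow_nonneg hx.le k)] using h x ⟨hx', hx.le⟩

end RhoLine

lemma SmoothUpTo.tendsto {O : Set (Coord n)} {p : Coord n} {f : Coord n → ℝ}
    (hf : SmoothUpTo O f) (hp : p ∈ O) (hp1 : p 1 = 0) :
    Tendsto f (𝓝[openHalfSpace n] p) (𝓝 (f p)) :=
  (hf p hp hp1.ge).continuousWithinAt.tendsto.mono_left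
    (nhdsWithin_mono _ openHalfSpace_subset_halfSpace)

section Inverse

variable {ι X : Type*} [Fintype ι] [DecidableEq ι]

lemma tendsto_matrix_inv {l : Filter X} {A : X → Matrix ι ι ℝ} {A₀ : Matrix ι ι ℝ}
    (hA : Tendsto A l (𝓝 A₀)) (hdet : A₀.det ≠ 0) : Tendsto (fun x => (A x)⁻¹) l (𝓝 A₀⁻¹) := by
  simp only [Matrix.inv_def, Ring.inverse_eq_inv']
  have hdet_tendsto := ((continuous_id.matrix_det).tendsto A₀).comp hA
  have hadj_tendsto := ((continuous_id.matrix_adjugate).tendsto A₀).comp hA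
  exact (hdet_tendsto.inv₀ hdet).smul hadj_tendsto

lemma inv_apply_of_eq_diagonal_mul_mul {d : ι → ℝ} (hd : ∀ i, d i ≠ 0) {A B : Matrix ι ι ℝ}
    (h : A = Matrix.diagonal d * B * Matrix.diagonal d) (i j : ι) :
    A⁻¹ i j = (d i)⁻¹ * B⁻¹ i j * (d j)⁻¹ := by
  have hdiag : (Matrix.diagonal d)⁻¹ = Matrix.diagonal fun i => (d i)⁻¹ := by
    refine Matrix.inv_eq_right_inv ?_
    simp only [Matrix.diagonal_mul_diagonal, mul_inv_cancel₀ (hd _), Matrix.diagonal_one]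
  rw [h, Matrix.mul_inv_rev, Matrix.mul_inv_rev, hdiag, ← mul_assoc, Matrix.mul_diagonal,
    Matrix.diagonal_mul]

lemma inv_apply_eq_of_ne {A : Matrix ι ι ℝ} (hA : A.det ≠ 0) {i j : ι} (hij : i ≠ j)
    (hj : A j j ≠ 0) :
    A⁻¹ i j = -(∑ b ∈ Finset.univ.erase j, A⁻¹ i b * A b j) * (A j j)⁻¹ := by
  have hone : (A⁻¹ * A) i j = 0 := by
    rw [Matrix.nonsing_inv_mul _ (isUnit_iff_ne_zero.2 hA), Matrix.one_apply_ne hij]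
  rw [Matrix.mul_apply, ← Finset.add_sum_erase _ _ (Finset.mem_univ j)] at hone
  rw [eq_mul_inv_iff_mul_eq₀ hj]
  exact eq_neg_of_add_eq_zero_left hone

lemma isBigORho_inv_of_ne {p : Coord n} {A : Coord n → Matrix ι ι ℝ}
    (hinv : ∀ i j, IsBigORho p 0 fun x => (A x)⁻¹ i j)
    (hdet : ∀ᶠ x in 𝓝[openHalfSpace n] p, (A x).det ≠ 0) {j : ι}
    (hA : ∀ i, i ≠ j → IsBigORho p 1 fun x => A x i j) {a : ℝ} (ha : a ≠ 0)
    (hj : Tendsto (fun x => A x j j) (𝓝[openHalfSpace n] p) (𝓝 a)) {i : ι} (hij : i ≠ j) :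
    IsBigORho p 1 fun x => (A x)⁻¹ i j := by
  have hsum : IsBigORho p 1 fun x => ∑ b ∈ Finset.univ.erase j, (A x)⁻¹ i b * A x b j :=
    IsBigORho.sum _ fun b hb => (hinv i b).mul (hA b (Finset.ne_of_mem_erase hb))
  refine (hsum.neg.mul (isBigORho_of_tendsto (hj.inv₀ ha))).congr ?_
  filter_upwards [hdet, hj.eventually_ne ha] with x hx hx'
  exact inv_apply_eq_of_ne hx hij hx'

end Inverse

/-! ### Orders of the components of the fields -/

/-- The type of a coordinate index: `0` for `t`, `1` for `ρ` and `2` for the cross-section. -/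
def indexType (μ : Fin (n + 3)) : Fin 3 := Fin.cases 0 (Fin.cases 1 fun _ => 2) μ

@[simp] lemma indexType_zero : indexType (0 : Fin (n + 3)) = 0 := rfl

@[simp] lemma indexType_one : indexType (1 : Fin (n + 3)) = 1 := rfl

@[simp] lemma indexType_succ_succ (M : Fin (n + 1)) : indexType M.succ.succ = 2 := rfl

lemma index_cases {P : Fin (n + 3) → Prop} (t : P 0) (ρ : P 1)
    (cross : ∀ M : Fin (n + 1), P M.succ.succ) (μ : Fin (n + 3)) : P μ :=
  Fin.cases t (Fin.cases ρ cross) μ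

lemma succ_succ_ne_one (M : Fin (n + 1)) : (M.succ.succ : Fin (n + 3)) ≠ 1 :=
  fun h => Fin.succ_ne_zero M (Fin.succ_injective _ h)

lemma sum_index (f : Fin (n + 3) → ℝ) :
    ∑ α, f α = f 0 + f 1 + ∑ M : Fin (n + 1), f M.succ.succ := by
  rw [Fin.sum_univ_succ, Fin.sum_univ_succ]
  exact (add_assoc _ _ _).symm

/-- Orders of vanishing of the components `g_{αβ}` of a metric with the horizon asymptotics. -/
def metricOrder : Fin 3 → Fin 3 → ℕ := ![![2, 2, 2], ![2, 0, 1], ![2, 1, 0]]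

/-- Orders of vanishing of the derivatives `∂_μ g_{αβ}` of such a metric. -/
def pdMetricOrder : Fin 3 → Fin 3 → Fin 3 → ℕ :=
  ![![![3, 2, 2], ![2, 1, 1], ![2, 1, 1]], ![![1, 1, 1], ![1, 0, 0], ![1, 0, 0]],
    ![![3, 2, 2], ![2, 1, 1], ![2, 1, 0]]]

/-- Orders of vanishing of the components `h_{αβ}` of a variation `£_ξ g` of such a metric. -/
def variationOrder : Fin 3 → Fin 3 → ℕ := ![![3, 2, 2], ![2, 1, 1], ![2, 1, 0]]

/-- Orders of vanishing of the derivatives `∂_μ h_{αβ}` of a variation. -/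
def pdVariationOrder : Fin 3 → Fin 3 → Fin 3 → ℕ :=
  ![![![3, 2, 2], ![2, 1, 1], ![2, 1, 1]], ![![2, 1, 1], ![1, 0, 0], ![1, 0, 0]],
    ![![3, 2, 2], ![2, 1, 1], ![2, 1, 0]]]

/-- Orders of vanishing of the components `ξ^α` of an element of the algebra. -/
def fieldOrder : Fin 3 → ℕ := ![0, 2, 0]

/-- Orders of vanishing of the derivatives `∂_μ ξ^α` of an element of the algebra. -/
def pdFieldOrder : Fin 3 → Fin 3 → ℕ := ![![2, 2, 2], ![1, 1, 1], ![0, 2, 0]]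

/-- Orders of vanishing of the derivatives `∂_μ φ^α` of a diffeomorphism generated by the
algebra. -/
def jacobianOrder : Fin 3 → Fin 3 → ℕ := ![![0, 2, 2], ![1, 0, 1], ![0, 2, 0]]

/-- A function, smooth up to `ρ = 0`, whose `t`-derivative vanishes at the horizon. -/
def StationaryAtHorizon (O : Set (Coord n)) (f : Coord n → ℝ) : Prop :=
  SmoothUpTo O f ∧ VanishesToOrder O 1 (pdWithin 0 f)

section StationaryAtHorizon

variable {O : Set (Coord n)} {f g : Coord n → ℝ}

lemma VanishesToOrder.stationaryAtHorizon (hO : IsOpen O) (hf : VanishesToOrder O 1 f) :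
    StationaryAtHorizon O f :=
  ⟨hf.smoothUpTo, hf.pdWithin_tangent hO (by simp)⟩

namespace StationaryAtHorizon

protected lemma add (hO : IsOpen O) (hf : StationaryAtHorizon O f)
    (hg : StationaryAtHorizon O g) : StationaryAtHorizon O fun x => f x + g x :=
  ⟨hf.1.add hg.1, (hf.2.add hO hg.2).congr hO fun _ hx hx' => pdWithin_add hf.1 hg.1 0 hx hx'⟩

protected lemma mul (hO : IsOpen O) (hf : StationaryAtHorizon O f)
    (hg : StationaryAtHorizon O g) : StationaryAtHorizon O fun x => f x * g x :=
  ⟨hf.1.mul hg.1,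
    ((hf.2.mul hO (l := 0) hg.1).add hO (VanishesToOrder.mul hO (k := 0) hf.1 hg.2)).congr hO
      fun _ hx hx' => pdWithin_mul hf.1 hg.1 0 hx hx'⟩

protected lemma sum (hO : IsOpen O) {ι : Type*} (s : Finset ι) {F : ι → Coord n → ℝ}
    (h : ∀ i ∈ s, StationaryAtHorizon O (F i)) :
    StationaryAtHorizon O fun x => ∑ i ∈ s, F i x := by
  classical
  induction s using Finset.induction_on with
  | empty =>
    simpa only [Finset.sum_empty] using
      (vanishesToOrder_zero_fun (k := 1)).stationaryAtHorizon hO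
  | insert a s ha ih =>
    simp only [Finset.sum_insert ha]
    exact (h a (by simp)).add hO (ih fun i hi => h i (by simp [hi]))

lemma pdWithin_tangent (hO : IsOpen O) (hf : StationaryAtHorizon O f) {μ : Fin (n + 3)}
    (hμ : μ ≠ 1) : StationaryAtHorizon O (pdWithin μ f) :=
  ⟨hf.1.pdWithin μ,
    (hf.2.pdWithin_tangent hO hμ).congr hO fun _ hx hx' => pdWithin_comm hf.1 0 μ hx hx'⟩

end StationaryAtHorizon

end StationaryAtHorizon

/-! ### Fields with the horizon asymptotics -/

/-- The Lie derivative `£_ξ h`, with one-sided derivatives at the horizon. -/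
def lieDerivWithin (ξ : VField n) (h : Tensor2 n) : Tensor2 n := fun x μ ν =>
  ∑ α, (ξ x α * pdWithin α (fun y => h y μ ν) x + h x α ν * pdWithin μ (fun y => ξ y α) x
    + h x μ α * pdWithin ν (fun y => ξ y α) x)

/-- The pull-back `φ^* h`, with one-sided derivatives at the horizon. -/
def pullbackWithin (φ : Coord n → Coord n) (h : Tensor2 n) : Tensor2 n := fun x μ ν =>
  ∑ α, ∑ β, h (φ x) α β * pdWithin μ (fun y => φ y α) x * pdWithin ν (fun y => φ y β) x

/-- The block of the cross-section components `A_{MN}` of a matrix of components. -/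
def crossBlock (A : Matrix (Fin (n + 3)) (Fin (n + 3)) ℝ) : Matrix (Fin (n + 1)) (Fin (n + 1)) ℝ :=
  A.submatrix (fun M => M.succ.succ) fun M => M.succ.succ

/-- Vector fields `(T + O(ρ²), O(ρ²), V^M + O(ρ²))` with `T` and `V^M` independent of `t`. -/
structure AdmissibleField (O : Set (Coord n)) (ξ : VField n) : Prop where
  smooth : ∀ α, SmoothUpTo O fun x => ξ x α
  ρ : VanishesToOrder O 2 fun x => ξ x 1
  pd_t : ∀ α, VanishesToOrder O 2 (pdWithin 0 fun x => ξ x α)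
  pd_ρ : ∀ α, VanishesToOrder O 1 (pdWithin 1 fun x => ξ x α)

/-- The variations of a metric with the horizon asymptotics along the algebra: their components
vanish to the orders `variationOrder`, and the `t`-derivatives of the cross-section components are
of one order better. -/
structure MetricVariation (O : Set (Coord n)) (h : Tensor2 n) : Prop where
  order : ∀ α β, VanishesToOrder O (variationOrder (indexType α) (indexType β)) fun x => h x α β
  stationary : ∀ M N : Fin (n + 1), StationaryAtHorizon O fun x => h x M.succ.succ N.succ.succ

/-- The asymptotics of a metric at a horizon `ρ = 0` of surface gravity `κ`, in a form that is
preserved by the diffeomorphisms generated by the algebra. -/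
structure HorizonMetric (κ : ℝ) (O : Set (Coord n)) (g : Tensor2 n) : Prop where
  symm : ∀ x ∈ O, x ∈ halfSpace n → (g x).IsSymm
  tt : VanishesToOrder O 3 fun x => g x 0 0 - -(κ ^ 2 * x 1 ^ 2)
  tρ : VanishesToOrder O 2 fun x => g x 0 1
  tM : ∀ M : Fin (n + 1), VanishesToOrder O 2 fun x => g x 0 M.succ.succ
  ρρ : VanishesToOrder O 1 fun x => g x 1 1 - 1
  ρM : ∀ M : Fin (n + 1), VanishesToOrder O 1 fun x => g x 1 M.succ.succ
  stationary : ∀ M N : Fin (n + 1), StationaryAtHorizon O fun x => g x M.succ.succ N.succ.succ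
  crossBlock_det_pos : ∀ p ∈ O, p 1 = 0 → 0 < (crossBlock (g p)).det

lemma pdWithin_comp_rho {u : ℝ → ℝ} (hu : Differentiable ℝ u) {μ : Fin (n + 3)} (hμ : μ ≠ 1)
    {x : Coord n} (hx : x ∈ halfSpace n) : pdWithin μ (fun y => u (y 1)) x = 0 := by
  have hρ : HasFDerivWithinAt (fun y : Coord n => y 1)
      (ContinuousLinearMap.proj (R := ℝ) (φ := fun _ => ℝ) 1) (halfSpace n) x :=
    (ContinuousLinearMap.proj (R := ℝ) (φ := fun _ => ℝ) 1).hasFDerivWithinAt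
  have hcomp := (hu (x 1)).hasDerivAt.comp_hasFDerivWithinAt x hρ
  rw [pdWithin, show (fun y : Coord n => u (y 1)) = u ∘ fun y => y 1 from rfl,
    hcomp.fderivWithin (uniqueDiffOn_halfSpace x hx)]
  simp [hμ.symm]

section Fields

variable {O : Set (Coord n)} {ξ : VField n} {g h : Tensor2 n} {κ : ℝ}

lemma VanishesToOrder.pdWithin_tangent_of_sub_rho (hO : IsOpen O) {f : Coord n → ℝ} {k : ℕ}
    {u : ℝ → ℝ} (hu : ContDiff ℝ ∞ u) (hf : VanishesToOrder O k fun x => f x - u (x 1))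
    {μ : Fin (n + 3)} (hμ : μ ≠ 1) : VanishesToOrder O k (KillingHorizon.pdWithin μ f) := by
  have hu_smooth : SmoothUpTo O fun x => u (x 1) := fun _ _ _ =>
    (hu.comp (contDiff_apply ℝ ℝ (1 : Fin (n + 3)))).contDiffWithinAt
  refine (hf.pdWithin_tangent hO hμ).congr hO fun x hx hx' => ?_
  have hadd := pdWithin_add hf.smoothUpTo hu_smooth μ hx hx'
  simpa only [sub_add_cancel, pdWithin_comp_rho (hu.differentiable (by simp)) hμ hx', add_zero]
    using hadd

namespace AdmissibleField

lemma order (hξ : AdmissibleField O ξ) (α : Fin (n + 3)) :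
    VanishesToOrder O (fieldOrder (indexType α)) fun x => ξ x α := by
  cases α using index_cases with
  | t => exact hξ.smooth _
  | ρ => exact hξ.ρ
  | cross M => exact hξ.smooth _

lemma pd_order (hO : IsOpen O) (hξ : AdmissibleField O ξ) (μ α : Fin (n + 3)) :
    VanishesToOrder O (pdFieldOrder (indexType μ) (indexType α)) (pdWithin μ fun x => ξ x α) := by
  cases μ using index_cases with
  | t => cases α using index_cases <;> exact hξ.pd_t _
  | ρ => cases α using index_cases <;> exact hξ.pd_ρ _
  | cross M =>
    cases α using index_cases with
    | t => exact (hξ.smooth _).pdWithin _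
    | ρ => exact hξ.ρ.pdWithin_tangent hO (succ_succ_ne_one M)
    | cross N => exact (hξ.smooth _).pdWithin _

lemma stationaryAtHorizon (hξ : AdmissibleField O ξ) (α : Fin (n + 3)) :
    StationaryAtHorizon O fun x => ξ x α :=
  ⟨hξ.smooth α, (hξ.pd_t α).mono one_le_two⟩

end AdmissibleField

lemma MetricVariation.stationaryAtHorizon (hO : IsOpen O) (hh : MetricVariation O h)
    (α β : Fin (n + 3)) : StationaryAtHorizon O fun x => h x α β := by
  have hαβ := hh.order α β
  cases α using index_cases with
  | t => exact (hαβ.mono ((by decide : ∀ b, 1 ≤ variationOrder 0 b) _)).stationaryAtHorizon hO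
  | ρ => exact (hαβ.mono ((by decide : ∀ b, 1 ≤ variationOrder 1 b) _)).stationaryAtHorizon hO
  | cross M =>
    cases β using index_cases with
    | t => exact (hαβ.mono (show 1 ≤ variationOrder 2 0 by decide)).stationaryAtHorizon hO
    | ρ => exact (hαβ.mono (show 1 ≤ variationOrder 2 1 by decide)).stationaryAtHorizon hO
    | cross N => exact hh.stationary M N

lemma MetricVariation.pd_order (hO : IsOpen O) (hh : MetricVariation O h) (μ α β : Fin (n + 3)) :
    VanishesToOrder O (pdVariationOrder (indexType μ) (indexType α) (indexType β))
      (pdWithin μ fun x => h x α β) := by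
  cases μ using index_cases with
  | t =>
    exact (((hh.order α β).pdWithin_tangent hO (by simp)).max
      (hh.stationaryAtHorizon hO α β).2).mono
        ((by decide : ∀ a b, pdVariationOrder 0 a b ≤ max (variationOrder a b) 1) _ _)
  | ρ =>
    exact (hh.order α β).pdWithin_rho.mono
      ((by decide : ∀ a b, pdVariationOrder 1 a b ≤ variationOrder a b - 1) _ _)
  | cross M => exact (hh.order α β).pdWithin_tangent hO (succ_succ_ne_one M)

namespace HorizonMetric

lemma order (hO : IsOpen O) (hg : HorizonMetric κ O g) (α β : Fin (n + 3)) :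
    VanishesToOrder O (metricOrder (indexType α) (indexType β)) fun x => g x α β := by
  have hρ_sq := vanishesToOrder_rho.mul hO (vanishesToOrder_rho (O := O))
  cases α using index_cases with
  | t =>
    cases β using index_cases with
    | t =>
      exact ((hg.tt.mono (l := 2) (by simp)).sub hO (hρ_sq.const_mul hO (κ ^ 2))).congr hO
        fun x _ _ => by ring
    | ρ => exact hg.tρ
    | cross M => exact hg.tM M
  | ρ =>
    cases β using index_cases with
    | t => exact hg.tρ.congr hO fun x hx hx' => (hg.symm x hx hx').apply _ _
    | ρ =>
      exact (hg.ρρ.smoothUpTo.add (smoothUpTo_const 1)).congr hO fun x _ _ => by ring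
    | cross M => exact hg.ρM M
  | cross M =>
    cases β using index_cases with
    | t => exact (hg.tM M).congr hO fun x hx hx' => (hg.symm x hx hx').apply _ _
    | ρ => exact (hg.ρM M).congr hO fun x hx hx' => (hg.symm x hx hx').apply _ _
    | cross N => exact (hg.stationary M N).1

lemma pdWithin_tangent (hO : IsOpen O) (hg : HorizonMetric κ O g) {μ : Fin (n + 3)} (hμ : μ ≠ 1)
    (α β : Fin (n + 3)) :
    VanishesToOrder O (variationOrder (indexType α) (indexType β))
      (pdWithin μ fun x => g x α β) := by
  have hαβ := (hg.order hO α β).pdWithin_tangent hO hμ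
  cases α using index_cases with
  | t =>
    cases β using index_cases with
    | t =>
      exact hg.tt.pdWithin_tangent_of_sub_rho hO (u := fun r => -(κ ^ 2 * r ^ 2)) (by fun_prop) hμ
    | ρ => exact hαβ
    | cross M => exact hαβ
  | ρ =>
    cases β using index_cases with
    | t => exact hαβ
    | ρ => exact hg.ρρ.pdWithin_tangent_of_sub_rho hO (u := fun _ => 1) contDiff_const hμ
    | cross M => exact hαβ
  | cross M => cases β using index_cases <;> exact hαβ

lemma stationaryAtHorizon (hO : IsOpen O) (hg : HorizonMetric κ O g) (α β : Fin (n + 3)) :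
    StationaryAtHorizon O fun x => g x α β := by
  refine ⟨(hg.order hO α β).smoothUpTo, ?_⟩
  have hαβ := hg.pdWithin_tangent hO (μ := 0) (by simp) α β
  cases α using index_cases with
  | t => exact hαβ.mono ((by decide : ∀ b, 1 ≤ variationOrder 0 b) _)
  | ρ => exact hαβ.mono ((by decide : ∀ b, 1 ≤ variationOrder 1 b) _)
  | cross M =>
    cases β using index_cases with
    | t => exact hαβ.mono (show 1 ≤ variationOrder 2 0 by decide)
    | ρ => exact hαβ.mono (show 1 ≤ variationOrder 2 1 by decide)
    | cross N => exact (hg.stationary M N).2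

lemma pd_order (hO : IsOpen O) (hg : HorizonMetric κ O g) (μ α β : Fin (n + 3)) :
    VanishesToOrder O (pdMetricOrder (indexType μ) (indexType α) (indexType β))
      (pdWithin μ fun x => g x α β) := by
  cases μ using index_cases with
  | t =>
    exact ((hg.pdWithin_tangent hO (by simp) α β).max (hg.stationaryAtHorizon hO α β).2).mono
      ((by decide : ∀ a b, pdMetricOrder 0 a b ≤ max (variationOrder a b) 1) _ _)
  | ρ =>
    exact (hg.order hO α β).pdWithin_rho.mono
      ((by decide : ∀ a b, pdMetricOrder 1 a b ≤ metricOrder a b - 1) _ _)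
  | cross M => exact hg.pdWithin_tangent hO (succ_succ_ne_one M) α β

lemma metricVariation_lieDerivWithin (hO : IsOpen O) (hg : HorizonMetric κ O g)
    (hξ : AdmissibleField O ξ) : MetricVariation O (lieDerivWithin ξ g) where
  order μ ν := VanishesToOrder.sum hO _ fun α _ =>
    ((((hξ.order α).mul hO (hg.pd_order hO α μ ν)).mono
      ((by decide : ∀ a m v, variationOrder m v ≤ fieldOrder a + pdMetricOrder a m v) _ _ _)).add hO
    (((hg.order hO α ν).mul hO (hξ.pd_order hO μ α)).mono
      ((by decide : ∀ a m v, variationOrder m v ≤ metricOrder a v + pdFieldOrder m a) _ _ _))).add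
      hO (((hg.order hO μ α).mul hO (hξ.pd_order hO ν α)).mono
      ((by decide : ∀ a m v, variationOrder m v ≤ metricOrder m a + pdFieldOrder v a) _ _ _))
  stationary M N := by
    have hξ_tangent (P : Fin (n + 1)) (α : Fin (n + 3)) :
        StationaryAtHorizon O (pdWithin P.succ.succ fun y => ξ y α) :=
      (hξ.stationaryAtHorizon α).pdWithin_tangent hO (succ_succ_ne_one P)
    refine StationaryAtHorizon.sum hO _ fun α _ => (StationaryAtHorizon.add hO ?_
      ((hg.stationaryAtHorizon hO _ _).mul hO (hξ_tangent M α))).add hO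
      ((hg.stationaryAtHorizon hO _ _).mul hO (hξ_tangent N α))
    obtain rfl | hα := eq_or_ne α 1
    · exact ((hξ.ρ.mul hO (hg.pd_order hO 1 M.succ.succ N.succ.succ)).mono
        (show 1 ≤ 2 + pdMetricOrder 1 2 2 by decide)).stationaryAtHorizon hO
    · exact (hξ.stationaryAtHorizon α).mul hO
        ((hg.stationaryAtHorizon hO _ _).pdWithin_tangent hO hα)

end HorizonMetric

end Fields

/-! ### Diffeomorphisms that preserve the horizon asymptotics -/

/-- Smooth maps that preserve the horizon, are immersive along it, and whose derivative there fixes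
the vectors `∂_t` and `∂_ρ`. -/
structure HorizonMap (O O' : Set (Coord n)) (φ : Coord n → Coord n) : Prop where
  smooth : ∀ α, SmoothUpTo O fun x => φ x α
  maps : ∀ x ∈ O, x ∈ halfSpace n → φ x ∈ O' ∧ φ x ∈ halfSpace n
  horizon : ∀ x ∈ O, x 1 = 0 → φ x 1 = 0
  fderiv_t : ∀ x ∈ O, x 1 = 0 → fderivWithin ℝ φ (halfSpace n) x (Pi.single 0 1) = Pi.single 0 1
  fderiv_ρ : ∀ x ∈ O, x 1 = 0 → fderivWithin ℝ φ (halfSpace n) x (Pi.single 1 1) = Pi.single 1 1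
  injective : ∀ x ∈ O, x 1 = 0 → Function.Injective (fderivWithin ℝ φ (halfSpace n) x)

/-- The matrix `J_{μα} = ∂_μ φ^α`, with one-sided derivatives at the horizon. -/
def jacobian (φ : Coord n → Coord n) (x : Coord n) : Matrix (Fin (n + 3)) (Fin (n + 3)) ℝ :=
  Matrix.of fun μ α => pdWithin μ (fun y => φ y α) x

lemma jacobian_apply (φ : Coord n → Coord n) (x : Coord n) (μ α : Fin (n + 3)) :
    jacobian φ x μ α = pdWithin μ (fun y => φ y α) x := rfl

lemma pullbackWithin_eq_mul (φ : Coord n → Coord n) (h : Tensor2 n) (x : Coord n) :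
    pullbackWithin φ h x = jacobian φ x * h (φ x) * (jacobian φ x).transpose := by
  ext μ ν
  simp only [pullbackWithin, jacobian_apply, Matrix.mul_apply, Matrix.transpose_apply,
    Finset.sum_mul]
  rw [Finset.sum_comm]
  exact Finset.sum_congr rfl fun β _ => Finset.sum_congr rfl fun α _ => by ring

lemma det_eq_mul_det_submatrix_succ {m : ℕ} {A : Matrix (Fin (m + 1)) (Fin (m + 1)) ℝ}
    (h : ∀ j : Fin m, A 0 j.succ = 0) : A.det = A 0 0 * (A.submatrix Fin.succ Fin.succ).det := by
  simp [Matrix.det_succ_row_zero, Fin.sum_univ_succ, h]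

lemma det_eq_mul_det_crossBlock {A : Matrix (Fin (n + 3)) (Fin (n + 3)) ℝ}
    (h0 : ∀ j : Fin (n + 2), A 0 j.succ = 0) (h1 : ∀ M : Fin (n + 1), A 1 M.succ.succ = 0) :
    A.det = A 0 0 * (A 1 1 * (crossBlock A).det) := by
  rw [det_eq_mul_det_submatrix_succ h0, det_eq_mul_det_submatrix_succ h1]
  rfl

lemma fderivWithin_eq_vecMul_jacobian {φ : Coord n → Coord n} {x : Coord n}
    (hφ : DifferentiableWithinAt ℝ φ (halfSpace n) x) (hx : x ∈ halfSpace n) (v : Coord n) :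
    fderivWithin ℝ φ (halfSpace n) x v = Matrix.vecMul v (jacobian φ x) := by
  ext α
  rw [clm_apply_eq_sum, Finset.sum_apply]
  refine Finset.sum_congr rfl fun μ _ => ?_
  simp only [Pi.smul_apply, smul_eq_mul, jacobian_apply, pdWithin,
    fderivWithin_apply hφ (uniqueDiffOn_halfSpace x hx)]
  rfl

namespace HorizonMap

variable {O O' O'' : Set (Coord n)} {φ φ' : Coord n → Coord n} {x : Coord n}

lemma differentiableWithinAt (h : HorizonMap O O' φ) (hx : x ∈ O) (hx' : x ∈ halfSpace n) :
    DifferentiableWithinAt ℝ φ (halfSpace n) x :=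
  differentiableWithinAt_pi.2 fun α => (h.smooth α).differentiableWithinAt hx hx'

lemma fderivWithin_comp (hO : IsOpen O) (h' : HorizonMap O' O'' φ') (h : HorizonMap O O' φ)
    (hx : x ∈ O) (hx' : x ∈ halfSpace n) : fderivWithin ℝ (φ' ∘ φ) (halfSpace n) x =
      (fderivWithin ℝ φ' (halfSpace n) (φ x)).comp (fderivWithin ℝ φ (halfSpace n) x) := by
  have hφ' := (h'.differentiableWithinAt (h.maps x hx hx').1 (h.maps x hx hx').2).hasFDerivWithinAt
  have hφ := (h.differentiableWithinAt hx hx').hasFDerivWithinAt.mono (inter_subset_left (t := O))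
  have hcomp := hφ'.comp x hφ fun y hy => (h.maps y hy.2 hy.1).2
  exact ((hasFDerivWithinAt_inter (hO.mem_nhds hx)).1 hcomp).fderivWithin
    (uniqueDiffOn_halfSpace x hx')

protected lemma comp (hO : IsOpen O) (h' : HorizonMap O' O'' φ') (h : HorizonMap O O' φ) :
    HorizonMap O O'' (φ' ∘ φ) where
  smooth α := (h'.smooth α).comp hO h.smooth h.maps
  maps x hx hx' := h'.maps _ (h.maps x hx hx').1 (h.maps x hx hx').2
  horizon x hx hx1 := h'.horizon _ (h.maps x hx hx1.ge).1 (h.horizon x hx hx1)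
  fderiv_t x hx hx1 := by
    rw [fderivWithin_comp hO h' h hx hx1.ge, ContinuousLinearMap.comp_apply, h.fderiv_t x hx hx1,
      h'.fderiv_t _ (h.maps x hx hx1.ge).1 (h.horizon x hx hx1)]
  fderiv_ρ x hx hx1 := by
    rw [fderivWithin_comp hO h' h hx hx1.ge, ContinuousLinearMap.comp_apply, h.fderiv_ρ x hx hx1,
      h'.fderiv_ρ _ (h.maps x hx hx1.ge).1 (h.horizon x hx hx1)]
  injective x hx hx1 := by
    rw [fderivWithin_comp hO h' h hx hx1.ge]
    exact (h'.injective _ (h.maps x hx hx1.ge).1 (h.horizon x hx hx1)).comp (h.injective x hx hx1)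

lemma pdWithin_t_sub (h : HorizonMap O O' φ) (α : Fin (n + 3)) :
    VanishesToOrder O 1 fun x => pdWithin 0 (fun y => φ y α) x - (Pi.single 0 1 : Coord n) α := by
  refine vanishesToOrder_one (((h.smooth α).pdWithin 0).add (smoothUpTo_const _))
    fun x hx hx1 => sub_eq_zero.2 ?_
  rw [← h.fderiv_t x hx hx1,
    fderivWithin_eq_vecMul_jacobian (h.differentiableWithinAt hx hx1.ge) hx1.ge]
  simp [jacobian_apply]

lemma pdWithin_ρ_sub (h : HorizonMap O O' φ) (α : Fin (n + 3)) :
    VanishesToOrder O 1 fun x => pdWithin 1 (fun y => φ y α) x - (Pi.single 1 1 : Coord n) α := by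
  refine vanishesToOrder_one (((h.smooth α).pdWithin 1).add (smoothUpTo_const _))
    fun x hx hx1 => sub_eq_zero.2 ?_
  rw [← h.fderiv_ρ x hx hx1,
    fderivWithin_eq_vecMul_jacobian (h.differentiableWithinAt hx hx1.ge) hx1.ge]
  simp [jacobian_apply]

lemma pdWithin_ρ (h : HorizonMap O O' φ) {α : Fin (n + 3)} (hα : α ≠ 1) :
    VanishesToOrder O 1 (pdWithin 1 fun y => φ y α) := by
  simpa only [Pi.single_eq_of_ne hα, sub_zero] using h.pdWithin_ρ_sub α

lemma pdWithin_t (hO : IsOpen O) (h : HorizonMap O O' φ) {α : Fin (n + 3)} (hα : α ≠ 0) :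
    VanishesToOrder O 2 (pdWithin 0 fun y => φ y α) := by
  refine ⟨(h.smooth α).pdWithin 0, fun x hx hx1 => ?_, ?_⟩
  · simpa only [Pi.single_eq_of_ne hα, sub_zero] using (h.pdWithin_t_sub α).eq_zero hx hx1
  · exact ((h.pdWithin_ρ_sub α).pdWithin_tangent_of_sub_rho hO contDiff_const
      (μ := 0) (by simp)).congr hO fun x hx hx' => pdWithin_comm (h.smooth α) 1 0 hx hx'

lemma rho (hO : IsOpen O) (h : HorizonMap O O' φ) : VanishesToOrder O 2 fun x => φ x 1 - x 1 := by
  have hneg : SmoothUpTo O fun x => -x 1 := (vanishesToOrder_rho.neg hO).smoothUpTo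
  refine ⟨(h.smooth 1).add hneg,
    fun x hx hx1 => sub_eq_zero.2 ((h.horizon x hx hx1).trans hx1.symm),
    (h.pdWithin_ρ_sub 1).congr hO fun x hx hx' => ?_⟩
  have hadd := pdWithin_add ((h.smooth 1).add hneg) (smoothUpTo_coord 1) 1 hx hx'
  simp only [neg_add_cancel_right, pdWithin_coord _ _ hx', if_true] at hadd
  simpa only [Pi.single_eq_same, sub_eq_add_neg] using eq_sub_of_add_eq hadd.symm

lemma pdWithin_tangent_ρ (hO : IsOpen O) (h : HorizonMap O O' φ) {μ : Fin (n + 3)} (hμ : μ ≠ 1) :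
    VanishesToOrder O 2 (pdWithin μ fun y => φ y 1) :=
  (h.rho hO).pdWithin_tangent_of_sub_rho hO (u := fun r => r) contDiff_id hμ

lemma jacobian_order (hO : IsOpen O) (h : HorizonMap O O' φ) (μ α : Fin (n + 3)) :
    VanishesToOrder O (jacobianOrder (indexType μ) (indexType α)) (pdWithin μ fun y => φ y α) := by
  cases μ using index_cases with
  | t =>
    cases α using index_cases with
    | t => exact (h.smooth _).pdWithin _
    | ρ => exact h.pdWithin_t hO (by simp)
    | cross M => exact h.pdWithin_t hO (Fin.succ_ne_zero _)
  | ρ =>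
    cases α using index_cases with
    | t => exact h.pdWithin_ρ (by simp)
    | ρ => exact (h.smooth _).pdWithin _
    | cross M => exact h.pdWithin_ρ (succ_succ_ne_one M)
  | cross M =>
    cases α using index_cases with
    | t => exact (h.smooth _).pdWithin _
    | ρ => exact h.pdWithin_tangent_ρ hO (succ_succ_ne_one M)
    | cross N => exact (h.smooth _).pdWithin _

lemma det_crossBlock_jacobian_ne_zero (hO : IsOpen O) (h : HorizonMap O O' φ) (hx : x ∈ O)
    (hx1 : x 1 = 0) : (crossBlock (jacobian φ x)).det ≠ 0 := by
  have hdet : (jacobian φ x).det ≠ 0 := by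
    rw [← isUnit_iff_ne_zero, ← Matrix.isUnit_iff_isUnit_det, ← Matrix.vecMul_injective_iff_isUnit]
    simpa only [← fderivWithin_eq_vecMul_jacobian (h.differentiableWithinAt hx hx1.ge) hx1.ge]
      using h.injective x hx hx1
  rw [det_eq_mul_det_crossBlock (fun j => (h.pdWithin_t hO (Fin.succ_ne_zero j)).eq_zero hx hx1)
    fun M => (h.pdWithin_ρ (succ_succ_ne_one M)).eq_zero hx hx1] at hdet
  exact right_ne_zero_of_mul (right_ne_zero_of_mul hdet)

lemma stationaryAtHorizon_comp (hO : IsOpen O) (hO' : IsOpen O') (h : HorizonMap O O' φ)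
    {f : Coord n → ℝ} (hf : StationaryAtHorizon O' f) : StationaryAtHorizon O fun x => f (φ x) := by
  refine ⟨hf.1.comp hO h.smooth h.maps, (VanishesToOrder.sum hO Finset.univ
    (F := fun α x => pdWithin α f (φ x) * pdWithin 0 (fun y => φ y α) x) fun α _ => ?_).congr hO
    fun x hx hx' => pdWithin_comp hO h.smooth h.maps hf.1 0 hx hx'⟩
  obtain rfl | hα := eq_or_ne α 0
  · exact (hf.2.comp hO hO' h.smooth h.maps h.horizon).mul hO (l := 0) ((h.smooth 0).pdWithin 0)
  · exact (VanishesToOrder.mul hO (k := 0) ((hf.1.pdWithin α).comp hO h.smooth h.maps)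
      (h.pdWithin_t hO hα)).mono (by simp)

lemma stationaryAtHorizon_jacobian (hO : IsOpen O) (h : HorizonMap O O' φ) {μ : Fin (n + 3)}
    (hμ : μ ≠ 1) (α : Fin (n + 3)) : StationaryAtHorizon O (pdWithin μ fun y => φ y α) :=
  ⟨(h.smooth α).pdWithin μ, ((h.pdWithin_t_sub α).pdWithin_tangent_of_sub_rho hO
    contDiff_const hμ).congr hO fun _ hx hx' => pdWithin_comm (h.smooth α) 0 μ hx hx'⟩

end HorizonMap

namespace HorizonMetric

variable {O O' : Set (Coord n)} {g : Tensor2 n} {κ : ℝ} {φ : Coord n → Coord n}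

lemma order_pullback_term (hO : IsOpen O) (hO' : IsOpen O') (hg : HorizonMetric κ O' g)
    (hφ : HorizonMap O O' φ) (μ ν α β : Fin (n + 3)) :
    VanishesToOrder O (metricOrder (indexType α) (indexType β) +
      jacobianOrder (indexType μ) (indexType α) + jacobianOrder (indexType ν) (indexType β))
      fun x => g (φ x) α β * pdWithin μ (fun y => φ y α) x * pdWithin ν (fun y => φ y β) x :=
  (((hg.order hO' α β).comp hO hO' hφ.smooth hφ.maps hφ.horizon).mul hO
    (hφ.jacobian_order hO μ α)).mul hO (hφ.jacobian_order hO ν β)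

lemma order_pullbackWithin (hO : IsOpen O) (hO' : IsOpen O') (hg : HorizonMetric κ O' g)
    (hφ : HorizonMap O O' φ) (μ ν : Fin (n + 3)) :
    VanishesToOrder O (metricOrder (indexType μ) (indexType ν))
      fun x => KillingHorizon.pullbackWithin φ g x μ ν :=
  VanishesToOrder.sum hO _ fun α _ => VanishesToOrder.sum hO _ fun β _ =>
    (hg.order_pullback_term hO hO' hφ μ ν α β).mono
      ((by decide : ∀ a b m v,
        metricOrder m v ≤ metricOrder a b + jacobianOrder m a + jacobianOrder v b) _ _ _ _)

lemma order_pullbackWithin_sub_term (hO : IsOpen O) (hO' : IsOpen O') (hg : HorizonMetric κ O' g)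
    (hφ : HorizonMap O O' φ) {μ ν α₀ β₀ : Fin (n + 3)} {k : ℕ}
    (hk : ∀ α β, (α, β) ≠ (α₀, β₀) → k ≤ metricOrder (indexType α) (indexType β) +
      jacobianOrder (indexType μ) (indexType α) + jacobianOrder (indexType ν) (indexType β)) :
    VanishesToOrder O k fun x => KillingHorizon.pullbackWithin φ g x μ ν -
      g (φ x) α₀ β₀ * pdWithin μ (fun y => φ y α₀) x * pdWithin ν (fun y => φ y β₀) x := by
  refine (VanishesToOrder.sum hO (Finset.univ.erase (α₀, β₀)) fun αβ hαβ =>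
    (hg.order_pullback_term hO hO' hφ μ ν αβ.1 αβ.2).mono
      (hk _ _ (Finset.ne_of_mem_erase hαβ))).congr hO fun x _ _ => ?_
  rw [Finset.sum_erase_eq_sub (Finset.mem_univ _), Fintype.sum_prod_type]
  rfl

lemma pullbackWithin_tt (hO : IsOpen O) (hO' : IsOpen O') (hg : HorizonMetric κ O' g)
    (hφ : HorizonMap O O' φ) : VanishesToOrder O 3
      fun x => KillingHorizon.pullbackWithin φ g x 0 0 - -(κ ^ 2 * x 1 ^ 2) := by
  have hrest := hg.order_pullbackWithin_sub_term hO hO' hφ (μ := 0) (ν := 0) (α₀ := 0) (β₀ := 0)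
    (k := 3) (index_cases (index_cases (by simp)
        (fun _ => show 3 ≤ metricOrder 0 1 + jacobianOrder 0 0 + jacobianOrder 0 1 by decide)
        fun _ _ => show 3 ≤ metricOrder 0 2 + jacobianOrder 0 0 + jacobianOrder 0 2 by decide)
      (fun β _ => (by decide : ∀ b, 3 ≤ metricOrder 1 b + 2 + jacobianOrder 0 b) _)
      fun _ β _ => (by decide : ∀ b, 3 ≤ metricOrder 2 b + 2 + jacobianOrder 0 b) _)
  have hJ : VanishesToOrder O 0 (pdWithin 0 fun y => φ y 0) := (hφ.smooth 0).pdWithin 0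
  have hg_tt := ((hg.tt.comp hO hO' hφ.smooth hφ.maps hφ.horizon).mul hO hJ).mul hO hJ
  have hsum : VanishesToOrder O 1 fun x => φ x 1 + x 1 :=
    (vanishesToOrder_one (hφ.smooth 1) hφ.horizon).add hO vanishesToOrder_rho
  have hφ_sq := ((((hφ.rho hO).mul hO hsum).mul hO hJ).mul hO hJ).const_mul hO (κ ^ 2)
  have hJ_sq := (((hφ.pdWithin_t_sub 0).mul hO (l := 0) (hJ.add hO (smoothUpTo_const 1))).mul hO
    (vanishesToOrder_rho.mul hO vanishesToOrder_rho)).const_mul hO (κ ^ 2)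
  refine (((hrest.add hO hg_tt).sub hO hφ_sq).sub hO hJ_sq).congr hO fun x _ _ => ?_
  simp only [Pi.single_eq_same]
  ring

lemma pullbackWithin_ρρ (hO : IsOpen O) (hO' : IsOpen O') (hg : HorizonMetric κ O' g)
    (hφ : HorizonMap O O' φ) :
    VanishesToOrder O 1 fun x => KillingHorizon.pullbackWithin φ g x 1 1 - 1 := by
  have hrest := hg.order_pullbackWithin_sub_term hO hO' hφ (μ := 1) (ν := 1) (α₀ := 1) (β₀ := 1)
    (k := 1) (index_cases
      (fun β _ => (by decide : ∀ b, 1 ≤ metricOrder 0 b + 1 + jacobianOrder 1 b) _)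
      (index_cases
        (fun _ => show 1 ≤ metricOrder 1 0 + jacobianOrder 1 1 + jacobianOrder 1 0 by decide)
        (by simp)
        fun _ _ => show 1 ≤ metricOrder 1 2 + jacobianOrder 1 1 + jacobianOrder 1 2 by decide)
      fun _ β _ => (by decide : ∀ b, 1 ≤ metricOrder 2 b + 1 + jacobianOrder 1 b) _)
  have hJ : VanishesToOrder O 0 (pdWithin 1 fun y => φ y 1) := (hφ.smooth 1).pdWithin 1
  have hg_ρρ := ((hg.ρρ.comp hO hO' hφ.smooth hφ.maps hφ.horizon).mul hO hJ).mul hO hJ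
  have hJ_sq := (hφ.pdWithin_ρ_sub 1).mul hO (l := 0) (hJ.add hO (smoothUpTo_const 1))
  refine ((hrest.add hO hg_ρρ).add hO hJ_sq).congr hO fun x _ _ => ?_
  simp only [Pi.single_eq_same]
  ring

lemma crossBlock_pullbackWithin (hO : IsOpen O) (hO' : IsOpen O') (hg : HorizonMetric κ O' g)
    (hφ : HorizonMap O O' φ) {p : Coord n} (hp : p ∈ O) (hp1 : p 1 = 0) :
    crossBlock (KillingHorizon.pullbackWithin φ g p) =
      crossBlock (jacobian φ p) * crossBlock (g (φ p)) * (crossBlock (jacobian φ p)).transpose := by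
  have hzero (M N : Fin (n + 1)) {α β : Fin (n + 3)}
      (hαβ : 1 ≤ metricOrder (indexType α) (indexType β) + jacobianOrder 2 (indexType α) +
        jacobianOrder 2 (indexType β)) : g (φ p) α β * pdWithin M.succ.succ (fun y => φ y α) p *
          pdWithin N.succ.succ (fun y => φ y β) p = 0 :=
    ((hg.order_pullback_term hO hO' hφ M.succ.succ N.succ.succ α β).mono hαβ).eq_zero hp hp1
  have hzero_t (b : Fin 3) : 1 ≤ metricOrder 0 b + jacobianOrder 2 0 + jacobianOrder 2 b := by
    decide +revert
  have hzero_ρ (b : Fin 3) : 1 ≤ metricOrder 1 b + jacobianOrder 2 1 + jacobianOrder 2 b := by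
    decide +revert
  ext M N
  simp only [crossBlock, Matrix.submatrix_apply, KillingHorizon.pullbackWithin, Matrix.mul_apply,
    Matrix.transpose_apply, jacobian_apply, Finset.sum_mul]
  rw [Finset.sum_comm (γ := Fin (n + 1)), sum_index,
    Finset.sum_eq_zero fun β _ => hzero M N (α := 0) (β := β) (hzero_t _),
    Finset.sum_eq_zero fun β _ => hzero M N (α := 1) (β := β) (hzero_ρ _), zero_add, zero_add]
  refine Finset.sum_congr rfl fun P _ => ?_
  rw [sum_index,
    hzero M N (α := P.succ.succ) (β := 0)
      (show 1 ≤ metricOrder 2 0 + jacobianOrder 2 2 + jacobianOrder 2 0 by decide),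
    hzero M N (α := P.succ.succ) (β := 1)
      (show 1 ≤ metricOrder 2 1 + jacobianOrder 2 2 + jacobianOrder 2 1 by decide),
    zero_add, zero_add]
  exact Finset.sum_congr rfl fun Q _ => by ring

protected lemma pullbackWithin (hO : IsOpen O) (hO' : IsOpen O') (hg : HorizonMetric κ O' g)
    (hφ : HorizonMap O O' φ) : HorizonMetric κ O (KillingHorizon.pullbackWithin φ g) where
  symm x hx hx' := by
    rw [Matrix.IsSymm, pullbackWithin_eq_mul, Matrix.transpose_mul, Matrix.transpose_mul,
      Matrix.transpose_transpose, (hg.symm _ (hφ.maps x hx hx').1 (hφ.maps x hx hx').2).eq,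
      Matrix.mul_assoc]
  tt := hg.pullbackWithin_tt hO hO' hφ
  tρ := hg.order_pullbackWithin hO hO' hφ 0 1
  tM M := hg.order_pullbackWithin hO hO' hφ 0 M.succ.succ
  ρρ := hg.pullbackWithin_ρρ hO hO' hφ
  ρM M := hg.order_pullbackWithin hO hO' hφ 1 M.succ.succ
  stationary M N := StationaryAtHorizon.sum hO _ fun α _ => StationaryAtHorizon.sum hO _ fun β _ =>
    ((hφ.stationaryAtHorizon_comp hO hO' (hg.stationaryAtHorizon hO' α β)).mul hO
      (hφ.stationaryAtHorizon_jacobian hO (succ_succ_ne_one M) α)).mul hO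
        (hφ.stationaryAtHorizon_jacobian hO (succ_succ_ne_one N) β)
  crossBlock_det_pos p hp hp1 := by
    have hdet := hφ.det_crossBlock_jacobian_ne_zero hO hp hp1
    have hpos := hg.crossBlock_det_pos _ (hφ.maps p hp hp1.ge).1 (hφ.horizon p hp hp1)
    rw [hg.crossBlock_pullbackWithin hO hO' hφ hp hp1, Matrix.det_mul, Matrix.det_mul,
      Matrix.det_transpose, mul_right_comm]
    exact mul_pos (mul_self_pos.2 hdet) hpos

end HorizonMetric

/-! ### The pre-symplectic current near the horizon -/

/-- The weight of an index: each lower index `t` of a component carries a factor `ρ`, since the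
frame `ρ dt, dρ, dx^M` is regular at the horizon. -/
def weight : Fin 3 → ℤ := ![1, 0, 0]

/-- Orders of the components of the inverse metric. The table is not symmetric: only the lower
triangle of the mixed components needs the better estimate. -/
def invMetricOrder : Fin 3 → Fin 3 → ℤ := ![![-2, -1, -1], ![-1, 0, 0], ![0, 1, 0]]

/-- Orders of the Christoffel symbols `Γ^α_{μν}`. -/
def christoffelOrder (α μ ν : Fin 3) : ℤ :=
  weight μ + weight ν - weight α + if α = 2 then 0 else -1

/-- The components of the metric in the frame `ρ dt, dρ, dx^M`. -/
def frameMetric (g : Tensor2 n) (x : Coord n) : Matrix (Fin (n + 3)) (Fin (n + 3)) ℝ :=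
  Matrix.of fun μ ν => x 1 ^ (-weight (indexType μ)) * g x μ ν * x 1 ^ (-weight (indexType ν))

/-- The limit of `frameMetric g` at the point `p` of the horizon. -/
def frameLimit (κ : ℝ) (g : Tensor2 n) (p : Coord n) : Matrix (Fin (n + 3)) (Fin (n + 3)) ℝ :=
  Matrix.of fun μ ν => if indexType μ = 2 ∧ indexType ν = 2 then g p μ ν else
    if indexType μ = indexType ν then ![-κ ^ 2, 1, 0] (indexType μ) else 0

/-- The coefficients of `δ_{[1} g_{rs} ∇_c δ_{2]} g_{ab}` in the component `ω^ν` of the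
pre-symplectic current of a metric with inverse matrix `I`. -/
def currentCoeff (I : Matrix (Fin (n + 3)) (Fin (n + 3)) ℝ) (ν r s c a b : Fin (n + 3)) : ℝ :=
  I ν a * (I r s * I b c - 2 * I r b * I s c)
    + 2 * I ν c * ((1 / 2) * (I r a * I s b - I r s * I a b))
    + I ν r * I a b * I s c

lemma eq_diagonal_mul_frameMetric_mul (g : Tensor2 n) {x : Coord n} (hx : 0 < x 1) :
    g x = Matrix.diagonal (fun μ => x 1 ^ weight (indexType μ)) * frameMetric g x *
      Matrix.diagonal fun μ => x 1 ^ weight (indexType μ) := by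
  ext μ ν
  have hμ := (zpow_pos hx (weight (indexType μ))).ne'
  have hν := (zpow_pos hx (weight (indexType ν))).ne'
  simp only [Matrix.mul_diagonal, Matrix.diagonal_mul, frameMetric, Matrix.of_apply, zpow_neg]
  field_simp

lemma det_eq_rho_sq_mul_det_frameMetric (g : Tensor2 n) {x : Coord n} (hx : 0 < x 1) :
    (g x).det = x 1 ^ 2 * (frameMetric g x).det := by
  have hprod : ∏ μ : Fin (n + 3), x 1 ^ weight (indexType μ) = x 1 := by
    rw [Fin.prod_univ_succ, Fin.prod_univ_succ, Finset.prod_eq_one fun M _ => zpow_zero _]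
    exact (congrArg₂ (· * ·) (zpow_one _) (mul_one _)).trans (mul_one _)
  conv_lhs => rw [eq_diagonal_mul_frameMetric_mul g hx]
  rw [Matrix.det_mul, Matrix.det_mul, Matrix.det_diagonal, hprod]
  ring

lemma indexType_ne {μ ν : Fin (n + 3)} (hμν : μ ≠ ν)
    (hcross : ¬(indexType μ = 2 ∧ indexType ν = 2)) : indexType μ ≠ indexType ν := by
  cases μ using index_cases <;> cases ν using index_cases <;> simp_all

namespace HorizonMetric

variable {O : Set (Coord n)} {g : Tensor2 n} {κ : ℝ} {p : Coord n}

lemma det_frameLimit_ne_zero (hg : HorizonMetric κ O g) (hκ : κ ≠ 0) (hp : p ∈ O)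
    (hp1 : p 1 = 0) : (frameLimit κ g p).det ≠ 0 := by
  have ht (j : Fin (n + 2)) : frameLimit κ g p 0 j.succ = 0 := by
    cases j using Fin.cases <;> rfl
  have htt : frameLimit κ g p 0 0 = -κ ^ 2 := rfl
  have hρρ : frameLimit κ g p 1 1 = 1 := rfl
  have hcross : crossBlock (frameLimit κ g p) = crossBlock (g p) := rfl
  rw [det_eq_mul_det_crossBlock ht fun _ => rfl, htt, hρρ, hcross, one_mul]
  exact mul_ne_zero (neg_ne_zero.2 (pow_ne_zero 2 hκ)) (hg.crossBlock_det_pos p hp hp1).ne'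

lemma isBigORho_frameMetric_of_ne (hO : IsOpen O) (hg : HorizonMetric κ O g) (hp : p ∈ O)
    (hp1 : p 1 = 0) {μ ν : Fin (n + 3)} (hμν : μ ≠ ν)
    (hcross : ¬(indexType μ = 2 ∧ indexType ν = 2)) :
    IsBigORho p 1 fun x => frameMetric g x μ ν :=
  ((isBigORho_rho_zpow.mul ((hg.order hO μ ν).isBigORho hO hp hp1)).mul isBigORho_rho_zpow).mono
    hp1 ((by decide : ∀ a b, ¬(a = 2 ∧ b = 2) → a ≠ b →
      1 ≤ -weight a + metricOrder a b + -weight b) _ _ hcross (indexType_ne hμν hcross))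

lemma tendsto_frameMetric_tt (hO : IsOpen O) (hg : HorizonMetric κ O g) (hp : p ∈ O)
    (hp1 : p 1 = 0) :
    Tendsto (fun x => frameMetric g x 0 0) (𝓝[openHalfSpace n] p) (𝓝 (-κ ^ 2)) := by
  have hrest : IsBigORho p 1 fun x => x 1 ^ (-2 : ℤ) * (g x 0 0 - -(κ ^ 2 * x 1 ^ 2)) :=
    (isBigORho_rho_zpow.mul (hg.tt.isBigORho hO hp hp1)).mono hp1 (by norm_num)
  have hlim := (hrest.tendsto_zero hp1).add_const (-κ ^ 2)
  rw [zero_add] at hlim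
  refine hlim.congr' ?_
  filter_upwards [eventually_rho_pos] with x hx
  have hx' : x 1 ≠ 0 := hx.ne'
  have hframe : frameMetric g x 0 0 = x 1 ^ (-1 : ℤ) * g x 0 0 * x 1 ^ (-1 : ℤ) := rfl
  rw [hframe, zpow_neg, zpow_neg, zpow_one, zpow_ofNat]
  field_simp
  ring

lemma tendsto_frameMetric (hO : IsOpen O) (hg : HorizonMetric κ O g) (hp : p ∈ O)
    (hp1 : p 1 = 0) :
    Tendsto (frameMetric g) (𝓝[openHalfSpace n] p) (𝓝 (frameLimit κ g p)) := by
  refine tendsto_pi_nhds.2 fun μ => tendsto_pi_nhds.2 fun ν => ?_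
  by_cases hcross : indexType μ = 2 ∧ indexType ν = 2
  · simpa [frameMetric, frameLimit, hcross, weight] using
      (hg.order hO μ ν).smoothUpTo.tendsto hp hp1
  obtain rfl | hμν := eq_or_ne μ ν
  · cases μ using index_cases with
    | t => exact hg.tendsto_frameMetric_tt hO hp hp1
    | ρ =>
      simpa [frameMetric, frameLimit, weight] using
        ((hg.ρρ.isBigORho hO hp hp1).tendsto_zero hp1).add_const 1
    | cross M => exact absurd ⟨rfl, rfl⟩ hcross
  · have hlim : frameLimit κ g p μ ν = 0 := by
      rw [frameLimit, Matrix.of_apply, if_neg hcross, if_neg (indexType_ne hμν hcross)]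
    exact hlim ▸ (hg.isBigORho_frameMetric_of_ne hO hp hp1 hμν hcross).tendsto_zero hp1

lemma eventually_det_frameMetric_ne_zero (hO : IsOpen O) (hg : HorizonMetric κ O g) (hκ : κ ≠ 0)
    (hp : p ∈ O) (hp1 : p 1 = 0) :
    ∀ᶠ x in 𝓝[openHalfSpace n] p, (frameMetric g x).det ≠ 0 :=
  ((continuous_id.matrix_det.tendsto _).comp (hg.tendsto_frameMetric hO hp hp1)).eventually_ne
    (hg.det_frameLimit_ne_zero hκ hp hp1)

lemma eventually_det_ne_zero (hO : IsOpen O) (hg : HorizonMetric κ O g) (hκ : κ ≠ 0) (hp : p ∈ O)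
    (hp1 : p 1 = 0) : ∀ᶠ x in 𝓝[openHalfSpace n] p, (g x).det ≠ 0 := by
  filter_upwards [hg.eventually_det_frameMetric_ne_zero hO hκ hp hp1, eventually_rho_pos]
    with x hdet hx
  rw [det_eq_rho_sq_mul_det_frameMetric g hx]
  exact mul_ne_zero (pow_ne_zero 2 hx.ne') hdet

lemma isBigORho_frameMetric_inv (hO : IsOpen O) (hg : HorizonMetric κ O g) (hκ : κ ≠ 0)
    (hp : p ∈ O) (hp1 : p 1 = 0) (μ ν : Fin (n + 3)) :
    IsBigORho p 0 fun x => (frameMetric g x)⁻¹ μ ν :=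
  isBigORho_of_tendsto (tendsto_pi_nhds.1 (tendsto_pi_nhds.1 (tendsto_matrix_inv
    (hg.tendsto_frameMetric hO hp hp1) (hg.det_frameLimit_ne_zero hκ hp hp1)) μ) ν)

lemma isBigORho_frameMetric_inv_of_ne (hO : IsOpen O) (hg : HorizonMetric κ O g) (hκ : κ ≠ 0)
    (hp : p ∈ O) (hp1 : p 1 = 0) {μ ν : Fin (n + 3)} (hμν : μ ≠ ν) (hν : indexType ν ≠ 2) :
    IsBigORho p 1 fun x => (frameMetric g x)⁻¹ μ ν := by
  have hne : frameLimit κ g p ν ν ≠ 0 := by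
    cases ν using index_cases with
    | t => exact neg_ne_zero.2 (pow_ne_zero 2 hκ)
    | ρ => exact one_ne_zero
    | cross M => exact absurd rfl hν
  exact isBigORho_inv_of_ne (hg.isBigORho_frameMetric_inv hO hκ hp hp1)
    (hg.eventually_det_frameMetric_ne_zero hO hκ hp hp1)
    (fun _ hi => hg.isBigORho_frameMetric_of_ne hO hp hp1 hi fun h => hν h.2) hne
    (tendsto_pi_nhds.1 (tendsto_pi_nhds.1 (hg.tendsto_frameMetric hO hp hp1) ν) ν) hμν

lemma isBigORho_inv (hO : IsOpen O) (hg : HorizonMetric κ O g) (hκ : κ ≠ 0) (hp : p ∈ O)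
    (hp1 : p 1 = 0) (μ ν : Fin (n + 3)) :
    IsBigORho p (invMetricOrder (indexType μ) (indexType ν)) fun x => (g x)⁻¹ μ ν := by
  have hframe {k : ℤ} (hk : IsBigORho p k fun x => (frameMetric g x)⁻¹ μ ν) :
      IsBigORho p (-weight (indexType μ) + k + -weight (indexType ν)) fun x => (g x)⁻¹ μ ν := by
    refine ((isBigORho_rho_zpow.mul hk).mul isBigORho_rho_zpow).congr ?_
    filter_upwards [eventually_rho_pos] with x hx
    rw [inv_apply_of_eq_diagonal_mul_mul (fun α => (zpow_pos hx (weight (indexType α))).ne')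
      (eq_diagonal_mul_frameMetric_mul g hx), zpow_neg, zpow_neg]
  by_cases hμν : indexType μ = 2 ∧ indexType ν ≠ 2
  · have hne : μ ≠ ν := fun h => hμν.2 (h ▸ hμν.1)
    exact (hframe (hg.isBigORho_frameMetric_inv_of_ne hO hκ hp hp1 hne hμν.2)).mono hp1
      ((by decide : ∀ a b, a = 2 ∧ b ≠ 2 →
        invMetricOrder a b ≤ -weight a + 1 + -weight b) _ _ hμν)
  · exact (hframe (hg.isBigORho_frameMetric_inv hO hκ hp hp1 μ ν)).mono hp1
      ((by decide : ∀ a b, ¬(a = 2 ∧ b ≠ 2) →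
        invMetricOrder a b ≤ -weight a + 0 + -weight b) _ _ hμν)

lemma isBigORho_sqrt_neg_det (hO : IsOpen O) (hg : HorizonMetric κ O g) (hp : p ∈ O)
    (hp1 : p 1 = 0) : IsBigORho p 1 fun x => √(-(g x).det) := by
  have hframe := ((Real.continuous_sqrt.comp continuous_id.matrix_det.neg).tendsto _).comp
    (hg.tendsto_frameMetric hO hp hp1)
  refine ((isBigORho_rho_zpow (k := 1)).mul (isBigORho_of_tendsto hframe)).congr ?_
  filter_upwards [eventually_rho_pos] with x hx
  rw [det_eq_rho_sq_mul_det_frameMetric g hx, ← mul_neg, Real.sqrt_mul (sq_nonneg _),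
    Real.sqrt_sq hx.le, zpow_one]
  rfl

end HorizonMetric

section Current

variable {O : Set (Coord n)} {g h h₁ h₂ : Tensor2 n} {κ : ℝ} {p : Coord n}

lemma VanishesToOrder.isBigORho_pd (hO : IsOpen O) (hp : p ∈ O) (hp1 : p 1 = 0) {k : ℕ}
    {μ : Fin (n + 3)} {f : Coord n → ℝ} (hf : VanishesToOrder O k (KillingHorizon.pdWithin μ f)) :
    IsBigORho p k (pd μ f) := by
  refine (hf.isBigORho hO hp hp1).congr ?_
  filter_upwards [eventually_rho_pos] with x hx
  exact pd_eq_pdWithin hx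

lemma MetricVariation.isBigORho (hO : IsOpen O) (hh : MetricVariation O h) (hp : p ∈ O)
    (hp1 : p 1 = 0) (α β : Fin (n + 3)) :
    IsBigORho p (weight (indexType α) + weight (indexType β)) fun x => h x α β :=
  ((hh.order α β).isBigORho hO hp hp1).mono hp1
    ((by decide : ∀ a b, weight a + weight b ≤ variationOrder a b) _ _)

lemma isBigORho_currentCoeff {I : Coord n → Matrix (Fin (n + 3)) (Fin (n + 3)) ℝ}
    (hI : ∀ α β, IsBigORho p (-weight (indexType α) - weight (indexType β)) fun x => I x α β)
    (hp1 : p 1 = 0) (ν r s c a b : Fin (n + 3)) :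
    IsBigORho p (-weight (indexType ν) - weight (indexType r) - weight (indexType s) -
      weight (indexType c) - weight (indexType a) - weight (indexType b))
      fun x => currentCoeff (I x) ν r s c a b := by
  refine IsBigORho.add (IsBigORho.add ?_ ?_) ?_
  · have hdiff : IsBigORho p (-weight (indexType r) - weight (indexType s) -
        weight (indexType b) - weight (indexType c))
        fun x => I x r s * I x b c - 2 * I x r b * I x s c :=
      (((hI r s).mul (hI b c)).mono hp1 (by omega)).sub
        ((((hI r b).const_mul 2).mul (hI s c)).mono hp1 (by omega))
    exact ((hI ν a).mul hdiff).mono hp1 (by omega)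
  · have hdiff : IsBigORho p (-weight (indexType r) - weight (indexType s) -
        weight (indexType a) - weight (indexType b))
        fun x => I x r a * I x s b - I x r s * I x a b :=
      (((hI r a).mul (hI s b)).mono hp1 (by omega)).sub
        (((hI r s).mul (hI a b)).mono hp1 (by omega))
    exact (((hI ν c).const_mul 2).mul (hdiff.const_mul (1 / 2))).mono hp1 (by omega)
  · exact (((hI ν r).mul (hI a b)).mul (hI s c)).mono hp1 (by omega)

namespace HorizonMetric

lemma isBigORho_christoffel (hO : IsOpen O) (hg : HorizonMetric κ O g) (hκ : κ ≠ 0) (hp : p ∈ O)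
    (hp1 : p 1 = 0) (α μ ν : Fin (n + 3)) :
    IsBigORho p (christoffelOrder (indexType α) (indexType μ) (indexType ν))
      (christoffel g α μ ν) := by
  refine IsBigORho.const_mul (IsBigORho.sum _ fun β _ => ?_) _
  have hterm (μ' α' β' : Fin (n + 3))
      (hle : christoffelOrder (indexType α) (indexType μ) (indexType ν) ≤
        invMetricOrder (indexType α) (indexType β) +
          pdMetricOrder (indexType μ') (indexType α') (indexType β')) :
      IsBigORho p (christoffelOrder (indexType α) (indexType μ) (indexType ν))
        fun x => (g x)⁻¹ α β * pd μ' (fun y => g y α' β') x :=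
    ((hg.isBigORho_inv hO hκ hp hp1 α β).mul
      ((hg.pd_order hO μ' α' β').isBigORho_pd hO hp hp1)).mono hp1 hle
  refine (((hterm μ β ν ?_).add (hterm ν β μ ?_)).sub (hterm β μ ν ?_)).congr
    (Eventually.of_forall fun x => by ring)
  · exact (by decide : ∀ a b m v,
      christoffelOrder a m v ≤ invMetricOrder a b + pdMetricOrder m b v) _ _ _ _
  · exact (by decide : ∀ a b m v,
      christoffelOrder a m v ≤ invMetricOrder a b + pdMetricOrder v b m) _ _ _ _
  · exact (by decide : ∀ a b m v,
      christoffelOrder a m v ≤ invMetricOrder a b + pdMetricOrder b m v) _ _ _ _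

lemma isBigORho_covDeriv (hO : IsOpen O) (hg : HorizonMetric κ O g) (hκ : κ ≠ 0) (hp : p ∈ O)
    (hp1 : p 1 = 0) (hh : MetricVariation O h) (γ α β : Fin (n + 3)) :
    IsBigORho p (weight (indexType γ) + weight (indexType α) + weight (indexType β))
      (covDeriv g h γ α β) := by
  have hΓ := hg.isBigORho_christoffel hO hκ hp hp1
  have hh_order (α β) := (hh.order α β).isBigORho hO hp hp1
  refine IsBigORho.sub (((hh.pd_order hO γ α β).isBigORho_pd hO hp hp1).mono hp1 ?_)
    (IsBigORho.sum _ fun δ _ => IsBigORho.add (((hΓ δ γ α).mul (hh_order δ β)).mono hp1 ?_)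
      (((hΓ δ γ β).mul (hh_order α δ)).mono hp1 ?_))
  · exact (by decide : ∀ c a b, weight c + weight a + weight b ≤ pdVariationOrder c a b) _ _ _
  · exact (by decide : ∀ c a b d, weight c + weight a + weight b ≤
      christoffelOrder d c a + variationOrder d b) _ _ _ _
  · exact (by decide : ∀ c a b d, weight c + weight a + weight b ≤
      christoffelOrder d c b + variationOrder a d) _ _ _ _

lemma isBigORho_mul_covDeriv (hO : IsOpen O) (hg : HorizonMetric κ O g) (hκ : κ ≠ 0) (hp : p ∈ O)
    (hp1 : p 1 = 0) (hh₁ : MetricVariation O h₁) (hh₂ : MetricVariation O h₂)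
    (r s c a b : Fin (n + 3)) :
    IsBigORho p (weight (indexType r) + weight (indexType s) + weight (indexType c) +
      weight (indexType a) + weight (indexType b)) fun x => h₁ x r s * covDeriv g h₂ c a b x :=
  ((hh₁.isBigORho hO hp hp1 r s).mul (hg.isBigORho_covDeriv hO hκ hp hp1 hh₂ c a b)).mono hp1
    (by omega)

lemma isBigORho_presymplecticCurrent (hO : IsOpen O) (hg : HorizonMetric κ O g) (hκ : κ ≠ 0)
    (hp : p ∈ O) (hp1 : p 1 = 0) (G : ℝ) (hh₁ : MetricVariation O h₁)
    (hh₂ : MetricVariation O h₂) (ν : Fin (n + 3)) :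
    IsBigORho p (1 - weight (indexType ν)) (presymplecticCurrent G g h₁ h₂ ν) := by
  have hinv (α β) : IsBigORho p (-weight (indexType α) - weight (indexType β))
      fun x => (g x)⁻¹ α β := (hg.isBigORho_inv hO hκ hp hp1 α β).mono hp1
    ((by decide : ∀ a b, -weight a - weight b ≤ invMetricOrder a b) _ _)
  have hsum : IsBigORho p (-weight (indexType ν)) fun x => ∑ r, ∑ s, ∑ c, ∑ a, ∑ b,
      currentCoeff (g x)⁻¹ ν r s c a b *
        ((1 / 2) * (h₁ x r s * covDeriv g h₂ c a b x - h₂ x r s * covDeriv g h₁ c a b x)) :=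
    IsBigORho.sum _ fun r _ => IsBigORho.sum _ fun s _ => IsBigORho.sum _ fun c _ =>
      IsBigORho.sum _ fun a _ => IsBigORho.sum _ fun b _ =>
        ((isBigORho_currentCoeff hinv hp1 ν r s c a b).mul
          (((hg.isBigORho_mul_covDeriv hO hκ hp hp1 hh₁ hh₂ r s c a b).sub
            (hg.isBigORho_mul_covDeriv hO hκ hp hp1 hh₂ hh₁ r s c a b)).const_mul _)).mono hp1
              (by omega)
  have hdensity : IsBigORho p 1 fun x => √(-(g x).det) / (16 * Real.pi * G) :=
    ((hg.isBigORho_sqrt_neg_det hO hp hp1).const_mul (16 * Real.pi * G)⁻¹).congr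
      (Eventually.of_forall fun x => div_eq_inv_mul _ _)
  exact (hdensity.mul hsum).mono hp1 (by omega)

end HorizonMetric

end Current

section Congr

variable {s : Set (Coord n)} {g g' h₁ h₁' h₂ h₂' : Tensor2 n} {x : Coord n}

lemma pd_congr {f f' : Coord n → ℝ} (hs : IsOpen s) (hf : EqOn f f' s) (hx : x ∈ s)
    (μ : Fin (n + 3)) : pd μ f x = pd μ f' x := by
  rw [pd, pd, (hf.eventuallyEq_of_mem (hs.mem_nhds hx)).fderiv_eq]

lemma christoffel_congr (hs : IsOpen s) (hg : EqOn g g' s) (hx : x ∈ s) (α μ ν : Fin (n + 3)) :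
    christoffel g α μ ν x = christoffel g' α μ ν x := by
  have hpd (γ α β) : pd γ (fun y => g y α β) x = pd γ (fun y => g' y α β) x :=
    pd_congr hs (fun y hy => by rw [hg hy]) hx γ
  simp only [christoffel, hpd, hg hx]

lemma covDeriv_congr (hs : IsOpen s) (hg : EqOn g g' s) (hh : EqOn h₁ h₁' s) (hx : x ∈ s)
    (γ α β : Fin (n + 3)) : covDeriv g h₁ γ α β x = covDeriv g' h₁' γ α β x := by
  have hpd (γ α β) : pd γ (fun y => h₁ y α β) x = pd γ (fun y => h₁' y α β) x :=
    pd_congr hs (fun y hy => by rw [hh hy]) hx γ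
  simp only [covDeriv, hpd, hh hx, christoffel_congr hs hg hx]

lemma presymplecticCurrent_congr (G : ℝ) (hs : IsOpen s) (hg : EqOn g g' s)
    (hh₁ : EqOn h₁ h₁' s) (hh₂ : EqOn h₂ h₂' s) (ν : Fin (n + 3)) :
    EqOn (presymplecticCurrent G g h₁ h₂ ν) (presymplecticCurrent G g' h₁' h₂' ν) s :=
  fun x hx => by
    simp only [presymplecticCurrent, covDeriv_congr hs hg hh₁ hx, covDeriv_congr hs hg hh₂ hx,
      hg hx, hh₁ hx, hh₂ hx]

lemma lieDeriv_eqOn_lieDerivWithin (ξ : VField n) (hg : EqOn g g' (openHalfSpace n)) :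
    EqOn (lieDeriv ξ g) (lieDerivWithin ξ g') (openHalfSpace n) := fun x hx => by
  ext μ ν
  refine Finset.sum_congr rfl fun α _ => ?_
  rw [pd_congr isOpen_openHalfSpace (fun y hy => by rw [hg hy]) hx, hg hx, pd_eq_pdWithin hx,
    pd_eq_pdWithin hx, pd_eq_pdWithin hx]

lemma pullback_eqOn_pullbackWithin (φ : Coord n → Coord n) (g : Tensor2 n) :
    EqOn (pullback φ g) (pullbackWithin φ g) (openHalfSpace n) := fun x hx => by
  ext μ ν
  refine Finset.sum_congr rfl fun α _ => Finset.sum_congr rfl fun β _ => ?_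
  rw [pd_eq_pdWithin hx, pd_eq_pdWithin hx]

end Congr

section Continuity

variable {O : Set (Coord n)} {g h h₁ h₂ : Tensor2 n} {x : Coord n}

lemma SmoothUpTo.continuousAt {f : Coord n → ℝ} (hf : SmoothUpTo O f) (hx : x ∈ O)
    (hx' : x ∈ openHalfSpace n) : ContinuousAt f x :=
  (hf x hx (openHalfSpace_subset_halfSpace hx')).continuousWithinAt.continuousAt
    (halfSpace_mem_nhds hx')

lemma SmoothUpTo.continuousAt_pd {f : Coord n → ℝ} (hf : SmoothUpTo O f) (hx : x ∈ O)
    (hx' : x ∈ openHalfSpace n) (μ : Fin (n + 3)) : ContinuousAt (pd μ f) x := by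
  refine ((hf.pdWithin μ).continuousAt hx hx').congr ?_
  filter_upwards [isOpen_openHalfSpace.mem_nhds hx'] with y hy
  exact (pd_eq_pdWithin hy).symm

lemma continuousAt_covDeriv (hg : ∀ μ ν, SmoothUpTo O fun y => g y μ ν)
    (hh : ∀ μ ν, SmoothUpTo O fun y => h y μ ν) (hx : x ∈ O) (hx' : x ∈ openHalfSpace n)
    (hinv : ∀ μ ν, ContinuousAt (fun y => (g y)⁻¹ μ ν) x) (γ α β : Fin (n + 3)) :
    ContinuousAt (covDeriv g h γ α β) x := by
  have hpd (μ α β) := (hg α β).continuousAt_pd hx hx' μ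
  have hh_cont (α β) := (hh α β).continuousAt hx hx'
  have hΓ (α μ ν) : ContinuousAt (christoffel g α μ ν) x :=
    continuousAt_const.mul (tendsto_finsetSum _ fun β _ =>
      (hinv α β).mul (((hpd μ β ν).add (hpd ν β μ)).sub (hpd β μ ν)))
  exact ((hh α β).continuousAt_pd hx hx' γ).sub (tendsto_finsetSum _ fun δ _ =>
    ((hΓ δ γ α).mul (hh_cont δ β)).add ((hΓ δ γ β).mul (hh_cont α δ)))

lemma continuousAt_currentCoeff (hinv : ∀ μ ν, ContinuousAt (fun y => (g y)⁻¹ μ ν) x)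
    (ν r s c a b : Fin (n + 3)) : ContinuousAt (fun y => currentCoeff (g y)⁻¹ ν r s c a b) x :=
  (((hinv ν a).mul (((hinv r s).mul (hinv b c)).sub
    ((continuousAt_const.mul (hinv r b)).mul (hinv s c)))).add
      ((continuousAt_const.mul (hinv ν c)).mul (continuousAt_const.mul
        (((hinv r a).mul (hinv s b)).sub ((hinv r s).mul (hinv a b)))))).add
    (((hinv ν r).mul (hinv a b)).mul (hinv s c))

lemma continuousAt_presymplecticCurrent (G : ℝ) (hg : ∀ μ ν, SmoothUpTo O fun y => g y μ ν)
    (hh₁ : ∀ μ ν, SmoothUpTo O fun y => h₁ y μ ν) (hh₂ : ∀ μ ν, SmoothUpTo O fun y => h₂ y μ ν)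
    (hx : x ∈ O) (hx' : x ∈ openHalfSpace n) (hdet : (g x).det ≠ 0) (ν : Fin (n + 3)) :
    ContinuousAt (presymplecticCurrent G g h₁ h₂ ν) x := by
  have hg_cont : ContinuousAt g x :=
    tendsto_pi_nhds.2 fun μ => tendsto_pi_nhds.2 fun ν => (hg μ ν).continuousAt hx hx'
  have hinv (μ ν) : ContinuousAt (fun y => (g y)⁻¹ μ ν) x :=
    tendsto_pi_nhds.1 (tendsto_pi_nhds.1 (tendsto_matrix_inv hg_cont hdet) μ) ν
  have hdensity : ContinuousAt (fun y => √(-(g y).det) / (16 * Real.pi * G)) x :=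
    (Real.continuous_sqrt.continuousAt.comp
      ((continuous_id.matrix_det.tendsto _).comp hg_cont).neg).div_const _
  exact hdensity.mul (tendsto_finsetSum _ fun r _ => tendsto_finsetSum _ fun s _ =>
    tendsto_finsetSum _ fun c _ => tendsto_finsetSum _ fun a _ => tendsto_finsetSum _ fun b _ =>
      (continuousAt_currentCoeff hinv ν r s c a b).mul (continuousAt_const.mul
        ((((hh₁ r s).continuousAt hx hx').mul
          (continuousAt_covDeriv hg hh₂ hx hx' hinv c a b)).sub
        (((hh₂ r s).continuousAt hx hx').mul
          (continuousAt_covDeriv hg hh₁ hx hx' hinv c a b)))))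

end Continuity

section Integrand

variable {O : Set (Coord n)} {g g' : Tensor2 n} {κ : ℝ} {ξ η χ : VField n} {p : Coord n}

lemma presymplecticCurrent_lieDeriv_eqOn (G : ℝ) (hgg' : EqOn g g' (openHalfSpace n))
    (η χ : VField n) (ν : Fin (n + 3)) :
    EqOn (presymplecticCurrent G g (lieDeriv η g) (lieDeriv χ g) ν)
      (presymplecticCurrent G g' (lieDerivWithin η g') (lieDerivWithin χ g') ν)
      (openHalfSpace n) :=
  presymplecticCurrent_congr G isOpen_openHalfSpace hgg' (lieDeriv_eqOn_lieDerivWithin η hgg')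
    (lieDeriv_eqOn_lieDerivWithin χ hgg') ν

namespace HorizonMetric

lemma isBigORho_presymplecticCurrent_lieDeriv (hO : IsOpen O) (hg : HorizonMetric κ O g')
    (hκ : κ ≠ 0) (hgg' : EqOn g g' (openHalfSpace n)) (G : ℝ) (hη : AdmissibleField O η)
    (hχ : AdmissibleField O χ) (hp : p ∈ O) (hp1 : p 1 = 0) (ν : Fin (n + 3)) :
    IsBigORho p (1 - weight (indexType ν))
      (presymplecticCurrent G g (lieDeriv η g) (lieDeriv χ g) ν) :=
  (hg.isBigORho_presymplecticCurrent hO hκ hp hp1 G (hg.metricVariation_lieDerivWithin hO hη)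
    (hg.metricVariation_lieDerivWithin hO hχ) ν).congr
      ((presymplecticCurrent_lieDeriv_eqOn G hgg' η χ ν).eventuallyEq_of_mem self_mem_nhdsWithin)

lemma eventually_continuousAt_presymplecticCurrent_lieDeriv (hO : IsOpen O)
    (hg : HorizonMetric κ O g') (hκ : κ ≠ 0) (hgg' : EqOn g g' (openHalfSpace n)) (G : ℝ)
    (hη : AdmissibleField O η) (hχ : AdmissibleField O χ) (hp : p ∈ O) (hp1 : p 1 = 0)
    (ν : Fin (n + 3)) :
    ∀ᶠ x in 𝓝[openHalfSpace n] p,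
      ContinuousAt (presymplecticCurrent G g (lieDeriv η g) (lieDeriv χ g) ν) x := by
  filter_upwards [self_mem_nhdsWithin, mem_nhdsWithin_of_mem_nhds (hO.mem_nhds hp),
    hg.eventually_det_ne_zero hO hκ hp hp1] with x hx hxO hdet
  refine (continuousAt_presymplecticCurrent G (fun α β => (hg.order hO α β).smoothUpTo)
    (fun α β => ((hg.metricVariation_lieDerivWithin hO hη).order α β).smoothUpTo)
    (fun α β => ((hg.metricVariation_lieDerivWithin hO hχ).order α β).smoothUpTo)
    hxO hx hdet ν).congr ?_
  exact (presymplecticCurrent_lieDeriv_eqOn G hgg' η χ ν).symm.eventuallyEq_of_mem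
    (isOpen_openHalfSpace.mem_nhds hx)

lemma isBigORho_integrand (hO : IsOpen O) (hg : HorizonMetric κ O g') (hκ : κ ≠ 0)
    (hgg' : EqOn g g' (openHalfSpace n)) (G : ℝ) (hξ : AdmissibleField O ξ)
    (hη : AdmissibleField O η) (hχ : AdmissibleField O χ) (hp : p ∈ O) (hp1 : p 1 = 0) :
    IsBigORho p 1 (integrand G g ξ η χ) := by
  have hω := hg.isBigORho_presymplecticCurrent_lieDeriv hO hκ hgg' G hη hχ hp hp1
  have hξω_ρ := ((hξ.order 0).isBigORho hO hp hp1).mul (hω 1)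
  have hξω_t := ((hξ.order 1).isBigORho hO hp hp1).mul (hω 0)
  exact ((hξω_ρ.mono hp1 (show 1 ≤ fieldOrder 0 + (1 - weight 1) by decide)).sub
    (hξω_t.mono hp1 (show 1 ≤ fieldOrder 1 + (1 - weight 0) by decide))).const_mul _

lemma eventually_continuousAt_integrand (hO : IsOpen O) (hg : HorizonMetric κ O g') (hκ : κ ≠ 0)
    (hgg' : EqOn g g' (openHalfSpace n)) (G : ℝ) (hξ : AdmissibleField O ξ)
    (hη : AdmissibleField O η) (hχ : AdmissibleField O χ) (hp : p ∈ O) (hp1 : p 1 = 0) :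
    ∀ᶠ x in 𝓝[openHalfSpace n] p, ContinuousAt (integrand G g ξ η χ) x := by
  have hω := hg.eventually_continuousAt_presymplecticCurrent_lieDeriv hO hκ hgg' G hη hχ hp hp1
  filter_upwards [self_mem_nhdsWithin, mem_nhdsWithin_of_mem_nhds (hO.mem_nhds hp), hω 0, hω 1]
    with x hx hxO hω_t hω_ρ
  exact continuousAt_const.mul ((((hξ.smooth 0).continuousAt hxO hx).mul hω_ρ).sub
    (((hξ.smooth 1).continuousAt hxO hx).mul hω_t))

end HorizonMetric

end Integrand

/-! ### Integrals over the cross-sections -/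

section Slice

variable {t : ℝ} {K : Set (Fin (n + 1) → ℝ)} {F : Coord n → ℝ}

lemma continuous_slicePt (t : ℝ) :
    Continuous fun q : ℝ × (Fin (n + 1) → ℝ) => slicePt t q.1 q.2 := by
  refine continuous_pi fun μ => ?_
  cases μ using index_cases with
  | t => exact continuous_const
  | ρ => exact continuous_fst
  | cross M => exact (continuous_apply M).comp continuous_snd

lemma tendsto_slicePt (t : ℝ) (y : Fin (n + 1) → ℝ) :
    Tendsto (fun ρ => slicePt t ρ y) (𝓝[>] 0) (𝓝[openHalfSpace n] slicePt t 0 y) :=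
  tendsto_nhdsWithin_iff.2 ⟨(((continuous_slicePt t).comp (Continuous.prodMk_left y)).tendsto
    0).mono_left nhdsWithin_le_nhds, self_mem_nhdsWithin⟩

lemma eventually_forall_slicePt (hK : IsCompact K) {P : Coord n → Prop}
    (hP : ∀ y ∈ K, ∀ᶠ x in 𝓝[openHalfSpace n] (slicePt t 0 y), P x) :
    ∀ᶠ ρ in 𝓝[>] (0 : ℝ), ∀ y ∈ K, P (slicePt t ρ y) := by
  have hnear := hK.eventually_forall_of_forall_eventually (x₀ := (0 : ℝ))
    (P := fun ρ y => 0 < ρ → P (slicePt t ρ y)) fun y hy =>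
      ((continuous_slicePt t).tendsto (0, y)).eventually (eventually_nhdsWithin_iff.1 (hP y hy))
  filter_upwards [self_mem_nhdsWithin, nhdsWithin_le_nhds hnear] with ρ hρ h y hy
  exact h y hy hρ

lemma eventually_integrableOn_slicePt (hK : IsCompact K)
    (hF : ∀ y ∈ K, ∀ᶠ x in 𝓝[openHalfSpace n] (slicePt t 0 y), ContinuousAt F x) :
    ∀ᶠ ρ in 𝓝[>] (0 : ℝ), IntegrableOn (fun y => F (slicePt t ρ y)) K := by
  filter_upwards [eventually_forall_slicePt hK hF] with ρ hρ
  refine ContinuousOn.integrableOn_compact hK fun y hy => ?_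
  have hslice : Continuous fun y : Fin (n + 1) → ℝ => slicePt t ρ y :=
    (continuous_slicePt t).comp (Continuous.prodMk_right ρ)
  exact (ContinuousAt.comp (g := F) (hρ y hy) hslice.continuousAt).continuousWithinAt

lemma tendsto_setIntegral_slicePt (hK : IsCompact K)
    (hF : ∀ y ∈ K, ∀ᶠ x in 𝓝[openHalfSpace n] (slicePt t 0 y), ContinuousAt F x)
    (hF0 : ∀ y ∈ K, Tendsto F (𝓝[openHalfSpace n] (slicePt t 0 y)) (𝓝 0)) :
    Tendsto (fun ρ => ∫ y in K, F (slicePt t ρ y)) (𝓝[>] (0 : ℝ)) (𝓝 0) := by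
  have hbound : ∀ᶠ ρ in 𝓝[>] (0 : ℝ), ∀ y ∈ K, ‖F (slicePt t ρ y)‖ ≤ 1 :=
    eventually_forall_slicePt hK fun y hy =>
      (hF0 y hy).norm.eventually_le_const (by simp)
  have hlim := tendsto_integral_filter_of_dominated_convergence (μ := volume.restrict K)
    (f := fun _ => (0 : ℝ)) (fun _ => 1)
    ((eventually_integrableOn_slicePt hK hF).mono fun ρ h => h.aestronglyMeasurable)
    (hbound.mono fun ρ h => ae_restrict_of_forall_mem hK.measurableSet h)
    (integrableOn_const hK.measure_lt_top.ne)
    (ae_restrict_of_forall_mem hK.measurableSet fun y hy => (hF0 y hy).comp (tendsto_slicePt t y))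
  simpa only [integral_zero] using hlim

end Slice

/-! ### Flows -/

lemma linear_ode_eqOn_Icc {E : Type*} [NormedAddCommGroup E] [NormedSpace ℝ E] {a b t₀ : ℝ}
    {A : ℝ → E →L[ℝ] E} (hA : ContinuousOn A (Icc a b)) {u w : ℝ → E}
    (hu : ∀ s ∈ Icc a b, HasDerivWithinAt u (A s (u s)) (Icc a b) s)
    (hw : ∀ s ∈ Icc a b, HasDerivWithinAt w (A s (w s)) (Icc a b) s)
    (ht₀ : t₀ ∈ Icc a b) (h : u t₀ = w t₀) : EqOn u w (Icc a b) := by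
  obtain ⟨K, hK⟩ := isCompact_Icc.exists_bound_of_continuousOn hA
  have hlip : ∀ s ∈ Icc a b, LipschitzOnWith K.toNNReal (fun e => A s e) univ := fun s hs =>
    ((A s).lipschitz.weaken (NNReal.le_toNNReal_of_coe_le (hK s hs))).lipschitzOnWith
  have hu_cont : ContinuousOn u (Icc a b) := fun s hs => (hu s hs).continuousWithinAt
  have hw_cont : ContinuousOn w (Icc a b) := fun s hs => (hw s hs).continuousWithinAt
  have hleft : Icc a t₀ ⊆ Icc a b := Icc_subset_Icc_right ht₀.2
  have hright : Icc t₀ b ⊆ Icc a b := Icc_subset_Icc_left ht₀.1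
  have hnhdsLE : ∀ s ∈ Ioc a t₀, Icc a b ∈ 𝓝[≤] s := fun s hs =>
    mem_of_superset (Icc_mem_nhdsLE hs.1) (Icc_subset_Icc_right (hs.2.trans ht₀.2))
  have hnhdsGE : ∀ s ∈ Ico t₀ b, Icc a b ∈ 𝓝[≥] s := fun s hs =>
    mem_of_superset (Icc_mem_nhdsGE hs.2) (Icc_subset_Icc_left (ht₀.1.trans hs.1))
  rw [← Icc_union_Icc_eq_Icc ht₀.1 ht₀.2]
  refine EqOn.union ?_ ?_
  · have hsub : Ioc a t₀ ⊆ Icc a b := Ioc_subset_Icc_self.trans hleft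
    exact ODE_solution_unique_of_mem_Icc_left (v := fun s e => A s e) (s := fun _ => univ)
      (fun s hs => hlip s (hsub hs)) (hu_cont.mono hleft)
      (fun s hs => (hu s (hsub hs)).mono_of_mem_nhdsWithin (hnhdsLE s hs)) (fun _ _ => trivial)
      (hw_cont.mono hleft)
      (fun s hs => (hw s (hsub hs)).mono_of_mem_nhdsWithin (hnhdsLE s hs)) (fun _ _ => trivial) h
  · have hsub : Ico t₀ b ⊆ Icc a b := Ico_subset_Icc_self.trans hright
    exact ODE_solution_unique_of_mem_Icc_right (v := fun s e => A s e) (s := fun _ => univ)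
      (fun s hs => hlip s (hsub hs)) (hu_cont.mono hright)
      (fun s hs => (hu s (hsub hs)).mono_of_mem_nhdsWithin (hnhdsGE s hs)) (fun _ _ => trivial)
      (hw_cont.mono hright)
      (fun s hs => (hw s (hsub hs)).mono_of_mem_nhdsWithin (hnhdsGE s hs)) (fun _ _ => trivial) h

section Flow

variable {E F : Type*} [NormedAddCommGroup E] [NormedSpace ℝ E] [NormedAddCommGroup F]
  [NormedSpace ℝ F]

lemma fderivWithin_apply_slice {S : Set ℝ} {W : Set E} {Φ : ℝ → E → F} {s : ℝ} {x : E}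
    (hΦ : DifferentiableWithinAt ℝ (Function.uncurry Φ) (S ×ˢ W) (s, x)) (hs : s ∈ S)
    (hW : UniqueDiffWithinAt ℝ W x) (v : E) :
    fderivWithin ℝ (Φ s) W x v = fderivWithin ℝ (Function.uncurry Φ) (S ×ˢ W) (s, x) (0, v) := by
  have hslice : HasFDerivWithinAt (fun y : E => (s, y)) (ContinuousLinearMap.inr ℝ ℝ E) W x :=
    (hasFDerivAt_prodMk_right s x).hasFDerivWithinAt
  have hcomp := hΦ.hasFDerivWithinAt.comp x hslice fun y hy => (⟨hs, hy⟩ : (s, y) ∈ S ×ˢ W)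
  exact congrArg (fun L => L v) (hcomp.fderivWithin hW)

/-- `Φ` is the flow of `ξ` for times in `[0, 1]`, of initial points in `W` and with trajectories
in `R`. -/
structure IsFlowOn (ξ : E → E) (W R : Set E) (Φ : ℝ → E → E) : Prop where
  initial : ∀ x ∈ W, Φ 0 x = x
  mapsTo : ∀ s ∈ Icc (0 : ℝ) 1, MapsTo (Φ s) W R
  hasDerivWithinAt : ∀ x ∈ W, ∀ s ∈ Icc (0 : ℝ) 1,
    HasDerivWithinAt (fun s' => Φ s' x) (ξ (Φ s x)) (Icc 0 1) s

namespace IsFlowOn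

variable {ξ : E → E} {W R : Set E} {Φ : ℝ → E → E} {x : E} {s : ℝ}

lemma fderivWithin_zero (h : IsFlowOn ξ W R Φ) (hW : UniqueDiffOn ℝ W) (hx : x ∈ W) :
    fderivWithin ℝ (Φ 0) W x = ContinuousLinearMap.id ℝ E := by
  have hcongr : fderivWithin ℝ (Φ 0) W x = fderivWithin ℝ id W x :=
    fderivWithin_congr h.initial (h.initial x hx)
  rw [hcongr, fderivWithin_id (hW x hx)]

lemma fderivWithin_time (h : IsFlowOn ξ W R Φ)
    (hΦ : DifferentiableOn ℝ (Function.uncurry Φ) (Icc (0 : ℝ) 1 ×ˢ W)) (hx : x ∈ W)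
    (hs : s ∈ Icc (0 : ℝ) 1) :
    fderivWithin ℝ (Function.uncurry Φ) (Icc (0 : ℝ) 1 ×ˢ W) (s, x) (1, 0) = ξ (Φ s x) := by
  have hcurve : HasDerivWithinAt (fun s' : ℝ => (s', x)) ((1 : ℝ), (0 : E)) (Icc 0 1) s :=
    ((hasDerivAt_id s).prodMk (hasDerivAt_const s x)).hasDerivWithinAt
  have hcomp := (hΦ (s, x) ⟨hs, hx⟩).hasFDerivWithinAt.comp_hasDerivWithinAt s hcurve
    fun r hr => (⟨hr, hx⟩ : (r, x) ∈ Icc (0 : ℝ) 1 ×ˢ W)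
  exact (uniqueDiffOn_Icc one_pos s hs).eq_deriv _ hcomp (h.hasDerivWithinAt x hx s hs)

lemma fderivWithin_fderivWithin_time (h : IsFlowOn ξ W R Φ) (hW : UniqueDiffOn ℝ W)
    (hΦ : DifferentiableOn ℝ (Function.uncurry Φ) (Icc (0 : ℝ) 1 ×ˢ W))
    (hξ : DifferentiableOn ℝ ξ R) (hx : x ∈ W) (hs : s ∈ Icc (0 : ℝ) 1) (v : E) :
    fderivWithin ℝ (fun q => fderivWithin ℝ (Function.uncurry Φ) (Icc (0 : ℝ) 1 ×ˢ W) q (1, 0))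
        (Icc (0 : ℝ) 1 ×ˢ W) (s, x) (0, v) =
      fderivWithin ℝ ξ R (Φ s x) (fderivWithin ℝ (Φ s) W x v) := by
  have hq : (s, x) ∈ Icc (0 : ℝ) 1 ×ˢ W := ⟨hs, hx⟩
  have hmaps : MapsTo (Function.uncurry Φ) (Icc (0 : ℝ) 1 ×ˢ W) R := fun q hq =>
    h.mapsTo q.1 hq.1 hq.2
  have hcomp := (hξ _ (hmaps hq)).hasFDerivWithinAt.comp (s, x) (hΦ _ hq).hasFDerivWithinAt hmaps
  have htime := hcomp.congr (fun q hq => h.fderivWithin_time hΦ hq.2 hq.1)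
    (h.fderivWithin_time hΦ hx hs)
  rw [htime.fderivWithin (((uniqueDiffOn_Icc one_pos).prod hW) _ hq),
    fderivWithin_apply_slice (hΦ _ hq) hs (hW x hx)]
  rfl

lemma hasDerivWithinAt_fderivWithin (h : IsFlowOn ξ W R Φ) (hW : UniqueDiffOn ℝ W)
    (hWi : W ⊆ closure (interior W))
    (hΦ : ContDiffOn ℝ 2 (Function.uncurry Φ) (Icc (0 : ℝ) 1 ×ˢ W)) (hξ : DifferentiableOn ℝ ξ R)
    (hx : x ∈ W) (v : E) (hs : s ∈ Icc (0 : ℝ) 1) :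
    HasDerivWithinAt (fun s' => fderivWithin ℝ (Φ s') W x v)
      (fderivWithin ℝ ξ R (Φ s x) (fderivWithin ℝ (Φ s) W x v)) (Icc 0 1) s := by
  set S := Icc (0 : ℝ) 1 ×ˢ W with hS
  set D := fderivWithin ℝ (Function.uncurry Φ) S
  have hΦd : DifferentiableOn ℝ (Function.uncurry Φ) S := hΦ.differentiableOn two_ne_zero
  have hS_unique : UniqueDiffOn ℝ S := (uniqueDiffOn_Icc one_pos).prod hW
  have hS_closure : S ⊆ closure (interior S) := by
    rw [hS, interior_prod_eq, closure_prod_eq, interior_Icc, closure_Ioo zero_ne_one]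
    exact prod_mono Subset.rfl hWi
  have hq : (s, x) ∈ S := ⟨hs, hx⟩
  have hcurve : HasDerivWithinAt (fun s' : ℝ => (s', x)) ((1 : ℝ), (0 : E)) (Icc 0 1) s :=
    ((hasDerivAt_id s).prodMk (hasDerivAt_const s x)).hasDerivWithinAt
  have hDv : DifferentiableWithinAt ℝ (fun q => D q ((0 : ℝ), v)) S (s, x) :=
    (((hΦ _ hq).fderivWithin_right (m := 1) hS_unique le_rfl hq).differentiableWithinAt
      one_ne_zero).clm_apply (differentiableWithinAt_const _)
  have hderiv := hDv.hasFDerivWithinAt.comp_hasDerivWithinAt s hcurve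
    fun r hr => (⟨hr, hx⟩ : (r, x) ∈ S)
  rw [fderivWithin_fderivWithin_apply_comm (hΦ _ hq) hS_unique (hS_closure hq) hq,
    h.fderivWithin_fderivWithin_time hW hΦd hξ hx hs] at hderiv
  exact hderiv.congr (fun r hr => fderivWithin_apply_slice (hΦd _ ⟨hr, hx⟩) hr (hW x hx) v)
    (fderivWithin_apply_slice (hΦd _ hq) hs (hW x hx) v)

lemma continuousOn_fderivWithin_field (h : IsFlowOn ξ W R Φ) (hR : UniqueDiffOn ℝ R)
    (hξ : ContDiffOn ℝ 1 ξ R) (hx : x ∈ W) :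
    ContinuousOn (fun s => fderivWithin ℝ ξ R (Φ s x)) (Icc 0 1) :=
  (hξ.continuousOn_fderivWithin hR le_rfl).comp
    (fun s hs => (h.hasDerivWithinAt x hx s hs).continuousWithinAt) fun s hs => h.mapsTo s hs hx

lemma fderivWithin_apply_eq_self (h : IsFlowOn ξ W R Φ) (hW : UniqueDiffOn ℝ W)
    (hWi : W ⊆ closure (interior W)) (hR : UniqueDiffOn ℝ R)
    (hΦ : ContDiffOn ℝ 2 (Function.uncurry Φ) (Icc (0 : ℝ) 1 ×ˢ W)) (hξ : ContDiffOn ℝ 1 ξ R)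
    (hx : x ∈ W) {v : E} (hv : ∀ s ∈ Icc (0 : ℝ) 1, fderivWithin ℝ ξ R (Φ s x) v = 0)
    (hs : s ∈ Icc (0 : ℝ) 1) : fderivWithin ℝ (Φ s) W x v = v := by
  refine linear_ode_eqOn_Icc (w := fun _ => v) (h.continuousOn_fderivWithin_field hR hξ hx)
    (fun r hr => h.hasDerivWithinAt_fderivWithin hW hWi hΦ (hξ.differentiableOn one_ne_zero) hx v
      hr)
    (fun r hr => ?_) (left_mem_Icc.2 zero_le_one) ?_ hs
  · rw [hv r hr]
    exact hasDerivWithinAt_const r _ v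
  · rw [h.fderivWithin_zero hW hx, ContinuousLinearMap.id_apply]

lemma injective_fderivWithin (h : IsFlowOn ξ W R Φ) (hW : UniqueDiffOn ℝ W)
    (hWi : W ⊆ closure (interior W)) (hR : UniqueDiffOn ℝ R)
    (hΦ : ContDiffOn ℝ 2 (Function.uncurry Φ) (Icc (0 : ℝ) 1 ×ˢ W)) (hξ : ContDiffOn ℝ 1 ξ R)
    (hx : x ∈ W) (hs : s ∈ Icc (0 : ℝ) 1) : Function.Injective (fderivWithin ℝ (Φ s) W x) := by
  refine (injective_iff_map_eq_zero _).2 fun v hv => ?_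
  have hzero := linear_ode_eqOn_Icc (w := fun _ => 0) (h.continuousOn_fderivWithin_field hR hξ hx)
    (fun r hr => h.hasDerivWithinAt_fderivWithin hW hWi hΦ (hξ.differentiableOn one_ne_zero) hx v
      hr)
    (fun r _ => by rw [map_zero]; exact hasDerivWithinAt_const r _ 0) hs hv
    (left_mem_Icc.2 zero_le_one)
  simpa only [h.fderivWithin_zero hW hx, ContinuousLinearMap.id_apply] using hzero

end IsFlowOn

end Flow

/-! ### The coordinate domain -/

section OpenPart

variable {O : Set (Coord n)} {x : Coord n}

lemma uniqueDiffOn_inter_halfSpace (hO : IsOpen O) : UniqueDiffOn ℝ (O ∩ halfSpace n) := by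
  rw [inter_comm]
  exact uniqueDiffOn_halfSpace.inter hO

lemma inter_halfSpace_subset_closure_interior (hO : IsOpen O) :
    O ∩ halfSpace n ⊆ closure (interior (O ∩ halfSpace n)) := by
  rintro x ⟨hx, hx'⟩
  rw [interior_inter, hO.interior_eq]
  exact hO.inter_closure ⟨hx, halfSpace_subset_closure_interior hx'⟩

lemma fderivWithin_inter_halfSpace {F : Type*} [NormedAddCommGroup F] [NormedSpace ℝ F]
    (hO : IsOpen O) (f : Coord n → F) (hx : x ∈ O) :
    fderivWithin ℝ f (O ∩ halfSpace n) x = fderivWithin ℝ f (halfSpace n) x := by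
  rw [inter_comm]
  exact fderivWithin_inter (hO.mem_nhds hx)

lemma forall_smoothUpTo_iff_contDiffOn (hO : IsOpen O) {φ : Coord n → Coord n} :
    (∀ α, SmoothUpTo O fun x => φ x α) ↔ ContDiffOn ℝ ∞ φ (O ∩ halfSpace n) := by
  rw [contDiffOn_pi]
  exact forall_congr' fun α => smoothUpTo_iff_contDiffOn hO

end OpenPart

/-- The open conditions `ρ < ρ₀` and `x^M ∈ U` that cut the coordinate domain out of the half
space. -/
def chart (ρ₀ : ℝ) (U : Set (Fin (n + 1) → ℝ)) : Set (Coord n) := {x | x 1 < ρ₀ ∧ crossPt x ∈ U}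

/-- The projection `x ↦ x^M` to the cross-section, as a continuous linear map. -/
def crossCLM (n : ℕ) : Coord n →L[ℝ] (Fin (n + 1) → ℝ) :=
  ContinuousLinearMap.pi fun M => ContinuousLinearMap.proj M.succ.succ

lemma crossCLM_single {μ : Fin (n + 3)} (hμ : indexType μ ≠ 2) :
    crossCLM n (Pi.single μ 1) = 0 := by
  ext M
  have hM : (M.succ.succ : Fin (n + 3)) ≠ μ := fun h => hμ (h ▸ rfl)
  simp [crossCLM, hM]

section Chart

variable {ρ₀ : ℝ} {U : Set (Fin (n + 1) → ℝ)}

lemma region_eq_chart_inter_halfSpace : region ρ₀ U = chart ρ₀ U ∩ halfSpace n := by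
  ext x
  simp only [region, chart, halfSpace, mem_ofPred_eq, mem_inter_iff]
  tauto

lemma isOpen_chart (hU : IsOpen U) : IsOpen (chart ρ₀ U : Set (Coord n)) :=
  (isOpen_lt (continuous_apply 1) continuous_const).inter (hU.preimage (crossCLM n).continuous)

lemma uniqueDiffOn_region (hU : IsOpen U) : UniqueDiffOn ℝ (region ρ₀ U : Set (Coord n)) := by
  rw [region_eq_chart_inter_halfSpace]
  exact uniqueDiffOn_inter_halfSpace (isOpen_chart hU)

lemma SmoothO.vanishesToOrder (hU : IsOpen U) {k : ℕ} {f : Coord n → ℝ}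
    (h : SmoothO ρ₀ U k f) : VanishesToOrder (chart ρ₀ U) k f := by
  obtain ⟨r, hr, hf⟩ := h
  rw [region_eq_chart_inter_halfSpace] at hr hf
  have hO : IsOpen (chart ρ₀ U : Set (Coord n)) := isOpen_chart hU
  exact ((vanishesToOrder_rho_pow hO k).mul hO (l := 0)
    ((smoothUpTo_iff_contDiffOn hO).2 hr)).congr hO fun x hx hx' => hf x ⟨hx, hx'⟩

variable {A : (Fin (n + 1) → ℝ) → ℝ} {x : Coord n}

lemma smoothUpTo_comp_crossPt (hU : IsOpen U) (hA : ContDiffOn ℝ ∞ A U) :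
    SmoothUpTo (chart ρ₀ U) fun x => A (crossPt x) := fun x hx _ =>
  ((hA.contDiffAt (hU.mem_nhds hx.2)).comp x
    (crossCLM n).contDiff.contDiffAt).contDiffWithinAt

lemma hasFDerivAt_comp_crossPt (hA : DifferentiableAt ℝ A (crossPt x)) :
    HasFDerivAt (fun x => A (crossPt x)) ((fderiv ℝ A (crossPt x)).comp (crossCLM n)) x :=
  hA.hasFDerivAt.comp x (crossCLM n).hasFDerivAt

lemma pdWithin_comp_crossPt (hA : DifferentiableAt ℝ A (crossPt x)) {μ : Fin (n + 3)}
    (hμ : indexType μ ≠ 2) (hx : x ∈ halfSpace n) : pdWithin μ (fun y => A (crossPt y)) x = 0 := by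
  rw [pdWithin, (hasFDerivAt_comp_crossPt hA).hasFDerivWithinAt.fderivWithin
    (uniqueDiffOn_halfSpace x hx), ContinuousLinearMap.comp_apply, crossCLM_single hμ, map_zero]

section SubCrossPt

variable {k : ℕ} {f : Coord n → ℝ}

lemma VanishesToOrder.smoothUpTo_of_sub_crossPt (hU : IsOpen U) (hA : ContDiffOn ℝ ∞ A U)
    (hf : VanishesToOrder (chart ρ₀ U) k fun x => f x - A (crossPt x)) :
    SmoothUpTo (chart ρ₀ U) f := by
  simpa only [sub_add_cancel] using hf.smoothUpTo.add (smoothUpTo_comp_crossPt hU hA)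

lemma VanishesToOrder.pdWithin_sub_crossPt (hU : IsOpen U) (hA : ContDiffOn ℝ ∞ A U)
    (hf : VanishesToOrder (chart ρ₀ U) k fun x => f x - A (crossPt x)) {μ : Fin (n + 3)}
    (hμ : indexType μ ≠ 2) (hx : x ∈ chart ρ₀ U) (hx' : x ∈ halfSpace n) :
    KillingHorizon.pdWithin μ f x =
      KillingHorizon.pdWithin μ (fun y => f y - A (crossPt y)) x := by
  have hadd := pdWithin_add hf.smoothUpTo (smoothUpTo_comp_crossPt hU hA) μ hx hx'
  have hAx : DifferentiableAt ℝ A (crossPt x) :=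
    (hA.contDiffAt (hU.mem_nhds hx.2)).differentiableAt (by simp)
  simpa only [sub_add_cancel, pdWithin_comp_crossPt hAx hμ hx', add_zero] using hadd

lemma VanishesToOrder.pdWithin_t_of_sub_crossPt (hU : IsOpen U) (hA : ContDiffOn ℝ ∞ A U)
    (hf : VanishesToOrder (chart ρ₀ U) k fun x => f x - A (crossPt x)) :
    VanishesToOrder (chart ρ₀ U) k (KillingHorizon.pdWithin 0 f) :=
  (hf.pdWithin_tangent (isOpen_chart hU) (by simp)).congr (isOpen_chart hU) fun _ hx hx' =>
    hf.pdWithin_sub_crossPt hU hA (by simp) hx hx'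

lemma VanishesToOrder.pdWithin_rho_of_sub_crossPt (hU : IsOpen U) (hA : ContDiffOn ℝ ∞ A U)
    (hf : VanishesToOrder (chart ρ₀ U) k fun x => f x - A (crossPt x)) :
    VanishesToOrder (chart ρ₀ U) (k - 1) (KillingHorizon.pdWithin 1 f) :=
  hf.pdWithin_rho.congr (isOpen_chart hU) fun _ hx hx' =>
    hf.pdWithin_sub_crossPt hU hA (by simp) hx hx'

end SubCrossPt

lemma HasLeading.admissibleField (hU : IsOpen U) {ξ : VField n} {T : (Fin (n + 1) → ℝ) → ℝ}
    {V : (Fin (n + 1) → ℝ) → Fin (n + 1) → ℝ} (h : HasLeading ρ₀ U ξ T V) :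
    AdmissibleField (chart ρ₀ U) ξ := by
  have ht := h.t.vanishesToOrder hU
  have hρ := h.ρ.vanishesToOrder hU
  have hcross := fun M => (h.cross M).vanishesToOrder hU
  have hV := contDiffOn_pi.1 h.smooth_V
  refine ⟨fun α => ?_, hρ, fun α => ?_, fun α => ?_⟩
  · cases α using index_cases with
    | t => exact ht.smoothUpTo_of_sub_crossPt hU h.smooth_T
    | ρ => exact hρ.smoothUpTo
    | cross M => exact (hcross M).smoothUpTo_of_sub_crossPt hU (hV M)
  · cases α using index_cases with
    | t => exact ht.pdWithin_t_of_sub_crossPt hU h.smooth_T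
    | ρ => exact hρ.pdWithin_tangent (isOpen_chart hU) (by simp)
    | cross M => exact (hcross M).pdWithin_t_of_sub_crossPt hU (hV M)
  · cases α using index_cases with
    | t => exact ht.pdWithin_rho_of_sub_crossPt hU h.smooth_T
    | ρ => exact hρ.pdWithin_rho
    | cross M => exact (hcross M).pdWithin_rho_of_sub_crossPt hU (hV M)

lemma admissibleField_of_mem_stsr (hU : IsOpen U) {ξ : VField n} (hξ : ξ ∈ stsr ρ₀ U) :
    AdmissibleField (chart ρ₀ U) ξ := by
  obtain ⟨T, V, h⟩ := hξ
  exact h.admissibleField hU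

end Chart

/-! ### The diffeomorphisms generated by the algebra -/

lemma horizonMap_id {O O' : Set (Coord n)} (h : O ⊆ O') :
    HorizonMap O O' (id : Coord n → Coord n) := by
  have hid : ∀ x : Coord n, x 1 = 0 →
      fderivWithin ℝ id (halfSpace n) x = ContinuousLinearMap.id ℝ _ :=
    fun x hx1 => fderivWithin_id (uniqueDiffOn_halfSpace x hx1.ge)
  exact
    { smooth := smoothUpTo_coord
      maps := fun x hx hx' => ⟨h hx, hx'⟩
      horizon := fun _ _ hx1 => hx1
      fderiv_t := fun x _ hx1 => by rw [hid x hx1, ContinuousLinearMap.id_apply]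
      fderiv_ρ := fun x _ hx1 => by rw [hid x hx1, ContinuousLinearMap.id_apply]
      injective := fun x _ hx1 => by rw [hid x hx1]; exact Function.injective_id }

lemma AdmissibleField.fderivWithin_single_eq_zero {O : Set (Coord n)} {ξ : VField n}
    (hξ : AdmissibleField O ξ) {μ : Fin (n + 3)} (hμ : indexType μ ≠ 2) {x : Coord n} (hx : x ∈ O)
    (hx1 : x 1 = 0) : fderivWithin ℝ ξ (halfSpace n) x (Pi.single μ 1) = 0 := by
  rw [fderivWithin_eq_vecMul_jacobian (differentiableWithinAt_pi.2 fun α =>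
    (hξ.smooth α).differentiableWithinAt hx hx1.ge) hx1.ge, Matrix.single_one_vecMul]
  ext α
  cases μ using index_cases with
  | t => exact (hξ.pd_t α).eq_zero hx hx1
  | ρ => exact (hξ.pd_ρ α).eq_zero hx hx1
  | cross M => exact absurd rfl hμ

section Generated

variable {ρ₀ : ℝ} {U : Set (Fin (n + 1) → ℝ)}

namespace IsFlowOn

variable {ξ : VField n} {W O : Set (Coord n)} {Φ : ℝ → Coord n → Coord n} {x : Coord n} {s : ℝ}

lemma rho_eq_zero {k : ℕ} (hξ : SmoothO ρ₀ U (k + 1) fun x => ξ x 1)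
    (h : IsFlowOn ξ W (region ρ₀ U) Φ) (hx : x ∈ W) (hx1 : x 1 = 0) (hs : s ∈ Icc (0 : ℝ) 1) :
    Φ s x 1 = 0 := by
  obtain ⟨r, hr, hξr⟩ := hξ
  have hmaps : MapsTo (fun s => Φ s x) (Icc 0 1) (region ρ₀ U) := fun s hs => h.mapsTo s hs hx
  have hc : ContinuousOn (fun s => Φ s x) (Icc 0 1) := fun s hs =>
    (h.hasDerivWithinAt x hx s hs).continuousWithinAt
  have hA : ContinuousOn
      (fun s => (Φ s x 1 ^ k * r (Φ s x)) • ContinuousLinearMap.id ℝ ℝ) (Icc 0 1) :=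
    ((((continuous_apply 1).comp_continuousOn hc).pow k).mul
      (hr.continuousOn.comp hc hmaps)).smul continuousOn_const
  refine linear_ode_eqOn_Icc hA (u := fun s => Φ s x 1) (w := fun _ => 0) (fun s hs => ?_)
    (fun s _ => ?_) (left_mem_Icc.2 zero_le_one) ?_ hs
  · refine (hasDerivWithinAt_pi.1 (h.hasDerivWithinAt x hx s hs) 1).congr_deriv ?_
    simp only [hξr _ (hmaps hs), smul_apply, ContinuousLinearMap.id_apply, smul_eq_mul]
    ring
  · rw [map_zero]
    exact hasDerivWithinAt_const s _ 0
  · rw [h.initial x hx, hx1]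

lemma fderivWithin_apply_single (hU : IsOpen U) (hO : IsOpen O) (hξ : ξ ∈ stsr ρ₀ U)
    (h : IsFlowOn ξ (O ∩ halfSpace n) (region ρ₀ U) Φ)
    (hΦ : ContDiffOn ℝ ∞ (Function.uncurry Φ) (Icc (0 : ℝ) 1 ×ˢ (O ∩ halfSpace n)))
    {μ : Fin (n + 3)} (hμ : indexType μ ≠ 2) (hx : x ∈ O) (hx1 : x 1 = 0) :
    fderivWithin ℝ (Φ 1) (O ∩ halfSpace n) x (Pi.single μ 1) = Pi.single μ 1 := by
  have hadm := admissibleField_of_mem_stsr hU hξ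
  obtain ⟨T, V, hTV⟩ := hξ
  have hxW : x ∈ O ∩ halfSpace n := ⟨hx, hx1.ge⟩
  rw [region_eq_chart_inter_halfSpace] at h
  refine h.fderivWithin_apply_eq_self (uniqueDiffOn_inter_halfSpace hO)
    (inter_halfSpace_subset_closure_interior hO) (uniqueDiffOn_inter_halfSpace (isOpen_chart hU))
    (hΦ.of_le two_le_smooth)
    (((forall_smoothUpTo_iff_contDiffOn (isOpen_chart hU)).1 hadm.smooth).of_le (by simp)) hxW
    (fun s hs => ?_) (right_mem_Icc.2 zero_le_one)
  have hs_chart := (h.mapsTo s hs hxW).1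
  rw [fderivWithin_inter_halfSpace (isOpen_chart hU) ξ hs_chart]
  rw [← region_eq_chart_inter_halfSpace] at h
  exact hadm.fderivWithin_single_eq_zero hμ hs_chart (h.rho_eq_zero hTV.ρ hxW hx1 hs)

lemma horizonMap (hU : IsOpen U) (hO : IsOpen O) (hξ : ξ ∈ stsr ρ₀ U)
    (h : IsFlowOn ξ (O ∩ halfSpace n) (region ρ₀ U) Φ)
    (hΦ : ContDiffOn ℝ ∞ (Function.uncurry Φ) (Icc (0 : ℝ) 1 ×ˢ (O ∩ halfSpace n)))
    {φ : Coord n → Coord n} (hφ : EqOn φ (Φ 1) (O ∩ halfSpace n)) :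
    HorizonMap O (chart ρ₀ U) φ := by
  have h01 : (1 : ℝ) ∈ Icc (0 : ℝ) 1 := right_mem_Icc.2 zero_le_one
  have hslice : ContDiffOn ℝ ∞ (Φ 1) (O ∩ halfSpace n) :=
    hΦ.comp (contDiff_prodMk_right (1 : ℝ)).contDiffOn fun y hy => ⟨h01, hy⟩
  have hfderiv : ∀ x ∈ O, x 1 = 0 → fderivWithin ℝ φ (halfSpace n) x =
      fderivWithin ℝ (Φ 1) (O ∩ halfSpace n) x := fun x hx hx1 => by
    rw [← fderivWithin_inter_halfSpace hO φ hx, fderivWithin_congr hφ (hφ ⟨hx, hx1.ge⟩)]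
  have hregion : UniqueDiffOn ℝ (region ρ₀ U : Set (Coord n)) := uniqueDiffOn_region hU
  have hξ_smooth : ContDiffOn ℝ ∞ ξ (region ρ₀ U) := by
    rw [region_eq_chart_inter_halfSpace]
    exact (forall_smoothUpTo_iff_contDiffOn (isOpen_chart hU)).1
      (admissibleField_of_mem_stsr hU hξ).smooth
  refine ⟨(forall_smoothUpTo_iff_contDiffOn hO).2 (hslice.congr hφ), fun x hx hx' => ?_,
    fun x hx hx1 => ?_, fun x hx hx1 => ?_, fun x hx hx1 => ?_, fun x hx hx1 => ?_⟩
  · have hmem := h.mapsTo 1 h01 ⟨hx, hx'⟩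
    rwa [← hφ ⟨hx, hx'⟩, region_eq_chart_inter_halfSpace] at hmem
  · obtain ⟨T, V, hTV⟩ := hξ
    rw [hφ ⟨hx, hx1.ge⟩]
    exact h.rho_eq_zero hTV.ρ ⟨hx, hx1.ge⟩ hx1 h01
  · rw [hfderiv x hx hx1, h.fderivWithin_apply_single hU hO hξ hΦ (by simp) hx hx1]
  · rw [hfderiv x hx hx1, h.fderivWithin_apply_single hU hO hξ hΦ (by simp) hx hx1]
  · rw [hfderiv x hx hx1]
    exact h.injective_fderivWithin (uniqueDiffOn_inter_halfSpace hO)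
      (inter_halfSpace_subset_closure_interior hO) hregion (hΦ.of_le two_le_smooth)
      (hξ_smooth.of_le (by simp)) ⟨hx, hx1.ge⟩ h01

end IsFlowOn

lemma IsExpOn.exists_horizonMap (hU : IsOpen U) {ξ : VField n} (hξ : ξ ∈ stsr ρ₀ U)
    {W : Set (Coord n)} {φ : Coord n → Coord n} (h : IsExpOn ρ₀ U ξ W φ) :
    ∃ O, IsOpen O ∧ W = O ∩ halfSpace n ∧ HorizonMap O (chart ρ₀ U) φ := by
  obtain ⟨⟨O, hO, rfl⟩, Φ, hΦ, hflow⟩ := h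
  have hOc : IsOpen (O ∩ chart ρ₀ U) := hO.inter (isOpen_chart hU)
  have hW : O ∩ region ρ₀ U = (O ∩ chart ρ₀ U) ∩ halfSpace n := by
    rw [region_eq_chart_inter_halfSpace, inter_assoc]
  rw [hW] at hΦ hflow ⊢
  exact ⟨O ∩ chart ρ₀ U, hOc, rfl, IsFlowOn.horizonMap hU hOc hξ
    ⟨fun x hx => (hflow x hx).1, fun s hs x hx => ((hflow x hx).2.2 s hs).1,
      fun x hx s hs => ((hflow x hx).2.2 s hs).2⟩ hΦ fun x hx => (hflow x hx).2.1.symm⟩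

lemma Generated.exists_horizonMap (hU : IsOpen U) {W : Set (Coord n)} {φ : Coord n → Coord n}
    (h : Generated ρ₀ U (stsr ρ₀ U) W φ) :
    ∃ O, IsOpen O ∧ O ⊆ chart ρ₀ U ∧ W = O ∩ halfSpace n ∧ HorizonMap O (chart ρ₀ U) φ := by
  induction h with
  | refl O hO =>
    exact ⟨O ∩ chart ρ₀ U, hO.inter (isOpen_chart hU), inter_subset_right,
      by rw [region_eq_chart_inter_halfSpace, inter_assoc], horizonMap_id inter_subset_right⟩
  | step W W' φ φ' ξ _ hξ hφ' hW ih =>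
    obtain ⟨O, hO, hOc, rfl, hφ⟩ := ih
    obtain ⟨O', _, rfl, hφ'_map⟩ := hφ'.exists_horizonMap hU hξ
    have hφ_map : HorizonMap O O' φ := { hφ with maps := fun x hx hx' => hW ⟨hx, hx'⟩ }
    exact ⟨O, hO, hOc, rfl, hφ'_map.comp hO hφ_map⟩

end Generated

/-! ### The background metric -/

/-- The metric `fψψ dψ² + Ω_{AB} dθ^A dθ^B` induced on the horizon cross-section at the point with
coordinates `y = (ψ, θ^A)`. -/
def crossMetric (fψψ : (Fin n → ℝ) → ℝ) (Ω : (Fin n → ℝ) → Matrix (Fin n) (Fin n) ℝ)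
    (y : Fin (n + 1) → ℝ) : Matrix (Fin (n + 1)) (Fin (n + 1)) ℝ :=
  Matrix.of (Matrix.vecCons (Matrix.vecCons (fψψ (thetaPt y)) 0)
    fun A => Matrix.vecCons 0 (Ω (thetaPt y) A))

lemma det_crossMetric (fψψ : (Fin n → ℝ) → ℝ) (Ω : (Fin n → ℝ) → Matrix (Fin n) (Fin n) ℝ)
    (y : Fin (n + 1) → ℝ) :
    (crossMetric fψψ Ω y).det = fψψ (thetaPt y) * (Ω (thetaPt y)).det :=
  det_eq_mul_det_submatrix_succ fun _ => rfl

namespace IsBackground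

variable {ρ₀ : ℝ} {U : Set (Fin (n + 1) → ℝ)} {Λ κ : ℝ} {ftψ : (Fin n → ℝ) → ℝ}
  {ftA : (Fin n → ℝ) → Fin n → ℝ} {fψψ : (Fin n → ℝ) → ℝ}
  {Ω : (Fin n → ℝ) → Matrix (Fin n) (Fin n) ℝ} {g : Tensor2 n}

lemma vanishesToOrder_t_cross (hU : IsOpen U) (hg : IsBackground ρ₀ U Λ κ ftψ ftA fψψ Ω g)
    (M : Fin (n + 1)) : VanishesToOrder (chart ρ₀ U) 2 fun x => g x 0 M.succ.succ := by
  have hO : IsOpen (chart ρ₀ U : Set (Coord n)) := isOpen_chart hU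
  have hsplit : ∀ {A : (Fin (n + 1) → ℝ) → ℝ}, ContDiffOn ℝ ∞ A U → ∀ {f : Coord n → ℝ},
      SmoothO ρ₀ U 4 (fun x => f x - A (crossPt x) * x 1 ^ 2) →
      VanishesToOrder (chart ρ₀ U) 2 f := fun {A} hA {f} hf => by
    have hA_rho : VanishesToOrder (chart ρ₀ U) (0 + 2) fun x => A (crossPt x) * x 1 ^ 2 :=
      VanishesToOrder.mul hO (smoothUpTo_comp_crossPt hU hA) (vanishesToOrder_rho_pow hO 2)
    simpa only [sub_add_cancel] using
      ((hf.vanishesToOrder hU).mono (l := 2) (by simp)).add hO hA_rho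
  cases M using Fin.cases with
  | zero => exact hsplit hg.smooth_ftψ hg.tψ
  | succ A => exact hsplit (hg.smooth_ftA A) (hg.tA A)

lemma vanishesToOrder_ρ_cross (hU : IsOpen U) (hg : IsBackground ρ₀ U Λ κ ftψ ftA fψψ Ω g)
    (M : Fin (n + 1)) : VanishesToOrder (chart ρ₀ U) 1 fun x => g x 1 M.succ.succ := by
  cases M using Fin.cases with
  | zero => exact (hg.ρψ.vanishesToOrder hU).mono (by simp)
  | succ A => exact ((hg.ρA A).vanishesToOrder hU).mono (by simp)

lemma contDiffOn_crossMetric (hg : IsBackground ρ₀ U Λ κ ftψ ftA fψψ Ω g) (M N : Fin (n + 1)) :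
    ContDiffOn ℝ ∞ (fun y => crossMetric fψψ Ω y M N) U := by
  cases M using Fin.cases with
  | zero =>
    cases N using Fin.cases with
    | zero => exact hg.smooth_fψψ
    | succ B => exact contDiffOn_const
  | succ A =>
    cases N using Fin.cases with
    | zero => exact contDiffOn_const
    | succ B => exact hg.smooth_Ω A B

lemma vanishesToOrder_sub_crossMetric (hU : IsOpen U)
    (hg : IsBackground ρ₀ U Λ κ ftψ ftA fψψ Ω g) (M N : Fin (n + 1)) :
    VanishesToOrder (chart ρ₀ U) 2 fun x =>
      g x M.succ.succ N.succ.succ - crossMetric fψψ Ω (crossPt x) M N := by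
  have hψA (A : Fin n) := (hg.ψA A).vanishesToOrder hU
  cases M using Fin.cases with
  | zero =>
    cases N using Fin.cases with
    | zero => exact hg.ψψ.vanishesToOrder hU
    | succ B => exact (hψA B).congr (isOpen_chart hU) fun x _ _ => sub_zero _
  | succ A =>
    cases N using Fin.cases with
    | zero =>
      refine (hψA A).congr (isOpen_chart hU) fun x hx hx' => ?_
      exact (sub_zero _).trans ((hg.symm x ⟨hx', hx.1, hx.2⟩).apply _ _)
    | succ B => exact (hg.AB A B).vanishesToOrder hU

lemma horizonMetric (hU : IsOpen U) (hg : IsBackground ρ₀ U Λ κ ftψ ftA fψψ Ω g) :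
    HorizonMetric κ (chart ρ₀ U) g where
  symm x hx hx' := hg.symm x ⟨hx', hx.1, hx.2⟩
  tt := by simpa only [neg_mul] using (hg.tt.vanishesToOrder hU).mono (l := 3) (by simp)
  tρ := (hg.tρ.vanishesToOrder hU).mono (by simp)
  tM := hg.vanishesToOrder_t_cross hU
  ρρ := (hg.ρρ.vanishesToOrder hU).mono (by simp)
  ρM := hg.vanishesToOrder_ρ_cross hU
  stationary M N := by
    have hγ := hg.contDiffOn_crossMetric M N
    have hMN := hg.vanishesToOrder_sub_crossMetric hU M N
    exact ⟨hMN.smoothUpTo_of_sub_crossPt hU hγ,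
      (hMN.pdWithin_t_of_sub_crossPt hU hγ).mono (by simp)⟩
  crossBlock_det_pos p hp hp1 := by
    have hblock : crossBlock (g p) = crossMetric fψψ Ω (crossPt p) := by
      ext M N
      exact sub_eq_zero.1 ((hg.vanishesToOrder_sub_crossMetric hU M N).eq_zero hp hp1)
    rw [hblock, det_crossMetric]
    exact mul_pos (hg.fψψ_pos _ hp.2) (hg.Ω_posDef _ hp.2).det_pos

end IsBackground

/-! ### Integrability -/

section Integrability

variable {ρ₀ κ : ℝ} {U : Set (Fin (n + 1) → ℝ)} {g : Tensor2 n}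

lemma AdmissibleField.subset {O O' : Set (Coord n)} {ξ : VField n} (hξ : AdmissibleField O ξ)
    (h : O' ⊆ O) : AdmissibleField O' ξ where
  smooth α := fun x hx => hξ.smooth α x (h hx)
  ρ := hξ.ρ.subset h
  pd_t α := (hξ.pd_t α).subset h
  pd_ρ α := (hξ.pd_ρ α).subset h

lemma chargesIntegrable (hU : IsOpen U) (hκ : κ ≠ 0) (G : ℝ)
    (hg : HorizonMetric κ (chart ρ₀ U) g) : ChargesIntegrable G ρ₀ U g (stsr ρ₀ U) := by
  intro W φ hφ ξ hξ η hη χ hχ t K hK hKW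
  obtain ⟨O, hO, hO_chart, rfl, hφ_map⟩ := hφ.exists_horizonMap hU
  have hφg : HorizonMetric κ O (pullbackWithin φ g) :=
    hg.pullbackWithin hO (isOpen_chart hU) hφ_map
  have hadm {ζ : VField n} (hζ : ζ ∈ stsr ρ₀ U) : AdmissibleField O ζ :=
    (admissibleField_of_mem_stsr hU hζ).subset hO_chart
  have heq := pullback_eqOn_pullbackWithin φ g
  have hcont : ∀ y ∈ K, ∀ᶠ x in 𝓝[openHalfSpace n] (slicePt t 0 y),
      ContinuousAt (integrand G (pullback φ g) ξ η χ) x := fun y hy =>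
    hφg.eventually_continuousAt_integrand hO hκ heq G (hadm hξ) (hadm hη) (hadm hχ) (hKW y hy).1 rfl
  refine ⟨eventually_integrableOn_slicePt hK hcont,
    tendsto_setIntegral_slicePt hK hcont fun y hy => ?_⟩
  exact (hφg.isBigORho_integrand hO hκ heq G (hadm hξ) (hadm hη) (hadm hχ) (hKW y hy).1
    rfl).tendsto_zero rfl

lemma horizonBigO_of_isBigORho {k : ℕ} {l : ℤ} {f : Coord n → ℝ} (hkl : k ≤ l)
    (h : ∀ p ∈ chart ρ₀ U, p 1 = 0 → IsBigORho p l f) : HorizonBigO ρ₀ U k f := by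
  rintro p ⟨hp, hp1⟩
  have hle : 𝓝[exterior ρ₀ U] p ≤ 𝓝[openHalfSpace n] p := nhdsWithin_mono p fun _ hx => hx.2
  simpa only [zpow_natCast] using
    Asymptotics.IsBigO.mono ((h p ⟨hp.2.1, hp.2.2⟩ hp1).mono hp1 hkl) hle

lemma sufficientCondition (hU : IsOpen U) (hκ : κ ≠ 0) (G : ℝ)
    (hg : HorizonMetric κ (chart ρ₀ U) g) : SufficientCondition G ρ₀ U g (stsr ρ₀ U) := by
  refine ⟨fun ξ hξ => ?_, fun η hη χ hχ => ?_⟩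
  · have hξ_order (α : Fin (n + 3)) (p : Coord n) (hp : p ∈ chart ρ₀ U) (hp1 : p 1 = 0) :=
      ((admissibleField_of_mem_stsr hU hξ).order α).isBigORho (isOpen_chart hU) hp hp1
    exact ⟨horizonBigO_of_isBigORho (by simp) (hξ_order 0),
      horizonBigO_of_isBigORho (by simp [fieldOrder]) (hξ_order 1),
      fun M => horizonBigO_of_isBigORho (by simp) (hξ_order M.succ.succ)⟩
  · have hω_order (ν : Fin (n + 3)) (p : Coord n) (hp : p ∈ chart ρ₀ U) (hp1 : p 1 = 0) :=
      hg.isBigORho_presymplecticCurrent_lieDeriv (isOpen_chart hU) hκ (eqOn_refl g _) G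
        (admissibleField_of_mem_stsr hU hη) (admissibleField_of_mem_stsr hU hχ) hp hp1 ν
    exact ⟨horizonBigO_of_isBigORho (by simp [weight]) (hω_order 0),
      horizonBigO_of_isBigORho (by simp [weight]) (hω_order 1),
      fun M => horizonBigO_of_isBigORho (by simp [weight]) (hω_order M.succ.succ)⟩

end Integrability

/-! ### The algebra -/

section Algebra

variable {ρ₀ : ℝ} {U : Set (Fin (n + 1) → ℝ)}

namespace SmoothO

variable {f h : Coord n → ℝ} {k : ℕ}

lemma congr (hf : SmoothO ρ₀ U k f) (hh : ∀ x ∈ region ρ₀ U, h x = f x) : SmoothO ρ₀ U k h := by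
  obtain ⟨r, hr, hfr⟩ := hf
  exact ⟨r, hr, fun x hx => (hh x hx).trans (hfr x hx)⟩

protected lemma zero : SmoothO ρ₀ U k fun _ => 0 :=
  ⟨fun _ => 0, contDiffOn_const, fun _ _ => (mul_zero _).symm⟩

protected lemma add (hf : SmoothO ρ₀ U k f) (hh : SmoothO ρ₀ U k h) :
    SmoothO ρ₀ U k fun x => f x + h x := by
  obtain ⟨r, hr, hfr⟩ := hf
  obtain ⟨s, hs, hhs⟩ := hh
  refine ⟨fun x => r x + s x, hr.add hs, fun x hx => ?_⟩
  rw [mul_add, ← hfr x hx, ← hhs x hx]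

lemma const_mul (hf : SmoothO ρ₀ U k f) (c : ℝ) : SmoothO ρ₀ U k fun x => c * f x := by
  obtain ⟨r, hr, hfr⟩ := hf
  refine ⟨fun x => c * r x, contDiffOn_const.mul hr, fun x hx => ?_⟩
  rw [mul_left_comm, ← hfr x hx]

protected lemma sub (hf : SmoothO ρ₀ U k f) (hh : SmoothO ρ₀ U k h) :
    SmoothO ρ₀ U k fun x => f x - h x :=
  (hf.add (hh.const_mul (-1))).congr fun _ _ => by ring

end SmoothO

namespace HasLeading

variable {ξ η : VField n} {T T₁ T₂ : (Fin (n + 1) → ℝ) → ℝ}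
  {V V₁ V₂ : (Fin (n + 1) → ℝ) → Fin (n + 1) → ℝ}

protected lemma zero : HasLeading ρ₀ U (0 : VField n) 0 0 where
  smooth_T := contDiffOn_const
  smooth_V := contDiffOn_const
  t := SmoothO.zero.congr fun _ _ => sub_zero _
  ρ := SmoothO.zero
  cross _ := SmoothO.zero.congr fun _ _ => sub_zero _

protected lemma add (hξ : HasLeading ρ₀ U ξ T₁ V₁) (hη : HasLeading ρ₀ U η T₂ V₂) :
    HasLeading ρ₀ U (ξ + η) (T₁ + T₂) (V₁ + V₂) where
  smooth_T := hξ.smooth_T.add hη.smooth_T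
  smooth_V := hξ.smooth_V.add hη.smooth_V
  t := (hξ.t.add hη.t).congr fun _ _ => add_sub_add_comm _ _ _ _
  ρ := hξ.ρ.add hη.ρ
  cross M := ((hξ.cross M).add (hη.cross M)).congr fun _ _ => add_sub_add_comm _ _ _ _

protected lemma const_smul (c : ℝ) (hξ : HasLeading ρ₀ U ξ T V) :
    HasLeading ρ₀ U (c • ξ) (c • T) (c • V) where
  smooth_T := hξ.smooth_T.const_smul c
  smooth_V := hξ.smooth_V.const_smul c
  t := (hξ.t.const_mul c).congr fun _ _ => (mul_sub _ _ _).symm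
  ρ := hξ.ρ.const_mul c
  cross M := ((hξ.cross M).const_mul c).congr fun _ _ => (mul_sub _ _ _).symm

lemma contDiffOn (hU : IsOpen U) (hξ : HasLeading ρ₀ U ξ T V) :
    ContDiffOn ℝ ∞ ξ (region ρ₀ U) := by
  rw [region_eq_chart_inter_halfSpace]
  exact (forall_smoothUpTo_iff_contDiffOn (isOpen_chart hU)).1 (hξ.admissibleField hU).smooth

lemma exists_crossCLM_eq (hξ : HasLeading ρ₀ U ξ T V) :
    ∃ s : Coord n → Fin (n + 1) → ℝ, ContDiffOn ℝ ∞ s (region ρ₀ U) ∧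
      ∀ x ∈ region ρ₀ U, crossCLM n (ξ x) = V (crossPt x) + x 1 ^ 2 • s x := by
  choose s hs hξs using hξ.cross
  refine ⟨fun x M => s M x, contDiffOn_pi.2 hs, fun x hx => funext fun M => ?_⟩
  exact sub_eq_iff_eq_add'.1 (hξs M x hx)

end HasLeading

section Derivative

variable {A : (Fin (n + 1) → ℝ) → ℝ} {f r : Coord n → ℝ} {x : Coord n}

lemma fderivWithin_apply_of_eq_comp_crossPt_add (hU : IsOpen U)
    (hA : DifferentiableAt ℝ A (crossPt x)) (hr : DifferentiableWithinAt ℝ r (region ρ₀ U) x)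
    (hf : ∀ y ∈ region ρ₀ U, f y = A (crossPt y) + y 1 ^ 2 * r y) (hx : x ∈ region ρ₀ U)
    (v : Coord n) :
    fderivWithin ℝ f (region ρ₀ U) x v = fderiv ℝ A (crossPt x) (crossCLM n v)
      + (x 1 ^ 2 * fderivWithin ℝ r (region ρ₀ U) x v + r x * (2 * x 1 * v 1)) := by
  have hρ : HasFDerivWithinAt (fun y : Coord n => y 1)
      (ContinuousLinearMap.proj (R := ℝ) (φ := fun _ => ℝ) 1) (region ρ₀ U) x :=
    (ContinuousLinearMap.proj (R := ℝ) (φ := fun _ => ℝ) 1).hasFDerivWithinAt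
  have hderiv := (hasFDerivAt_comp_crossPt hA).hasFDerivWithinAt.add
    ((hρ.pow 2).mul hr.hasFDerivWithinAt)
  rw [(hderiv.congr hf (hf x hx)).fderivWithin (uniqueDiffOn_region hU x hx)]
  simp [mul_assoc]

lemma HasLeading.smoothO_fderivWithin_sub (hU : IsOpen U) {ξ : VField n}
    {T : (Fin (n + 1) → ℝ) → ℝ} {V : (Fin (n + 1) → ℝ) → Fin (n + 1) → ℝ}
    (hξ : HasLeading ρ₀ U ξ T V) (hA : ContDiffOn ℝ ∞ A U)
    (hf : SmoothO ρ₀ U 2 fun x => f x - A (crossPt x)) :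
    SmoothO ρ₀ U 2 fun x => fderivWithin ℝ f (region ρ₀ U) x (ξ x)
      - fderiv ℝ A (crossPt x) (V (crossPt x)) := by
  obtain ⟨r, hr, hfr⟩ := hf
  obtain ⟨q, hq, hξq⟩ := hξ.ρ
  obtain ⟨s, hs, hξs⟩ := hξ.exists_crossCLM_eq
  have hA_fderiv : ContDiffOn ℝ ∞ (fun x : Coord n => fderiv ℝ A (crossPt x)) (region ρ₀ U) :=
    (hA.fderiv_of_isOpen hU (by simp)).comp (crossCLM n).contDiff.contDiffOn fun x hx => hx.2.2
  have hρ : ContDiffOn ℝ ∞ (fun x : Coord n => x 1) (region ρ₀ U) :=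
    (contDiff_apply ℝ ℝ 1).contDiffOn
  have hr_fderiv : ContDiffOn ℝ ∞ (fun x => fderivWithin ℝ r (region ρ₀ U) x (ξ x))
      (region ρ₀ U) :=
    (hr.fderivWithin (uniqueDiffOn_region hU) (by simp)).clm_apply (hξ.contDiffOn hU)
  refine ⟨fun x => fderiv ℝ A (crossPt x) (s x) +
      (fderivWithin ℝ r (region ρ₀ U) x (ξ x) + r x * (2 * x 1 * q x)),
    (hA_fderiv.clm_apply hs).add (hr_fderiv.add (hr.mul ((contDiffOn_const.mul hρ).mul hq))),
    fun x hx => ?_⟩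
  beta_reduce
  rw [fderivWithin_apply_of_eq_comp_crossPt_add hU
    ((hA.contDiffAt (hU.mem_nhds hx.2.2)).differentiableAt (by simp))
    ((hr x hx).differentiableWithinAt (by simp)) (fun y hy => sub_eq_iff_eq_add'.1 (hfr y hy)) hx,
    hξs x hx, show ξ x 1 = x 1 ^ 2 * q x from hξq x hx, map_add, map_smul, smul_eq_mul]
  ring

end Derivative

lemma lieBracketWithin_apply {s : Set (Coord n)} {ξ η : VField n} {x : Coord n}
    (hs : UniqueDiffWithinAt ℝ s x) (hξ : DifferentiableWithinAt ℝ ξ s x)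
    (hη : DifferentiableWithinAt ℝ η s x) (α : Fin (n + 3)) :
    VectorField.lieBracketWithin ℝ ξ η s x α =
      fderivWithin ℝ (fun y => η y α) s x (ξ x) - fderivWithin ℝ (fun y => ξ y α) s x (η x) := by
  rw [fderivWithin_apply hη hs, fderivWithin_apply hξ hs]
  rfl

namespace HasLeading

variable {ξ η : VField n} {T₁ T₂ : (Fin (n + 1) → ℝ) → ℝ}
  {V₁ V₂ : (Fin (n + 1) → ℝ) → Fin (n + 1) → ℝ}

lemma smoothO_lieBracketWithin_sub (hU : IsOpen U) (hξ : HasLeading ρ₀ U ξ T₁ V₁)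
    (hη : HasLeading ρ₀ U η T₂ V₂) {α : Fin (n + 3)} {A₁ A₂ : (Fin (n + 1) → ℝ) → ℝ}
    (hA₁ : ContDiffOn ℝ ∞ A₁ U) (hA₂ : ContDiffOn ℝ ∞ A₂ U)
    (hξα : SmoothO ρ₀ U 2 fun x => ξ x α - A₁ (crossPt x))
    (hηα : SmoothO ρ₀ U 2 fun x => η x α - A₂ (crossPt x)) :
    SmoothO ρ₀ U 2 fun x => VectorField.lieBracketWithin ℝ ξ η (region ρ₀ U) x α -
      (fderiv ℝ A₂ (crossPt x) (V₁ (crossPt x)) - fderiv ℝ A₁ (crossPt x) (V₂ (crossPt x))) := by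
  refine ((hξ.smoothO_fderivWithin_sub hU hA₂ hηα).sub
    (hη.smoothO_fderivWithin_sub hU hA₁ hξα)).congr fun x hx => ?_
  rw [lieBracketWithin_apply (uniqueDiffOn_region hU x hx)
    ((hξ.contDiffOn hU x hx).differentiableWithinAt (by simp))
    ((hη.contDiffOn hU x hx).differentiableWithinAt (by simp))]
  exact sub_sub_sub_comm _ _ _ _

lemma lieBracketWithin (hU : IsOpen U) (hξ : HasLeading ρ₀ U ξ T₁ V₁)
    (hη : HasLeading ρ₀ U η T₂ V₂) :
    HasLeading ρ₀ U (VectorField.lieBracketWithin ℝ ξ η (region ρ₀ U))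
      (fun y => fderiv ℝ T₂ y (V₁ y) - fderiv ℝ T₁ y (V₂ y))
      (fun y => fderiv ℝ V₂ y (V₁ y) - fderiv ℝ V₁ y (V₂ y)) where
  smooth_T := ((hη.smooth_T.fderiv_of_isOpen hU (by simp)).clm_apply hξ.smooth_V).sub
    ((hξ.smooth_T.fderiv_of_isOpen hU (by simp)).clm_apply hη.smooth_V)
  smooth_V := ((hη.smooth_V.fderiv_of_isOpen hU (by simp)).clm_apply hξ.smooth_V).sub
    ((hξ.smooth_V.fderiv_of_isOpen hU (by simp)).clm_apply hη.smooth_V)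
  t := hξ.smoothO_lieBracketWithin_sub hU hη hξ.smooth_T hη.smooth_T hξ.t hη.t
  ρ := by
    simpa only [fderiv_fun_const, Pi.zero_apply, zero_apply, sub_zero] using
      hξ.smoothO_lieBracketWithin_sub hU hη (α := 1) (contDiffOn_const (c := 0))
        (contDiffOn_const (c := 0)) (by simpa only [sub_zero] using hξ.ρ)
        (by simpa only [sub_zero] using hη.ρ)
  cross M := by
    refine (hξ.smoothO_lieBracketWithin_sub hU hη (contDiffOn_pi.1 hξ.smooth_V M)
      (contDiffOn_pi.1 hη.smooth_V M) (hξ.cross M) (hη.cross M)).congr fun x hx => ?_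
    rw [fderiv_apply ((hη.smooth_V.contDiffAt (hU.mem_nhds hx.2.2)).differentiableAt (by simp)),
      fderiv_apply ((hξ.smooth_V.contDiffAt (hU.mem_nhds hx.2.2)).differentiableAt (by simp))]
    rfl

end HasLeading

lemma isClosedAlgebra_stsr (hU : IsOpen U) : IsClosedAlgebra ρ₀ U (stsr (n := n) ρ₀ U) := by
  refine ⟨⟨0, 0, .zero⟩, ?_, ?_, ?_⟩
  · rintro ξ ⟨T₁, V₁, hξ⟩ η ⟨T₂, V₂, hη⟩
    exact ⟨_, _, hξ.add hη⟩
  · rintro c ξ ⟨T, V, hξ⟩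
    exact ⟨_, _, hξ.const_smul c⟩
  · rintro ξ ⟨T₁, V₁, hξ⟩ η ⟨T₂, V₂, hη⟩
    exact ⟨_, _, hξ.lieBracketWithin hU hη⟩

end Algebra

end KillingHorizon

end

theorem mainTheorem4_general (n : ℕ) (G κ ρ₀ : ℝ) (_hG : G ≠ 0) (hκ : κ ≠ 0)
    (U : Set (Fin (n + 1) → ℝ)) (hU : IsOpen U) (g : KillingHorizon.Tensor2 n)
    (hg : KillingHorizon.HorizonMetric κ (KillingHorizon.chart ρ₀ U) g) :
    (∀ (ξ η : KillingHorizon.VField n) (T₁ T₂ : (Fin (n + 1) → ℝ) → ℝ)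
      (V₁ V₂ : (Fin (n + 1) → ℝ) → Fin (n + 1) → ℝ),
      KillingHorizon.HasLeading ρ₀ U ξ T₁ V₁ → KillingHorizon.HasLeading ρ₀ U η T₂ V₂ →
      KillingHorizon.HasLeading ρ₀ U
        (VectorField.lieBracketWithin ℝ ξ η (KillingHorizon.region ρ₀ U))
        (fun y => fderiv ℝ T₂ y (V₁ y) - fderiv ℝ T₁ y (V₂ y))
        (fun y => fderiv ℝ V₂ y (V₁ y) - fderiv ℝ V₁ y (V₂ y))) ∧
    KillingHorizon.IsClosedAlgebra ρ₀ U (KillingHorizon.stsr ρ₀ U) ∧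
    KillingHorizon.SufficientCondition G ρ₀ U g (KillingHorizon.stsr ρ₀ U) ∧
    KillingHorizon.ChargesIntegrable G ρ₀ U g (KillingHorizon.stsr ρ₀ U) :=
  ⟨fun _ _ _ _ _ _ hξ hη => hξ.lieBracketWithin hU hη, KillingHorizon.isClosedAlgebra_stsr hU,
    KillingHorizon.sufficientCondition hU hκ G hg, KillingHorizon.chargesIntegrable hU hκ G hg⟩

theorem mainTheorem4 (n : ℕ) (G Λ κ ρ₀ : ℝ) (hG : 0 < G) (hκ : κ ≠ 0) (hρ₀ : 0 < ρ₀)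
    (U : Set (Fin (n + 1) → ℝ)) (hU : IsOpen U)
    (ftψ : (Fin n → ℝ) → ℝ) (ftA : (Fin n → ℝ) → Fin n → ℝ) (fψψ : (Fin n → ℝ) → ℝ)
    (Ω : (Fin n → ℝ) → Matrix (Fin n) (Fin n) ℝ) (g : KillingHorizon.Tensor2 n)
    (hg : KillingHorizon.IsBackground ρ₀ U Λ κ ftψ ftA fψψ Ω g) :
    (∀ (ξ η : KillingHorizon.VField n) (T₁ T₂ : (Fin (n + 1) → ℝ) → ℝ)
      (V₁ V₂ : (Fin (n + 1) → ℝ) → Fin (n + 1) → ℝ),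
      KillingHorizon.HasLeading ρ₀ U ξ T₁ V₁ → KillingHorizon.HasLeading ρ₀ U η T₂ V₂ →
      KillingHorizon.HasLeading ρ₀ U
        (VectorField.lieBracketWithin ℝ ξ η (KillingHorizon.region ρ₀ U))
        (fun y => fderiv ℝ T₂ y (V₁ y) - fderiv ℝ T₁ y (V₂ y))
        (fun y => fderiv ℝ V₂ y (V₁ y) - fderiv ℝ V₁ y (V₂ y))) ∧
    KillingHorizon.IsClosedAlgebra ρ₀ U (KillingHorizon.stsr ρ₀ U) ∧
    KillingHorizon.SufficientCondition G ρ₀ U g (KillingHorizon.stsr ρ₀ U) ∧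
    KillingHorizon.ChargesIntegrable G ρ₀ U g (KillingHorizon.stsr ρ₀ U) := by
  exact mainTheorem4_general n G κ ρ₀ hG.ne' hκ U hU g (hg.horizonMetric hU)
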